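/- Let $p$ be a prime and $n\ge 1$ an integer. Let $\mathfrak g=\mathfrak{gl}_2(\mathbb Q_p)=M_2(\mathbb Q_p)$, with universal enveloping algebra $U(\mathfrak g)$ over $\mathbb Q_p$, and let $$e=\begin{pmatrix}0&1\\0&0\end{pmatrix},\quad h_1=\begin{pmatrix}1&0\\0&0\end{pmatrix},\quad h_2=\begin{pmatrix}0&0\\0&1\end{pmatrix},\quad f=\begin{pmatrix}0&0\\1&0\end{pmatrix}.$$ Let $\mathbb G(n)^\circ$ be the wide open rigid analytic group over $\mathbb Q_p$ whose points with values in a complete valued extension $L$ of $\mathbb Q_p$ are the matrices $g\in GL_2(L)$ such that all entries of $g-1$ lie in $p^n\mathfrak m_L$, where $\mathfrak m_L$ is the maximal ideal of the valuation ring of $L$. Writing $g=1+p^n\begin{pmatrix}a_n&b_n\\c_n&d_n\end{pmatrix}$, its ring of functions $\mathcal O(\mathbb G(n)^\circ)$ is the space of power series $F=\sum_{\mu\in\mathbb N^4}\xi_\mu\, a_n^{\mu_1}b_n^{\mu_2}c_n^{\mu_3}d_n^{\mu_4}$ over $\mathbb Q_p$ with $|\xi_\mu|r^{|\mu|}\to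 0$ for every $0<r<1$, with the Fréchet topology given by the norms $\|F\|_r=\sup_\mu|\xi_\mu|r^{|\mu|}$, $0<r<1$. Let $\mathcal D^{\rm an}(\mathbb G(n)^\circ)=\mathcal O(\mathbb G(n)^\circ)'_b$ be its continuous dual with the strong topology; it is a $\mathbb Q_p$-algebra under convolution, $(\delta*\delta')(F)=(\delta\otimes\delta')\big((g,h)\mapsto F(gh)\big)$. For $m,\nu\in\mathbb N$ put $q^{(m)}_\nu=\lfloor \nu/p^m\rfloor$, and let $U(p^n\mathfrak g_{\mathbb Z_p})^{(m)}\subset U(\mathfrak g)$ be the $\mathbb Z_p$-submodule generated by the elements $$q^{(m)}_{\nu_1}!\,\frac{(p^ne)^{\nu_1}}{\nu_1!}\cdot q^{(m)}_{\nu_2}!\,p^{n\nu_2}\binom{h_1}{\nu_2}\cdot q^{(m)}_{\nu_3}!\,p^{n\nu_3}\binom{h_2}{\nu_3}\cdot q^{(m)}_{\nu_4}!\,\frac{(p^nf)^{\nu_4}}{\nu_4!},\qquad \nu_1,\nu_2,\nu_3,\nu_4\in\mathbb N .$$ Then: (1) For every $m\ge 0$, $U(p^n\mathfrak g_{\mathbb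 Z_p})^{(m)}$ is a $\mathbb Z_p$-subalgebra of $U(\mathfrak g)$. Let $\widehat U(p^n\mathfrak g_{\mathbb Z_p})^{(m)}=\varprojlim_k U(p^n\mathfrak g_{\mathbb Z_p})^{(m)}/p^k$ be its $p$-adic completion, and $\widehat U(p^n\mathfrak g_{\mathbb Z_p})^{(m)}_{\mathbb Q}=\widehat U(p^n\mathfrak g_{\mathbb Z_p})^{(m)}\otimes_{\mathbb Z}\mathbb Q$, a $\mathbb Q_p$-Banach space with the image of $\widehat U(p^n\mathfrak g_{\mathbb Z_p})^{(m)}$ as unit ball. (2) There is a unique $\mathbb Q_p$-algebra homomorphism $\lambda:U(\mathfrak g)\to\mathcal D^{\rm an}(\mathbb G(n)^\circ)$ that sends each $X\in\mathfrak g$ to the linear form $F\mapsto\frac{d}{dt}F(e^{tX})\big|_{t=0}$. (3) For every $m\ge 0$, the restriction of $\lambda$ to $U(p^n\mathfrak g_{\mathbb Z_p})^{(m)}$ extends uniquely to a continuous map $\Psi_m:\widehat U(p^n\mathfrak g_{\mathbb Z_p})^{(m)}\to\mathcal D^{\rm an}(\mathbb G(n)^\circ)$ for the $p$-adic topology on the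 source, and $\Psi_m$ is a homomorphism of $\mathbb Z_p$-algebras. (4) The maps $\Psi_m$ induce an isomorphism of topological $\mathbb Q_p$-algebras $$\varinjlim_m\widehat U(p^n\mathfrak g_{\mathbb Z_p})^{(m)}_{\mathbb Q}\;\xrightarrow{\ \simeq\ }\;\mathcal D^{\rm an}(\mathbb G(n)^\circ),$$ that is, an algebra isomorphism which is a homeomorphism, where the left side, formed along the maps induced by the inclusions $U(p^n\mathfrak g_{\mathbb Z_p})^{(m)}\subset U(p^n\mathfrak g_{\mathbb Z_p})^{(m+1)}$, carries the locally convex inductive limit topology. -/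

import Mathlib

open scoped TensorProduct Topology

noncomputable section

namespace GL2Dist

/-- Index set of the four coordinates `a_n = x₀₀`, `b_n = x₀₁`, `c_n = x₁₀`, `d_n = x₁₁`. -/
abbrev Idx : Type := Fin 2 × Fin 2

section Functions

variable (p : ℕ) [Fact p.Prime]

/-- Power series `∑ ξ_μ x^μ` over `ℚ_p` in the four coordinates with `|ξ_μ| r^|μ| → 0`
for every `0 < r < 1`. -/
def wideOpenSubmodule : Submodule ℚ_[p] (MvPowerSeries Idx ℚ_[p]) where
  carrier := {F | ∀ r : ℝ, 0 < r → r < 1 →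
    Filter.Tendsto (fun μ : Idx →₀ ℕ => ‖MvPowerSeries.coeff μ F‖ * r ^ μ.degree)
      Filter.cofinite (𝓝 0)}
  zero_mem' := by
    intro r _ _
    simp
  add_mem' := by
    intro F G hF hG r h0 h1
    refine squeeze_zero (fun μ => by positivity) (fun μ => ?_)
      (by simpa using (hF r h0 h1).add (hG r h0 h1))
    rw [map_add, ← add_mul]
    gcongr
    exact norm_add_le _ _
  smul_mem' := by
    intro c F hF r h0 h1
    have := (hF r h0 h1).const_mul ‖c‖
    simpa [mul_assoc] using this

/-- The algebra `𝒪(𝔾(n)°)` of rigid analytic functions on the wide open four-dimensional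
unit polydisc with coordinates `a_n, b_n, c_n, d_n`, as a vector space over `ℚ_p`. -/
def WideOpenFun : Type := wideOpenSubmodule p

instance : AddCommGroup (WideOpenFun p) := inferInstanceAs (AddCommGroup (wideOpenSubmodule p))

instance : Module ℚ_[p] (WideOpenFun p) := inferInstanceAs (Module ℚ_[p] (wideOpenSubmodule p))

variable {p}

/-- The coefficient of `x^μ`. -/
def WideOpenFun.coeff (μ : Idx →₀ ℕ) : WideOpenFun p →ₗ[ℚ_[p]] ℚ_[p] :=
  (MvPowerSeries.coeff μ) ∘ₗ (wideOpenSubmodule p).subtype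

lemma WideOpenFun.ext {F G : WideOpenFun p} (h : ∀ μ, F.coeff μ = G.coeff μ) : F = G :=
  Subtype.ext (MvPowerSeries.ext h)

lemma WideOpenFun.tendsto (F : WideOpenFun p) {r : ℝ} (h0 : 0 < r) (h1 : r < 1) :
    Filter.Tendsto (fun μ : Idx →₀ ℕ => ‖F.coeff μ‖ * r ^ μ.degree) Filter.cofinite (𝓝 0) :=
  F.2 r h0 h1

lemma WideOpenFun.bddAbove (F : WideOpenFun p) {r : ℝ} (h0 : 0 < r) (h1 : r < 1) :
    BddAbove (Set.range fun μ : Idx →₀ ℕ => ‖F.coeff μ‖ * r ^ μ.degree) :=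
  (F.tendsto h0 h1).bddAbove_range_of_cofinite

/-- The Gauss norm `‖F‖_r = sup_μ |ξ_μ| r^|μ|` of radius `r`, for `0 < r < 1`. -/
def gaussNorm (r : Set.Ioo (0 : ℝ) 1) : Seminorm ℚ_[p] (WideOpenFun p) :=
  Seminorm.of (fun F => ⨆ μ : Idx →₀ ℕ, ‖F.coeff μ‖ * (r : ℝ) ^ μ.degree)
    (by
      intro F G
      refine ciSup_le fun μ => ?_
      have hr := r.2.1
      calc ‖(F + G).coeff μ‖ * (r : ℝ) ^ μ.degree
          ≤ ‖F.coeff μ‖ * (r : ℝ) ^ μ.degree + ‖G.coeff μ‖ * (r : ℝ) ^ μ.degree := by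
            rw [map_add, ← add_mul]; gcongr; exact norm_add_le _ _
        _ ≤ _ := add_le_add (le_ciSup (F.bddAbove r.2.1 r.2.2) μ)
            (le_ciSup (G.bddAbove r.2.1 r.2.2) μ))
    (by
      intro c F
      rw [Real.mul_iSup_of_nonneg (norm_nonneg c)]
      simp [mul_assoc])

lemma le_gaussNorm (r : Set.Ioo (0 : ℝ) 1) (F : WideOpenFun p) (μ : Idx →₀ ℕ) :
    ‖F.coeff μ‖ * (r : ℝ) ^ μ.degree ≤ gaussNorm r F :=
  le_ciSup (F.bddAbove r.2.1 r.2.2) μ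

lemma gaussNorm_le (r : Set.Ioo (0 : ℝ) 1) (F : WideOpenFun p) {C : ℝ}
    (h : ∀ μ, ‖F.coeff μ‖ * (r : ℝ) ^ μ.degree ≤ C) : gaussNorm r F ≤ C :=
  ciSup_le h

lemma gaussNorm_mono {r s : Set.Ioo (0 : ℝ) 1} (h : r ≤ s) :
    gaussNorm (p := p) r ≤ gaussNorm s := by
  intro F
  refine gaussNorm_le r F fun μ => le_trans ?_ (le_gaussNorm s F μ)
  have := r.2.1
  gcongr

instance : Nonempty (Set.Ioo (0 : ℝ) 1) := ⟨⟨1 / 2, by norm_num, by norm_num⟩⟩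

variable (p) in
/-- The family of all Gauss norms `‖·‖_r`, `0 < r < 1`. -/
def gaussFamily : SeminormFamily ℚ_[p] (WideOpenFun p) (Set.Ioo (0 : ℝ) 1) := gaussNorm

/-- The Fréchet topology of `𝒪(𝔾(n)°) = lim_{r<1} 𝒪(𝔾(n)_r)`. -/
instance : TopologicalSpace (WideOpenFun p) := (gaussFamily p).moduleFilterBasis.topology

lemma gauss_withSeminorms : WithSeminorms (gaussFamily p) := ⟨rfl⟩

instance : IsTopologicalAddGroup (WideOpenFun p) := gauss_withSeminorms.topologicalAddGroup

instance : ContinuousSMul ℚ_[p] (WideOpenFun p) := gauss_withSeminorms.continuousSMul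

/-- The monomial `x^μ`. -/
def monom (μ : Idx →₀ ℕ) : WideOpenFun p :=
  ⟨MvPowerSeries.monomial μ 1, by
    classical
    intro r _ _
    refine tendsto_nhds_of_eventually_eq ?_
    refine (Set.finite_singleton μ).subset fun ν hν => ?_
    by_contra hne
    apply hν
    have : ν ≠ μ := hne
    simp [MvPowerSeries.coeff_monomial, this]⟩

lemma coeff_monom [DecidableEq (Idx →₀ ℕ)] (μ ν : Idx →₀ ℕ) :
    (monom μ : WideOpenFun p).coeff ν = if ν = μ then 1 else 0 :=
  (MvPowerSeries.coeff_monomial ν μ 1).trans (by congr)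

lemma gaussNorm_monom_le (r : Set.Ioo (0 : ℝ) 1) (μ : Idx →₀ ℕ) :
    gaussNorm r (monom μ : WideOpenFun p) ≤ (r : ℝ) ^ μ.degree := by
  classical
  refine gaussNorm_le r _ fun ν => ?_
  have := r.2.1
  rw [coeff_monom]
  split_ifs with h
  · simp [h]
  · simp; positivity

/-- Every function is the sum of its power series. -/
lemma hasSum_monom (F : WideOpenFun p) :
    HasSum (fun μ => F.coeff μ • (monom μ : WideOpenFun p)) F := by
  classical
  rw [HasSum, SummationFilter.unconditional_filter, gauss_withSeminorms.tendsto_nhds]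
  intro r ε hε
  have hfin := (F.tendsto r.2.1 r.2.2).eventually (gt_mem_nhds (half_pos hε))
  rw [Filter.eventually_cofinite] at hfin
  filter_upwards [Filter.eventually_ge_atTop hfin.toFinset] with s hs
  refine lt_of_le_of_lt ?_ (half_lt_self hε)
  refine gaussNorm_le r _ fun μ => ?_
  have hc : (∑ ν ∈ s, F.coeff ν • (monom ν : WideOpenFun p) - F).coeff μ
      = (if μ ∈ s then F.coeff μ else 0) - F.coeff μ := by
    rw [map_sub, map_sum]
    congr 1
    simp [coeff_monom]
  rw [hc]
  split_ifs with hμ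
  · simp; positivity
  · have : μ ∉ hfin.toFinset := fun h => hμ (hs h)
    simp only [Set.Finite.mem_toFinset, Set.mem_ofPred_eq, not_not] at this
    simpa using this.le

end Functions

section Convolution

/-- The polynomial functions in the coordinates `a_n, b_n, c_n, d_n` on the monoid `1 + p^n M₂`.
The index `n` enters through the comultiplication below. -/
def Coord (p : ℕ) [Fact p.Prime] (_n : ℕ) : Type := MvPolynomial Idx ℚ_[p]

variable (p : ℕ) [Fact p.Prime] (n : ℕ)

instance : CommRing (Coord p n) := inferInstanceAs (CommRing (MvPolynomial Idx ℚ_[p]))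

instance : Algebra ℚ_[p] (Coord p n) := inferInstanceAs (Algebra ℚ_[p] (MvPolynomial Idx ℚ_[p]))

/-- The coordinate function `x_ij`. -/
def Coord.x (i j : Fin 2) : Coord p n := (MvPolynomial.X (i, j) : MvPolynomial Idx ℚ_[p])

/-- The monomial `x^μ`. -/
def Coord.mon (μ : Idx →₀ ℕ) : Coord p n := (MvPolynomial.monomial μ 1 : MvPolynomial Idx ℚ_[p])

variable {p n} in
/-- Algebra homomorphism determined by its values on the coordinates. -/
def Coord.aeval {B : Type} [CommRing B] [Algebra ℚ_[p] B] (v : Fin 2 → Fin 2 → B) :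
    Coord p n →ₐ[ℚ_[p]] B :=
  (MvPolynomial.aeval fun ij : Idx => v ij.1 ij.2 : MvPolynomial Idx ℚ_[p] →ₐ[ℚ_[p]] B)

variable {p n} in
@[simp] lemma Coord.aeval_x {B : Type} [CommRing B] [Algebra ℚ_[p] B] (v : Fin 2 → Fin 2 → B)
    (i j : Fin 2) : Coord.aeval v (Coord.x p n i j) = v i j :=
  MvPolynomial.aeval_X _ _

variable {p n} in
lemma Coord.algHom_ext {B : Type} [CommRing B] [Algebra ℚ_[p] B] {f g : Coord p n →ₐ[ℚ_[p]] B}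
    (h : ∀ i j, f (Coord.x p n i j) = g (Coord.x p n i j)) : f = g :=
  MvPolynomial.algHom_ext (fun ij => h ij.1 ij.2)

variable {p n} in
lemma Coord.linearMap_ext {f g : Coord p n →ₗ[ℚ_[p]] ℚ_[p]}
    (h : ∀ μ, f (Coord.mon p n μ) = g (Coord.mon p n μ)) : f = g := by
  refine MvPolynomial.linearMap_ext (R := ℚ_[p]) (σ := Idx) fun μ => ?_
  ext
  exact h μ

/-- The comultiplication `x_ij ↦ x_ij ⊗ 1 + 1 ⊗ x_ij + p^n ∑_k x_ik ⊗ x_kj`, that is, the matrix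
product `(1 + p^n x)(1 + p^n x') = 1 + p^n (x + x' + p^n x x')`. -/
def Coord.comul : Coord p n →ₐ[ℚ_[p]] Coord p n ⊗[ℚ_[p]] Coord p n :=
  Coord.aeval fun i j => Coord.x p n i j ⊗ₜ 1 + 1 ⊗ₜ Coord.x p n i j +
    (p : ℚ_[p]) ^ n • ∑ k, Coord.x p n i k ⊗ₜ Coord.x p n k j

/-- The counit: evaluation at the unit element `x = 0`. -/
def Coord.counit : Coord p n →ₐ[ℚ_[p]] ℚ_[p] := Coord.aeval fun _ _ => 0

instance : Bialgebra ℚ_[p] (Coord p n) :=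
  Bialgebra.ofAlgHom (Coord.comul p n) (Coord.counit p n)
    (by
      have h : ∀ a b c : Coord p n, (Algebra.TensorProduct.assoc ℚ_[p] ℚ_[p] ℚ_[p] (Coord p n)
          (Coord p n) (Coord p n)).toAlgHom ((a ⊗ₜ b) ⊗ₜ c) = a ⊗ₜ (b ⊗ₜ c) := fun _ _ _ => rfl
      refine Coord.algHom_ext fun i j => ?_
      simp only [AlgHom.coe_comp, Function.comp_apply, Coord.comul, Coord.aeval_x, map_add,
        map_smul, Algebra.TensorProduct.map_tmul, AlgHom.coe_id, id_eq, map_one,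
        TensorProduct.add_tmul, TensorProduct.tmul_add, TensorProduct.smul_tmul',
        Algebra.TensorProduct.one_def, Fin.sum_univ_two, smul_add]
      simp only [← TensorProduct.smul_tmul', map_smul, h, TensorProduct.tmul_smul]
      abel)
    (by
      refine Coord.algHom_ext fun i j => ?_
      simp [Coord.comul, Coord.counit])
    (by
      refine Coord.algHom_ext fun i j => ?_
      simp [Coord.comul, Coord.counit])

lemma Coord.coe_comul (f : Coord p n) : Coalgebra.comul (R := ℚ_[p]) f = Coord.comul p n f := rfl

lemma Coord.coe_counit (f : Coord p n) :
    Coalgebra.counit (R := ℚ_[p]) f = Coord.counit p n f := rfl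

/-- The analytic distribution algebra `D^an(𝔾(n)°) = 𝒪(𝔾(n)°)'_b`: the continuous dual of
`𝒪(𝔾(n)°)`, with the strong topology (uniform convergence on bounded sets). -/
def AnDist (p : ℕ) [Fact p.Prime] (_n : ℕ) : Type := WideOpenFun p →L[ℚ_[p]] ℚ_[p]

instance : AddCommGroup (AnDist p n) := inferInstanceAs (AddCommGroup (WideOpenFun p →L[ℚ_[p]] ℚ_[p]))

instance : Module ℚ_[p] (AnDist p n) := inferInstanceAs (Module ℚ_[p] (WideOpenFun p →L[ℚ_[p]] ℚ_[p]))

instance : TopologicalSpace (AnDist p n) :=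
  inferInstanceAs (TopologicalSpace (WideOpenFun p →L[ℚ_[p]] ℚ_[p]))

variable {p n}

/-- Evaluation of a distribution at a function. -/
def AnDist.eval (δ : AnDist p n) : WideOpenFun p →L[ℚ_[p]] ℚ_[p] := δ

lemma AnDist.eval_add (δ δ' : AnDist p n) (F : WideOpenFun p) :
    (δ + δ').eval F = δ.eval F + δ'.eval F := rfl

lemma AnDist.eval_smul (c : ℚ_[p]) (δ : AnDist p n) (F : WideOpenFun p) :
    (c • δ).eval F = c * δ.eval F := rfl

lemma AnDist.hasSum (δ : AnDist p n) (F : WideOpenFun p) :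
    HasSum (fun μ => F.coeff μ * δ.eval (monom μ)) (δ.eval F) := by
  simpa using (hasSum_monom F).mapL δ.eval

lemma AnDist.ext {δ δ' : AnDist p n} (h : ∀ μ, δ.eval (monom μ) = δ'.eval (monom μ)) :
    δ = δ' := by
  refine ContinuousLinearMap.ext fun F => ?_
  refine (δ.hasSum F).unique ?_
  have h' := δ'.hasSum F
  simp only [← h] at h'
  exact h'

lemma AnDist.exists_bound (δ : AnDist p n) : ∃ r : Set.Ioo (0 : ℝ) 1, ∃ C : ℝ, 0 ≤ C ∧
    ∀ μ : Idx →₀ ℕ, ‖δ.eval (monom μ)‖ ≤ C * (r : ℝ) ^ μ.degree := by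
  obtain ⟨s, C, -, hC⟩ := Seminorm.bound_of_continuous gauss_withSeminorms
    ((normSeminorm ℚ_[p] ℚ_[p]).comp δ.eval.toLinearMap) (continuous_norm.comp δ.eval.cont)
  obtain ⟨r, hr⟩ : ∃ r : Set.Ioo (0 : ℝ) 1, s.sup (gaussFamily p) ≤ gaussNorm r := by
    obtain ⟨r, hr⟩ := s.exists_le
    exact ⟨r, Finset.sup_le fun i hi => gaussNorm_mono (hr i hi)⟩
  refine ⟨r, C, C.2, fun μ => ?_⟩
  calc ‖δ.eval (monom μ)‖ ≤ (C • s.sup (gaussFamily p)) (monom μ) := hC _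
    _ = C * (s.sup (gaussFamily p)) (monom μ) := rfl
    _ ≤ C * (r : ℝ) ^ μ.degree := by
      gcongr
      exact (hr _).trans (gaussNorm_monom_le r μ)

/-- The restriction of a distribution to polynomial functions. -/
def AnDist.toPoly (δ : AnDist p n) : Coord p n →ₗ[ℚ_[p]] ℚ_[p] :=
  (MvPolynomial.basisMonomials Idx ℚ_[p]).constr ℚ_[p] fun μ => δ.eval (monom μ)

@[simp] lemma AnDist.toPoly_mon (δ : AnDist p n) (μ : Idx →₀ ℕ) :
    δ.toPoly (Coord.mon p n μ) = δ.eval (monom μ) := by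
  have := (MvPolynomial.basisMonomials Idx ℚ_[p]).constr_basis ℚ_[p]
    (fun μ => δ.eval (monom μ)) μ
  rwa [MvPolynomial.coe_basisMonomials] at this

lemma AnDist.summable {d : (Idx →₀ ℕ) → ℚ_[p]} {r : Set.Ioo (0 : ℝ) 1} {C : ℝ}
    (h : ∀ μ : Idx →₀ ℕ, ‖d μ‖ ≤ C * (r : ℝ) ^ μ.degree) (F : WideOpenFun p) :
    Summable fun μ => F.coeff μ * d μ := by
  refine NonarchimedeanAddGroup.summable_of_tendsto_cofinite_zero ?_
  have := (F.tendsto r.2.1 r.2.2).const_mul C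
  rw [mul_zero] at this
  refine squeeze_zero_norm (fun μ => ?_) this
  rw [norm_mul]
  calc _ ≤ ‖F.coeff μ‖ * (C * (r : ℝ) ^ μ.degree) := by gcongr; exact h μ
    _ = _ := by ring

/-- The continuous linear form `∑ ξ_μ x^μ ↦ ∑ ξ_μ d_μ`, for a family `d` with `|d_μ| ≤ C r^|μ|`
for some `r < 1`. -/
def AnDist.ofBound (d : (Idx →₀ ℕ) → ℚ_[p]) (h : ∃ r : Set.Ioo (0 : ℝ) 1, ∃ C : ℝ, 0 ≤ C ∧
    ∀ μ : Idx →₀ ℕ, ‖d μ‖ ≤ C * (r : ℝ) ^ μ.degree) : AnDist p n :=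
  show WideOpenFun p →L[ℚ_[p]] ℚ_[p] from
  { toFun := fun F => ∑' μ, F.coeff μ * d μ
    map_add' := by
      obtain ⟨r, C, -, hC⟩ := h
      intro F G
      rw [← (summable hC F).tsum_add (summable hC G)]
      simp [add_mul]
    map_smul' := by
      intro c F
      rw [RingHom.id_apply, smul_eq_mul, ← tsum_mul_left]
      simp [mul_assoc]
    cont := by
      obtain ⟨r, C, hC0, hC⟩ := h
      have key : ∀ F : WideOpenFun p, ‖∑' μ, F.coeff μ * d μ‖ ≤ C * gaussNorm r F := by
        intro F
        refine IsUltrametricDist.norm_tsum_le_of_forall_le_of_nonneg (by positivity) fun μ => ?_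
        rw [norm_mul]
        calc _ ≤ ‖F.coeff μ‖ * (C * (r : ℝ) ^ μ.degree) := by gcongr; exact hC μ
          _ = C * (‖F.coeff μ‖ * (r : ℝ) ^ μ.degree) := by ring
          _ ≤ _ := by gcongr; exact le_gaussNorm r F μ
      let L : WideOpenFun p →ₗ[ℚ_[p]] ℚ_[p] :=
        { toFun := fun F => ∑' μ, F.coeff μ * d μ
          map_add' := by
            intro F G
            rw [← (summable hC F).tsum_add (summable hC G)]
            simp [add_mul]
          map_smul' := by
            intro c F
            rw [RingHom.id_apply, smul_eq_mul, ← tsum_mul_left]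
            simp [mul_assoc] }
      refine WithSeminorms.continuous_normedSpace_rng ℚ_[p] gauss_withSeminorms L
        ⟨{r}, ⟨C, hC0⟩, fun F => ?_⟩
      rw [Finset.sup_singleton]
      exact key F }

lemma AnDist.ofBound_monom (d : (Idx →₀ ℕ) → ℚ_[p]) (h) (μ : Idx →₀ ℕ) :
    (AnDist.ofBound d h : AnDist p n).eval (monom μ) = d μ := by
  classical
  change ∑' ν, (monom μ : WideOpenFun p).coeff ν * d ν = d μ
  rw [tsum_eq_single μ]
  · simp [coeff_monom]
  · intro ν hν
    simp [coeff_monom, hν]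

/-- `ℤ_p`-span of the tensors `x^μ ⊗ x^ν` with `|μ| + |ν| ≥ k`. -/
def orderSpan (p : ℕ) [Fact p.Prime] (n k : ℕ) : AddSubgroup (Coord p n ⊗[ℚ_[p]] Coord p n) :=
  AddSubgroup.closure {t | ∃ (c : ℚ_[p]) (μ ν : Idx →₀ ℕ), ‖c‖ ≤ 1 ∧ k ≤ μ.degree + ν.degree ∧
    t = c • (Coord.mon p n μ ⊗ₜ Coord.mon p n ν)}

lemma Coord.mon_mul (μ ν : Idx →₀ ℕ) :
    Coord.mon p n μ * Coord.mon p n ν = Coord.mon p n (μ + ν) := by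
  have := MvPolynomial.monomial_mul (R := ℚ_[p]) (s := μ) (s' := ν) (a := 1) (b := 1)
  rwa [one_mul] at this

lemma Coord.mon_zero : Coord.mon p n 0 = 1 := rfl

lemma Coord.x_eq_mon (i j : Fin 2) :
    Coord.x p n i j = Coord.mon p n (Finsupp.single (i, j) 1) := rfl

lemma mul_mem_orderSpan {k l : ℕ} {a b : Coord p n ⊗[ℚ_[p]] Coord p n}
    (ha : a ∈ orderSpan p n k) (hb : b ∈ orderSpan p n l) : a * b ∈ orderSpan p n (k + l) := by
  induction ha using AddSubgroup.closure_induction with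
  | zero => rw [zero_mul]; exact zero_mem _
  | add x y _ _ hx hy => rw [add_mul]; exact add_mem hx hy
  | neg x _ hx => rw [neg_mul]; exact neg_mem hx
  | mem x hx =>
    obtain ⟨c, μ, ν, hc, hk, rfl⟩ := hx
    induction hb using AddSubgroup.closure_induction with
    | zero => rw [mul_zero]; exact zero_mem _
    | add x y _ _ hx hy => rw [mul_add]; exact add_mem hx hy
    | neg x _ hx => rw [mul_neg]; exact neg_mem hx
    | mem y hy =>
      obtain ⟨c', μ', ν', hc', hl, rfl⟩ := hy
      refine AddSubgroup.subset_closure ⟨c * c', μ + μ', ν + ν', ?_, ?_, ?_⟩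
      · rw [norm_mul]; exact mul_le_one₀ hc (norm_nonneg _) hc'
      · rw [map_add, map_add]; omega
      · rw [smul_mul_smul_comm, Algebra.TensorProduct.tmul_mul_tmul, Coord.mon_mul,
          Coord.mon_mul]

lemma comul_x_mem (i j : Fin 2) : Coord.comul p n (Coord.x p n i j) ∈ orderSpan p n 1 := by
  have hp : ‖(p : ℚ_[p]) ^ n‖ ≤ 1 := by
    rw [norm_pow]; exact pow_le_one₀ (norm_nonneg _) (Padic.norm_p_lt_one).le
  simp only [Coord.comul, Coord.aeval_x, Finset.smul_sum]
  refine add_mem (add_mem ?_ ?_) (sum_mem fun k _ => ?_)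
  · refine AddSubgroup.subset_closure ⟨1, Finsupp.single (i, j) 1, 0, by simp, by simp, ?_⟩
    rw [one_smul]; rfl
  · refine AddSubgroup.subset_closure ⟨1, 0, Finsupp.single (i, j) 1, by simp, by simp, ?_⟩
    rw [one_smul]; rfl
  · exact AddSubgroup.subset_closure
      ⟨_, Finsupp.single (i, k) 1, Finsupp.single (k, j) 1, hp, by simp, rfl⟩

lemma comul_mon_mem (μ : Idx →₀ ℕ) : Coord.comul p n (Coord.mon p n μ) ∈
    orderSpan p n μ.degree := by
  induction μ using Finsupp.induction_linear with
  | zero =>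
    rw [Coord.mon_zero, map_one]
    refine AddSubgroup.subset_closure ⟨1, 0, 0, by simp, by simp, ?_⟩
    rw [one_smul]; rfl
  | add μ ν hμ hν =>
    rw [← Coord.mon_mul, map_mul, map_add]
    exact mul_mem_orderSpan hμ hν
  | single ij k =>
    induction k with
    | zero =>
      rw [Finsupp.single_zero, Coord.mon_zero, map_one]
      refine AddSubgroup.subset_closure ⟨1, 0, 0, by simp, by simp, ?_⟩
      rw [one_smul]; rfl
    | succ k ih =>
      rw [Finsupp.single_add, ← Coord.mon_mul, map_mul, map_add]
      refine mul_mem_orderSpan ih ?_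
      have := comul_x_mem (p := p) (n := n) ij.1 ij.2
      rw [Coord.x_eq_mon] at this
      simpa using this

/-- The convolution of the restrictions of two distributions to polynomials satisfies the growth
condition that characterizes distributions. -/
lemma conv_bound (δ δ' : AnDist p n) : ∃ r : Set.Ioo (0 : ℝ) 1, ∃ C : ℝ, 0 ≤ C ∧
    ∀ μ : Idx →₀ ℕ, ‖LinearMap.mul' ℚ_[p] ℚ_[p] (TensorProduct.map δ.toPoly δ'.toPoly
      (Coord.comul p n (Coord.mon p n μ)))‖ ≤ C * (r : ℝ) ^ μ.degree := by
  obtain ⟨r, C, hC0, hC⟩ := δ.exists_bound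
  obtain ⟨r', C', hC0', hC'⟩ := δ'.exists_bound
  have hr := (r ⊔ r').2
  refine ⟨r ⊔ r', C * C', by positivity, fun μ => ?_⟩
  have key : ∀ k : ℕ, ∀ t ∈ orderSpan p n k, ‖LinearMap.mul' ℚ_[p] ℚ_[p]
      (TensorProduct.map δ.toPoly δ'.toPoly t)‖ ≤ C * C' * ((r ⊔ r' : Set.Ioo (0 : ℝ) 1) : ℝ) ^ k := by
    intro k t ht
    have h0 : 0 ≤ C * C' * ((r ⊔ r' : Set.Ioo (0 : ℝ) 1) : ℝ) ^ k := by
      have := hr.1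
      positivity
    induction ht using AddSubgroup.closure_induction with
    | zero => simpa using h0
    | add x y _ _ hx hy =>
      rw [map_add, map_add]
      exact (IsUltrametricDist.norm_add_le_max _ _).trans (max_le hx hy)
    | neg x _ hx => rwa [map_neg, map_neg, norm_neg]
    | mem x hx =>
      obtain ⟨c, μ, ν, hc, hk, rfl⟩ := hx
      have h1 : ‖δ.eval (monom μ)‖ ≤ C * ((r ⊔ r' : Set.Ioo (0 : ℝ) 1) : ℝ) ^ μ.degree := by
        refine (hC μ).trans ?_
        have := r.2.1
        gcongr
        exact le_sup_left
      have h2 : ‖δ'.eval (monom ν)‖ ≤ C' * ((r ⊔ r' : Set.Ioo (0 : ℝ) 1) : ℝ) ^ ν.degree := by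
        refine (hC' ν).trans ?_
        have := r'.2.1
        gcongr
        exact le_sup_right
      have h3 : 0 ≤ C * ((r ⊔ r' : Set.Ioo (0 : ℝ) 1) : ℝ) ^ μ.degree := (norm_nonneg _).trans h1
      rw [map_smul, map_smul, TensorProduct.map_tmul, LinearMap.mul'_apply, AnDist.toPoly_mon,
        AnDist.toPoly_mon, norm_smul, norm_mul]
      calc _ ≤ 1 * ((C * ((r ⊔ r' : Set.Ioo (0 : ℝ) 1) : ℝ) ^ μ.degree) *
            (C' * ((r ⊔ r' : Set.Ioo (0 : ℝ) 1) : ℝ) ^ ν.degree)) := by gcongr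
        _ = C * C' * ((r ⊔ r' : Set.Ioo (0 : ℝ) 1) : ℝ) ^ (μ.degree + ν.degree) := by ring
        _ ≤ _ := by
          gcongr ?_ * ?_
          exact pow_le_pow_of_le_one hr.1.le hr.2.le hk
  exact key _ _ (comul_mon_mem μ)

/-- The convolution `δ * δ'` is the continuous linear form `F ↦ (δ ⊗ δ')(Δ F)`, where `Δ` is the
comultiplication `(Δ F)(g, h) = F(g h)`; for `F = ∑ ξ_μ x^μ` this is
`∑ ξ_μ (δ ⊗ δ')(Δ x^μ)`, with `Δ x^μ` a polynomial. -/
instance : Mul (AnDist p n) where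
  mul δ δ' := AnDist.ofBound _ (conv_bound δ δ')

/-- The unit element is the evaluation at the unit element of the group, `∑ ξ_μ x^μ ↦ ξ_0`. -/
instance : One (AnDist p n) where
  one := AnDist.ofBound (fun μ => Coord.counit p n (Coord.mon p n μ)) (by
    refine ⟨⟨1 / 2, by norm_num, by norm_num⟩, 1, zero_le_one, fun μ => ?_⟩
    by_cases hμ : μ = 0
    · subst hμ
      simp [Coord.mon_zero]
    · obtain ⟨ij, hij⟩ := Finsupp.ne_iff.mp hμ
      have : Coord.counit p n (Coord.mon p n μ) = 0 := by
        obtain ⟨ν, rfl⟩ : ∃ ν, μ = Finsupp.single ij 1 + ν :=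
          ⟨μ - Finsupp.single ij 1, by
            rw [add_tsub_cancel_of_le]
            exact Finsupp.single_le_iff.mpr (Nat.one_le_iff_ne_zero.mpr hij)⟩
        have hx : Coord.counit p n (Coord.mon p n (Finsupp.single ij 1)) = 0 :=
          Coord.aeval_x (p := p) (n := n) (fun _ _ => (0 : ℚ_[p])) ij.1 ij.2
        rw [← Coord.mon_mul, map_mul, hx, zero_mul]
      rw [this, norm_zero]
      positivity)

lemma AnDist.mul_eval_monom (δ δ' : AnDist p n) (μ : Idx →₀ ℕ) : (δ * δ').eval (monom μ) =
    LinearMap.mul' ℚ_[p] ℚ_[p] (TensorProduct.map δ.toPoly δ'.toPoly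
      (Coord.comul p n (Coord.mon p n μ))) :=
  AnDist.ofBound_monom _ _ μ

lemma AnDist.one_eval_monom (μ : Idx →₀ ℕ) :
    (1 : AnDist p n).eval (monom μ) = Coord.counit p n (Coord.mon p n μ) :=
  AnDist.ofBound_monom _ _ μ

/-- Restriction to polynomials, with values in the convolution algebra of the bialgebra of
polynomial functions. -/
def AnDist.toConvPoly (δ : AnDist p n) : WithConv (Coord p n →ₗ[ℚ_[p]] ℚ_[p]) :=
  WithConv.toConv δ.toPoly

lemma AnDist.toConvPoly_injective : Function.Injective (AnDist.toConvPoly (p := p) (n := n)) := by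
  intro δ δ' h
  refine AnDist.ext fun μ => ?_
  have : δ.toPoly = δ'.toPoly := WithConv.toConv_injective h
  rw [← AnDist.toPoly_mon, this, AnDist.toPoly_mon]

lemma AnDist.toConvPoly_mul (δ δ' : AnDist p n) :
    (δ * δ').toConvPoly = δ.toConvPoly * δ'.toConvPoly := by
  refine WithConv.ofConv_injective (Coord.linearMap_ext fun μ => ?_)
  change (δ * δ').toPoly _ = _
  rw [AnDist.toPoly_mon, AnDist.mul_eval_monom]
  rfl

lemma AnDist.toConvPoly_one : (1 : AnDist p n).toConvPoly = 1 := by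
  refine WithConv.ofConv_injective (Coord.linearMap_ext fun μ => ?_)
  change (1 : AnDist p n).toPoly _ = _
  rw [AnDist.toPoly_mon, AnDist.one_eval_monom]
  rfl

lemma AnDist.toConvPoly_zero : (0 : AnDist p n).toConvPoly = 0 := by
  refine WithConv.ofConv_injective (Coord.linearMap_ext fun μ => ?_)
  change (0 : AnDist p n).toPoly _ = _
  rw [AnDist.toPoly_mon]
  rfl

lemma AnDist.toConvPoly_add (δ δ' : AnDist p n) :
    (δ + δ').toConvPoly = δ.toConvPoly + δ'.toConvPoly := by
  refine WithConv.ofConv_injective (Coord.linearMap_ext fun μ => ?_)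
  change (δ + δ').toPoly _ = δ.toPoly _ + δ'.toPoly _
  simp only [AnDist.toPoly_mon, AnDist.eval_add]

lemma AnDist.toConvPoly_smul (c : ℚ_[p]) (δ : AnDist p n) :
    (c • δ).toConvPoly = c • δ.toConvPoly := by
  refine WithConv.ofConv_injective (Coord.linearMap_ext fun μ => ?_)
  change (c • δ).toPoly _ = c * δ.toPoly _
  simp only [AnDist.toPoly_mon, AnDist.eval_smul]

instance : Ring (AnDist p n) :=
  { (inferInstance : AddCommGroup (AnDist p n)) with
    mul := (· * ·)
    one := 1
    mul_assoc := fun a b c => AnDist.toConvPoly_injective (by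
      simp only [AnDist.toConvPoly_mul, mul_assoc])
    one_mul := fun a => AnDist.toConvPoly_injective (by
      simp only [AnDist.toConvPoly_mul, AnDist.toConvPoly_one, one_mul])
    mul_one := fun a => AnDist.toConvPoly_injective (by
      simp only [AnDist.toConvPoly_mul, AnDist.toConvPoly_one, mul_one])
    zero_mul := fun a => AnDist.toConvPoly_injective (by
      simp only [AnDist.toConvPoly_mul, AnDist.toConvPoly_zero, zero_mul])
    mul_zero := fun a => AnDist.toConvPoly_injective (by
      simp only [AnDist.toConvPoly_mul, AnDist.toConvPoly_zero, mul_zero])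
    left_distrib := fun a b c => AnDist.toConvPoly_injective (by
      simp only [AnDist.toConvPoly_mul, AnDist.toConvPoly_add, mul_add])
    right_distrib := fun a b c => AnDist.toConvPoly_injective (by
      simp only [AnDist.toConvPoly_mul, AnDist.toConvPoly_add, add_mul]) }

instance : Algebra ℚ_[p] (AnDist p n) :=
  Algebra.ofModule
    (fun c a b => AnDist.toConvPoly_injective (by
      simp only [AnDist.toConvPoly_mul, AnDist.toConvPoly_smul, smul_mul_assoc]))
    (fun c a b => AnDist.toConvPoly_injective (by
      simp only [AnDist.toConvPoly_mul, AnDist.toConvPoly_smul, mul_smul_comm]))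

end Convolution

section PadicCompletion

variable (p : ℕ) (A : Type) [Ring A]

/-- The two-sided ideal `p^k A` of a (not necessarily commutative) ring `A`. -/
def pIdeal (k : ℕ) : Ideal A := Ideal.span {(p : A) ^ k}

instance (k : ℕ) : (pIdeal p A k).IsTwoSided where
  mul_mem_of_left := by
    intro _ b ha
    obtain ⟨c, rfl⟩ := Ideal.mem_span_singleton'.mp ha
    refine Ideal.mem_span_singleton'.mpr ⟨c * b, ?_⟩
    rw [mul_assoc, mul_assoc, ((Nat.cast_commute p b).pow_left k).eq]

lemma pIdeal_succ_le (k : ℕ) : pIdeal p A (k + 1) ≤ pIdeal p A k := by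
  refine Ideal.span_singleton_le_iff_mem _ |>.mpr ?_
  exact Ideal.mem_span_singleton'.mpr ⟨(p : A), (pow_succ' _ _).symm⟩

variable [Fact p.Prime] [Algebra ℤ_[p] A]

/-- The compatible families in `∏ k, A / p^k A`. -/
def padicCompletionSubalgebra : Subalgebra ℤ_[p] (Π k, A ⧸ pIdeal p A k) :=
  ⨅ k, AlgHom.equalizer
    ((Ideal.Quotient.factorₐ ℤ_[p] (pIdeal_succ_le p A k)).comp
      (Pi.evalAlgHom ℤ_[p] (fun k => A ⧸ pIdeal p A k) (k + 1)))
    (Pi.evalAlgHom ℤ_[p] (fun k => A ⧸ pIdeal p A k) k)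

/-- The `p`-adic completion `lim_k A / p^k A`. -/
def PadicCompletion : Type := padicCompletionSubalgebra p A

instance : Ring (PadicCompletion p A) := inferInstanceAs (Ring (padicCompletionSubalgebra p A))

instance : Algebra ℤ_[p] (PadicCompletion p A) :=
  inferInstanceAs (Algebra ℤ_[p] (padicCompletionSubalgebra p A))

lemma mem_padicCompletionSubalgebra (x : Π k, A ⧸ pIdeal p A k) :
    x ∈ padicCompletionSubalgebra p A ↔
      ∀ k, Ideal.Quotient.factorₐ ℤ_[p] (pIdeal_succ_le p A k) (x (k + 1)) = x k := by
  simp only [padicCompletionSubalgebra, Algebra.mem_iInf]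
  rfl

/-- The canonical map from `A` to its `p`-adic completion. -/
def PadicCompletion.of : A →ₐ[ℤ_[p]] PadicCompletion p A :=
  AlgHom.codRestrict (AlgHom.pi fun k => Ideal.Quotient.mkₐ ℤ_[p] (pIdeal p A k))
    (padicCompletionSubalgebra p A)
    (fun a => (mem_padicCompletionSubalgebra p A _).mpr fun _ => rfl)

variable {A} {B : Type} [Ring B] [Algebra ℤ_[p] B]

lemma pIdeal_le_comap (f : A →ₐ[ℤ_[p]] B) (k : ℕ) :
    pIdeal p A k ≤ (pIdeal p B k).comap f := by
  refine Ideal.span_singleton_le_iff_mem _ |>.mpr ?_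
  rw [Ideal.mem_comap, map_pow, map_natCast]
  exact Ideal.mem_span_singleton_self _

/-- The map induced on `p`-adic completions by an algebra homomorphism. -/
def PadicCompletion.map (f : A →ₐ[ℤ_[p]] B) : PadicCompletion p A →ₐ[ℤ_[p]] PadicCompletion p B :=
  AlgHom.codRestrict
    (AlgHom.pi fun k => (Ideal.quotientMapₐ (pIdeal p B k) f (pIdeal_le_comap p f k)).comp
      ((Pi.evalAlgHom ℤ_[p] (fun k => A ⧸ pIdeal p A k) k).comp
        (padicCompletionSubalgebra p A).val))
    (padicCompletionSubalgebra p B)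
    (fun x => (mem_padicCompletionSubalgebra p B _).mpr fun k => by
      have hx := (mem_padicCompletionSubalgebra p A x.1).mp x.2 k
      obtain ⟨a, ha⟩ := Ideal.Quotient.mk_surjective (x.1 (k + 1))
      change Ideal.Quotient.factorₐ ℤ_[p] (pIdeal_succ_le p B k)
        (Ideal.quotientMapₐ _ f (pIdeal_le_comap p f (k + 1)) (x.1 (k + 1))) =
        Ideal.quotientMapₐ _ f (pIdeal_le_comap p f k) (x.1 k)
      rw [← hx, ← ha]
      rfl)

lemma PadicCompletion.map_id :
    PadicCompletion.map p (AlgHom.id ℤ_[p] A) = AlgHom.id ℤ_[p] (PadicCompletion p A) := by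
  refine AlgHom.ext fun x => Subtype.ext (funext fun k => ?_)
  change Ideal.quotientMapₐ _ (AlgHom.id ℤ_[p] A) (pIdeal_le_comap p _ k) (x.1 k) = x.1 k
  obtain ⟨a, ha⟩ := Ideal.Quotient.mk_surjective (x.1 k)
  rw [← ha]
  rfl

lemma PadicCompletion.map_comp {C : Type} [Ring C] [Algebra ℤ_[p] C] (g : B →ₐ[ℤ_[p]] C)
    (f : A →ₐ[ℤ_[p]] B) :
    PadicCompletion.map p (g.comp f) = (PadicCompletion.map p g).comp (PadicCompletion.map p f) := by
  refine AlgHom.ext fun x => Eq.symm ?_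
  refine Subtype.ext (funext fun k => ?_)
  change Ideal.quotientMapₐ _ g (pIdeal_le_comap p _ k)
    (Ideal.quotientMapₐ _ f (pIdeal_le_comap p _ k) (x.1 k)) =
    Ideal.quotientMapₐ _ (g.comp f) (pIdeal_le_comap p _ k) (x.1 k)
  obtain ⟨a, ha⟩ := Ideal.Quotient.mk_surjective (x.1 k)
  rw [← ha]
  rfl

/-- The topology on an abelian group `E` for which the subgroups `p^k Λ` are a fundamental system
of neighbourhoods of `0`. -/
@[reducible] def latticeTopology {E : Type} [AddCommGroup E] (Λ : AddSubgroup E) : TopologicalSpace E where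
  IsOpen U := ∀ x ∈ U, ∃ k : ℕ, ∀ y ∈ Λ, x + p ^ k • y ∈ U
  isOpen_univ := fun _ _ => ⟨0, fun _ _ => trivial⟩
  isOpen_inter := by
    rintro U V hU hV x ⟨hxU, hxV⟩
    obtain ⟨k, hk⟩ := hU x hxU
    obtain ⟨l, hl⟩ := hV x hxV
    refine ⟨k + l, fun y hy => ⟨?_, ?_⟩⟩
    · rw [pow_add, mul_smul]
      exact hk _ (Λ.nsmul_mem hy _)
    · rw [pow_add, mul_comm, mul_smul]
      exact hl _ (Λ.nsmul_mem hy _)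
  isOpen_sUnion := by
    rintro S hS x ⟨U, hU, hx⟩
    obtain ⟨k, hk⟩ := hS U hU x hx
    exact ⟨k, fun y hy => ⟨U, hU, hk y hy⟩⟩

/-- The `p`-adic topology on the `p`-adic completion. -/
instance (A : Type) [Ring A] [Algebra ℤ_[p] A] : TopologicalSpace (PadicCompletion p A) :=
  latticeTopology p ⊤

/-- `Â_ℚ = Â ⊗ ℚ`, for the `p`-adic completion `Â` of a `ℤ_p`-algebra `A`; as a `ℚ_p`-algebra it
is `ℚ_p ⊗_{ℤ_p} Â`. -/
abbrev CompletionQ (A : Type) [Ring A] [Algebra ℤ_[p] A] : Type :=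
  ℚ_[p] ⊗[ℤ_[p]] PadicCompletion p A

/-- The map induced on `Â_ℚ` by an algebra homomorphism. -/
def CompletionQ.map {A B : Type} [Ring A] [Algebra ℤ_[p] A] [Ring B] [Algebra ℤ_[p] B]
    (f : A →ₐ[ℤ_[p]] B) : CompletionQ p A →ₐ[ℚ_[p]] CompletionQ p B :=
  Algebra.TensorProduct.map (AlgHom.id ℚ_[p] ℚ_[p]) (PadicCompletion.map p f)

lemma CompletionQ.map_id {A : Type} [Ring A] [Algebra ℤ_[p] A] :
    CompletionQ.map p (AlgHom.id ℤ_[p] A) = AlgHom.id ℚ_[p] (CompletionQ p A) := by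
  rw [CompletionQ.map, PadicCompletion.map_id]
  exact Algebra.TensorProduct.map_id

lemma CompletionQ.map_comp {A B C : Type} [Ring A] [Algebra ℤ_[p] A] [Ring B] [Algebra ℤ_[p] B]
    [Ring C] [Algebra ℤ_[p] C] (g : B →ₐ[ℤ_[p]] C) (f : A →ₐ[ℤ_[p]] B) :
    CompletionQ.map p (g.comp f) = (CompletionQ.map p g).comp (CompletionQ.map p f) := by
  rw [CompletionQ.map, PadicCompletion.map_comp]
  exact Algebra.TensorProduct.map_id_comp _ _

/-- The Banach space topology on `Â_ℚ`, with the multiples `p^k` of the image of `Â` as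
neighbourhoods of `0`. -/
@[reducible] def completionQTopology (A : Type) [Ring A] [Algebra ℤ_[p] A] :
    TopologicalSpace (CompletionQ p A) :=
  latticeTopology p (Algebra.TensorProduct.includeRight :
    PadicCompletion p A →ₐ[ℤ_[p]] CompletionQ p A).toLinearMap.range.toAddSubgroup

/-- Locally convex vector space topologies over `ℚ_p`: vector space topologies for which `0` has
a fundamental system of neighbourhoods consisting of `ℤ_p`-submodules. -/
structure IsLocallyConvexTopology {E : Type} [AddCommGroup E] [Module ℚ_[p] E]
    (t : TopologicalSpace E) : Prop where
  isTopologicalAddGroup : IsTopologicalAddGroup E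
  continuousSMul : ContinuousSMul ℚ_[p] E
  exists_submodule : ∀ U ∈ 𝓝 (0 : E), ∃ L : AddSubgroup E,
    (∀ a : ℤ_[p], ∀ x ∈ L, (a : ℚ_[p]) • x ∈ L) ∧ (L : Set E) ∈ 𝓝 (0 : E) ∧ (L : Set E) ⊆ U

/-- The locally convex inductive limit topology: the finest locally convex topology on `E` for
which all maps `φ m : V m → E` are continuous. -/
@[reducible] def inductiveLimitTopology {E : Type} [AddCommGroup E] [Module ℚ_[p] E] {V : ℕ → Type}
    (τ : ∀ m, TopologicalSpace (V m)) (φ : ∀ m, V m → E) : TopologicalSpace E :=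
  sInf {t | IsLocallyConvexTopology p t ∧ ∀ m, @Continuous _ _ (τ m) t (φ m)}

end PadicCompletion

section Enveloping

attribute [local instance 100] LieRing.ofAssociativeRing

variable (p : ℕ) [Fact p.Prime]

/-- The Lie algebra `𝔤 = 𝔤𝔩₂(ℚ_p)`, with the commutator bracket. -/
abbrev GL2Lie : Type := Matrix (Fin 2) (Fin 2) ℚ_[p]

/-- The universal enveloping algebra `U(𝔤)` over `ℚ_p`. -/
def Ug : Type := UniversalEnvelopingAlgebra ℚ_[p] (GL2Lie p)

instance : Ring (Ug p) := inferInstanceAs (Ring (UniversalEnvelopingAlgebra ℚ_[p] (GL2Lie p)))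

instance : Algebra ℚ_[p] (Ug p) :=
  inferInstanceAs (Algebra ℚ_[p] (UniversalEnvelopingAlgebra ℚ_[p] (GL2Lie p)))

instance : Algebra ℤ_[p] (Ug p) := Algebra.compHom _ (algebraMap ℤ_[p] ℚ_[p])

/-- The canonical map `𝔤 → U(𝔤)`. -/
def Ug.ι : GL2Lie p →ₗ[ℚ_[p]] Ug p :=
  (UniversalEnvelopingAlgebra.ι ℚ_[p] : GL2Lie p →ₗ⁅ℚ_[p]⁆ _).toLinearMap

end Enveloping

section Levels

variable (p : ℕ) [Fact p.Prime]

/-- The divided power `x^ν / ν!`. -/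
def dividedPow (x : Ug p) (ν : ℕ) : Ug p := ((ν.factorial : ℚ_[p])⁻¹) • x ^ ν

/-- The binomial coefficient `x (x - 1) ⋯ (x - ν + 1) / ν!`. -/
def binom (x : Ug p) (ν : ℕ) : Ug p :=
  ((ν.factorial : ℚ_[p])⁻¹) • Polynomial.aeval x (descPochhammer ℚ_[p] ν)

/-- `q^(m)_ν !`, where `q^(m)_ν = ⌊ν / p^m⌋`. -/
def qFactorial (m ν : ℕ) : ℕ := (ν / p ^ m).factorial

/-- `e = (0 1; 0 0)` in `U(𝔤)`. -/
def Ug.e : Ug p := Ug.ι p !![0, 1; 0, 0]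

/-- `h₁ = (1 0; 0 0)` in `U(𝔤)`. -/
def Ug.h₁ : Ug p := Ug.ι p !![1, 0; 0, 0]

/-- `h₂ = (0 0; 0 1)` in `U(𝔤)`. -/
def Ug.h₂ : Ug p := Ug.ι p !![0, 0; 0, 1]

/-- `f = (0 0; 1 0)` in `U(𝔤)`. -/
def Ug.f : Ug p := Ug.ι p !![0, 0; 1, 0]

/-- The elements `q_{ν₁}! (p^n e)^{ν₁} / ν₁! · q_{ν₂}! p^{n ν₂} binom(h₁, ν₂) ·
q_{ν₃}! p^{n ν₃} binom(h₂, ν₃) · q_{ν₄}! (p^n f)^{ν₄} / ν₄!` of `U(𝔤)`, with `q = q^(m)`. -/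
def levelGen (n m : ℕ) (ν : Fin 4 → ℕ) : Ug p :=
  (qFactorial p m (ν 0) • dividedPow p (p ^ n • Ug.e p) (ν 0)) *
  (qFactorial p m (ν 1) • p ^ (n * ν 1) • binom p (Ug.h₁ p) (ν 1)) *
  (qFactorial p m (ν 2) • p ^ (n * ν 2) • binom p (Ug.h₂ p) (ν 2)) *
  (qFactorial p m (ν 3) • dividedPow p (p ^ n • Ug.f p) (ν 3))

/-- The `ℤ_p`-submodule of `U(𝔤)` generated by the elements `levelGen p n m ν`. -/
def levelModule (n m : ℕ) : Submodule ℤ_[p] (Ug p) :=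
  Submodule.span ℤ_[p] (Set.range (levelGen p n m))

/-- The `ℤ_p`-subalgebra `U(p^n 𝔤_{ℤ_p})^(m)` of `U(𝔤)` generated by the elements
`levelGen p n m ν`. -/
def levelAlg (n m : ℕ) : Subalgebra ℤ_[p] (Ug p) :=
  Algebra.adjoin ℤ_[p] (Set.range (levelGen p n m))

lemma qFactorial_dvd {m m' : ℕ} (h : m ≤ m') (ν : ℕ) : qFactorial p m' ν ∣ qFactorial p m ν :=
  Nat.factorial_dvd_factorial
    (Nat.div_le_div_left (Nat.pow_le_pow_right (Fact.out : p.Prime).pos h)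
      (pow_pos (Fact.out : p.Prime).pos m))

lemma nsmul_mul_four {R : Type} [Ring R] (a b c d a' b' c' d' : ℕ) (x y z w : R) :
    ((a' * a) • x) * ((b' * b) • y) * ((c' * c) • z) * ((d' * d) • w) =
      (a * b * c * d) • ((a' • x) * (b' • y) * (c' • z) * (d' • w)) := by
  simp only [smul_mul_assoc, mul_smul_comm, smul_smul]
  congr 1
  ring

lemma levelAlg_mono (n : ℕ) {m m' : ℕ} (h : m ≤ m') : levelAlg p n m ≤ levelAlg p n m' := by
  refine Algebra.adjoin_le ?_
  rintro _ ⟨ν, rfl⟩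
  choose c hc using fun i => qFactorial_dvd p h (ν i)
  have key : levelGen p n m ν = (c 0 * c 1 * c 2 * c 3) • levelGen p n m' ν := by
    simp only [levelGen, hc]
    exact nsmul_mul_four _ _ _ _ _ _ _ _ _ _ _ _
  rw [key]
  exact nsmul_mem (Algebra.subset_adjoin (Set.mem_range_self ν)) _

/-- The completed algebra `Û(p^n 𝔤_{ℤ_p})^(m)`. -/
abbrev LevelCompletion (n m : ℕ) : Type := PadicCompletion p (levelAlg p n m)

/-- The `ℚ_p`-algebra `Û(p^n 𝔤_{ℤ_p})^(m)_ℚ`. -/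
abbrev LevelCompletionQ (n m : ℕ) : Type := CompletionQ p (levelAlg p n m)

/-- The transition maps `Û(p^n 𝔤_{ℤ_p})^(m)_ℚ → Û(p^n 𝔤_{ℤ_p})^(m')_ℚ`, for `m ≤ m'`. -/
def levelTransition (n m m' : ℕ) (h : m ≤ m') :
    LevelCompletionQ p n m →ₐ[ℚ_[p]] LevelCompletionQ p n m' :=
  CompletionQ.map p (Subalgebra.inclusion (levelAlg_mono p n h))

lemma levelTransition_self (n m : ℕ) (h : m ≤ m) :
    levelTransition p n m m h = AlgHom.id ℚ_[p] (LevelCompletionQ p n m) := by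
  rw [levelTransition, Subalgebra.inclusion_self, CompletionQ.map_id]

lemma inclusion_comp {R A : Type} [CommRing R] [Ring A] [Algebra R A] {S T U : Subalgebra R A}
    (h : S ≤ T) (h' : T ≤ U) : Subalgebra.inclusion (h.trans h') =
      (Subalgebra.inclusion h').comp (Subalgebra.inclusion h) := rfl

lemma levelTransition_comp (n : ℕ) {m₁ m₂ m₃ : ℕ} (h : m₁ ≤ m₂) (h' : m₂ ≤ m₃) :
    levelTransition p n m₁ m₃ (h.trans h') =
      (levelTransition p n m₂ m₃ h').comp (levelTransition p n m₁ m₂ h) :=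
  (congrArg (CompletionQ.map p)
    (inclusion_comp (levelAlg_mono p n h) (levelAlg_mono p n h'))).trans (CompletionQ.map_comp p _ _)

instance (n : ℕ) : DirectedSystem (LevelCompletionQ p n)
    (fun m m' h => levelTransition p n m m' h) where
  map_self m x := DFunLike.congr_fun (levelTransition_self p n m le_rfl) x
  map_map _ _ _ h h' x := (DFunLike.congr_fun (levelTransition_comp p n h h') x).symm

/-- The `ℚ_p`-algebra `lim_m Û(p^n 𝔤_{ℤ_p})^(m)_ℚ` (direct limit). -/
def LevelLimit (n : ℕ) : Type :=
  DirectLimit (LevelCompletionQ p n) (fun m m' h => levelTransition p n m m' h)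

instance (n : ℕ) : Ring (LevelLimit p n) :=
  inferInstanceAs (Ring (DirectLimit (LevelCompletionQ p n)
    (fun m m' h => levelTransition p n m m' h)))

instance (n : ℕ) : Algebra ℚ_[p] (LevelLimit p n) :=
  inferInstanceAs (Algebra ℚ_[p] (DirectLimit (LevelCompletionQ p n)
    (fun m m' h => levelTransition p n m m' h)))

/-- The canonical map from level `m` to the direct limit. -/
def LevelLimit.of (n m : ℕ) : LevelCompletionQ p n m →ₐ[ℚ_[p]] LevelLimit p n :=
  DirectLimit.Algebra.of (LevelCompletionQ p n) (fun m m' h => levelTransition p n m m' h) m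

/-- The locally convex inductive limit topology of the Banach spaces
`Û(p^n 𝔤_{ℤ_p})^(m)_ℚ`. -/
instance (n : ℕ) : TopologicalSpace (LevelLimit p n) :=
  inductiveLimitTopology p (fun m => completionQTopology p (levelAlg p n m))
    (fun m => LevelLimit.of p n m)

end Levels

section Tangent

variable {p : ℕ} [Fact p.Prime]

/-- The value `F(g) = ∑ ξ_μ x^μ` of `F` at `g = 1 + p^n x` in `𝔾(n)°(ℚ_p) = 1 + p^n M₂(pℤ_p)`;
a junk value for other matrices `g`. -/
def WideOpenFun.evalAt (n : ℕ) (F : WideOpenFun p) (g : Matrix (Fin 2) (Fin 2) ℚ_[p]) : ℚ_[p] :=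
  ∑' μ : Idx →₀ ℕ, F.coeff μ * μ.prod fun ij k => ((g - 1) ij.1 ij.2 / (p : ℚ_[p]) ^ n) ^ k

instance (n : ℕ) : Algebra ℤ_[p] (AnDist p n) := Algebra.compHom _ (algebraMap ℤ_[p] ℚ_[p])

/-- `lam : U(𝔤) → D^an(𝔾(n)°)` is the algebra homomorphism that sends `X ∈ 𝔤` to the linear form
`F ↦ d/dt F(e^{tX}) |_{t = 0}`. -/
def IsTangentMap (n : ℕ) (lam : Ug p →ₐ[ℚ_[p]] AnDist p n) : Prop :=
  ∀ (X : GL2Lie p) (F : WideOpenFun p),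
    HasDerivAt (fun t : ℚ_[p] => F.evalAt n (NormedSpace.exp (t • X)))
      ((lam (Ug.ι p X)).eval F) 0

end Tangent

end GL2Dist

end

open GL2Dist

noncomputable section
namespace GL2Dist

lemma qFactorial_ne_zero {p : ℕ} (m ν : ℕ) : qFactorial p m ν ≠ 0 := Nat.factorial_ne_zero _

section Arithmetic

variable {p : ℕ} [Fact p.Prime]

lemma norm_natCast_eq_zpow {N : ℕ} (hN : N ≠ 0) :
    ‖(N : ℚ_[p])‖ = (p : ℝ) ^ (-(padicValNat p N : ℤ)) := by
  rw [Padic.norm_eq_zpow_neg_valuation (by exact_mod_cast hN), Padic.valuation_natCast]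

lemma norm_natCast_le_one (N : ℕ) : ‖(N : ℚ_[p])‖ ≤ 1 := by
  simpa using Padic.norm_int_le_one (p := p) (N : ℤ)

lemma norm_natCast_le_of_padicValNat_le {M N : ℕ} (hM : M ≠ 0) (hN : N ≠ 0)
    (h : padicValNat p M ≤ padicValNat p N) : ‖(N : ℚ_[p])‖ ≤ ‖(M : ℚ_[p])‖ := by
  rw [norm_natCast_eq_zpow hM, norm_natCast_eq_zpow hN]
  have hp : (1 : ℝ) ≤ p := by exact_mod_cast (Fact.out : p.Prime).one_le
  exact zpow_le_zpow_right₀ hp (by omega)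

lemma padicValNat_factorial_eq_add_sum (m k : ℕ) : padicValNat p k.factorial =
    padicValNat p (qFactorial p m k) + ∑ s ∈ Finset.range m, k / p ^ (s + 1) := by
  induction m with
  | zero => simp [qFactorial]
  | succ m ih =>
    have h : padicValNat p (k / p ^ m).factorial =
        padicValNat p (k / p ^ (m + 1)).factorial + k / p ^ (m + 1) := by
      rw [← padicValNat_mul_div_factorial, padicValNat_factorial_mul, Nat.div_div_eq_div_mul,
        ← pow_succ]
    rw [ih, Finset.sum_range_succ, qFactorial, qFactorial, h]
    ring

lemma norm_qFactorial_mul_choose_le (m i j : ℕ) :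
    ‖(qFactorial p m i * qFactorial p m j * (i + j).choose i : ℚ_[p])‖ ≤
      ‖(qFactorial p m (i + j) : ℚ_[p])‖ := by
  have hc : (i + j).choose i ≠ 0 := (Nat.choose_pos (by omega)).ne'
  have h := norm_natCast_le_of_padicValNat_le (p := p) (qFactorial_ne_zero (p := p) m (i + j))
    (mul_ne_zero (mul_ne_zero (qFactorial_ne_zero (p := p) m i) (qFactorial_ne_zero (p := p) m j)) hc) ?_
  · push_cast at h; exact h
  rw [padicValNat.mul (mul_ne_zero (qFactorial_ne_zero (p := p) m i) (qFactorial_ne_zero (p := p) m j)) hc,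
    padicValNat.mul (qFactorial_ne_zero (p := p) m i) (qFactorial_ne_zero (p := p) m j)]
  have hf := congrArg (padicValNat p) (Nat.add_choose_mul_factorial_mul_factorial i j)
  rw [← Nat.choose_symm_add] at hf
  rw [padicValNat.mul (mul_ne_zero hc (Nat.factorial_ne_zero _)) (Nat.factorial_ne_zero _),
    padicValNat.mul hc (Nat.factorial_ne_zero _), padicValNat_factorial_eq_add_sum m i,
    padicValNat_factorial_eq_add_sum m j, padicValNat_factorial_eq_add_sum m (i + j)] at hf
  have hs : ∑ s ∈ Finset.range m, i / p ^ (s + 1) + ∑ s ∈ Finset.range m, j / p ^ (s + 1) ≤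
      ∑ s ∈ Finset.range m, (i + j) / p ^ (s + 1) := by
    rw [← Finset.sum_add_distrib]
    exact Finset.sum_le_sum fun s _ => Nat.div_add_div_le_add_div
  omega

lemma norm_qFactorial_add_le (m i j : ℕ) : ‖(qFactorial p m (i + j) : ℚ_[p])‖ ≤
    ‖(qFactorial p m i * qFactorial p m j : ℚ_[p])‖ := by
  obtain ⟨c, hc⟩ := (Nat.factorial_mul_factorial_dvd_factorial_add (i / p ^ m) (j / p ^ m)).trans
    (Nat.factorial_dvd_factorial Nat.div_add_div_le_add_div)
  have : (qFactorial p m (i + j) : ℚ_[p]) = qFactorial p m i * qFactorial p m j * c := by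
    rw [qFactorial, hc, qFactorial, qFactorial]; push_cast; ring
  rw [this, norm_mul]
  exact mul_le_of_le_one_right (norm_nonneg _) (norm_natCast_le_one _)

/-- The factor `q^(m)_i ! p^(n i) / i!`. -/
def levelCoeff (p : ℕ) [Fact p.Prime] (n m i : ℕ) : ℚ_[p] :=
  qFactorial p m i * (p : ℚ_[p]) ^ (n * i) * (i.factorial : ℚ_[p])⁻¹

lemma prime_cast_ne_zero : (p : ℚ_[p]) ≠ 0 := by
  exact_mod_cast (Fact.out : p.Prime).ne_zero

lemma factorial_cast_ne_zero (i : ℕ) : (i.factorial : ℚ_[p]) ≠ 0 := by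
  exact_mod_cast i.factorial_ne_zero

lemma qFactorial_cast_ne_zero (m i : ℕ) : (qFactorial p m i : ℚ_[p]) ≠ 0 := by
  exact_mod_cast qFactorial_ne_zero m i

lemma levelCoeff_ne_zero (n m i : ℕ) : levelCoeff p n m i ≠ 0 :=
  mul_ne_zero (mul_ne_zero (qFactorial_cast_ne_zero m i) (pow_ne_zero _ prime_cast_ne_zero))
    (inv_ne_zero (factorial_cast_ne_zero i))

lemma norm_prime_pow_le_one (k : ℕ) : ‖(p : ℚ_[p]) ^ k‖ ≤ 1 := by
  rw [norm_pow]; exact pow_le_one₀ (norm_nonneg _) Padic.norm_p_lt_one.le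

lemma add_factorial_cast (i j : ℕ) : ((i + j).factorial : ℚ_[p]) =
    (i + j).choose i * i.factorial * j.factorial := by
  have h := Nat.add_choose_mul_factorial_mul_factorial i j
  rw [← Nat.choose_symm_add] at h
  exact_mod_cast h.symm

lemma norm_levelCoeff_mul_div_le (n m i j : ℕ) :
    ‖levelCoeff p n m i * levelCoeff p n m j / levelCoeff p n m (i + j)‖ ≤ 1 := by
  have h : levelCoeff p n m i * levelCoeff p n m j / levelCoeff p n m (i + j) =
      qFactorial p m i * qFactorial p m j * (i + j).choose i / qFactorial p m (i + j) := by
    have h1 := qFactorial_cast_ne_zero (p := p) m (i + j)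
    have h2 := factorial_cast_ne_zero (p := p) i
    have h3 := factorial_cast_ne_zero (p := p) j
    have h4 := prime_cast_ne_zero (p := p)
    have h5 : ((i + j).choose i : ℚ_[p]) ≠ 0 := by
      exact_mod_cast (Nat.choose_pos (by omega)).ne'
    simp only [levelCoeff, add_factorial_cast]
    field_simp
    ring
  rw [h, norm_div]
  exact div_le_one_of_le₀ (norm_qFactorial_mul_choose_le m i j) (norm_nonneg _)

lemma norm_levelCoeff_choose_div_le (n m i j : ℕ) :
    ‖levelCoeff p n m (i + j) * (i + j).choose i / (levelCoeff p n m i * levelCoeff p n m j)‖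
      ≤ 1 := by
  have h : levelCoeff p n m (i + j) * (i + j).choose i /
      (levelCoeff p n m i * levelCoeff p n m j) =
      qFactorial p m (i + j) / (qFactorial p m i * qFactorial p m j) := by
    have h1 := qFactorial_cast_ne_zero (p := p) m i
    have h1' := qFactorial_cast_ne_zero (p := p) m j
    have h2 := factorial_cast_ne_zero (p := p) i
    have h3 := factorial_cast_ne_zero (p := p) j
    have h4 := prime_cast_ne_zero (p := p)
    have h5 : ((i + j).choose i : ℚ_[p]) ≠ 0 := by
      exact_mod_cast (Nat.choose_pos (by omega)).ne'
    simp only [levelCoeff, add_factorial_cast]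
    field_simp
    ring
  rw [h, norm_div]
  exact div_le_one_of_le₀ (norm_qFactorial_add_le m i j) (norm_nonneg _)

lemma norm_levelCoeff_mul_factorial_le (n m i : ℕ) :
    ‖levelCoeff p n m i * i.factorial‖ ≤ 1 := by
  rw [levelCoeff, inv_mul_cancel_right₀ (factorial_cast_ne_zero i), norm_mul]
  exact mul_le_one₀ (norm_natCast_le_one _) (norm_nonneg _) (norm_prime_pow_le_one _)

end Arithmetic

section DescPochhammer

variable {p : ℕ} [Fact p.Prime] {R : Type*} [Ring R] [Algebra ℚ_[p] R]

variable (p) in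
/-- The falling factorial `x (x - 1) ⋯ (x - k + 1)`. -/
def fallingFactorial (x : R) (k : ℕ) : R := Polynomial.aeval x (descPochhammer ℚ_[p] k)

local notation "ff" => fallingFactorial p

@[simp] lemma fallingFactorial_zero (x : R) : ff x 0 = 1 := by
  simp [fallingFactorial]

lemma fallingFactorial_succ (x : R) (k : ℕ) : ff x (k + 1) = ff x k * (x - k) := by
  simp [fallingFactorial, descPochhammer_succ_right]

lemma fallingFactorial_succ' (x : R) (k : ℕ) : ff x (k + 1) = x * ff (x - 1) k := by
  simp [fallingFactorial, descPochhammer_succ_left, Polynomial.aeval_comp]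

lemma fallingFactorial_mul_sub (x : R) (i j : ℕ) : ff x i * ff (x - i) j = ff x (i + j) := by
  simp only [fallingFactorial]
  rw [← descPochhammer_mul, map_mul, Polynomial.aeval_comp]
  simp

lemma fallingFactorial_commute {x y : R} (h : Commute x y) (k : ℕ) : Commute (ff x k) y := by
  induction k with
  | zero => simp
  | succ k ih =>
    rw [fallingFactorial_succ]
    exact ih.mul_left (h.sub_left (Nat.cast_commute k y))

lemma fallingFactorial_commute_fallingFactorial {x y : R} (h : Commute x y) (k l : ℕ) :
    Commute (ff x k) (ff y l) :=
  (fallingFactorial_commute (fallingFactorial_commute h k).symm l).symm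

lemma fallingFactorial_add {x y : R} (h : Commute x y) (k : ℕ) :
    ff (x + y) k = ∑ ij ∈ Finset.HasAntidiagonal.antidiagonal k,
      (k.choose ij.1 : ℚ_[p]) • (ff x ij.1 * ff y ij.2) := by
  have key : ∀ (z : R) (k : ℕ), (descPochhammer ℤ k).smeval z = ff z k := fun z k => by
    rw [fallingFactorial, ← descPochhammer_map (Int.castRingHom ℚ_[p]),
      ← Polynomial.aeval_eq_smeval, ← algebraMap_int_eq, Polynomial.aeval_map_algebraMap]
  have := Ring.descPochhammer_smeval_add k h
  simp only [key] at this
  rw [this]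
  refine Finset.sum_congr rfl fun ij _ => ?_
  rw [Algebra.smul_def, map_natCast]

lemma fallingFactorial_neg (x : R) (k : ℕ) :
    ff (-x) k = (-1 : ℚ_[p]) ^ k • ff (x + ((k : ℤ) - 1 : ℤ)) k := by
  have key : ∀ k : ℕ, ∀ x : R, ff (-x) k = (-1 : ℚ_[p]) ^ k • ff (x + ((k : ℤ) - 1 : ℤ)) k := by
    intro k
    induction k with
    | zero => intro x; simp
    | succ k ih =>
      intro x
      have h1 : ff (-x) (k + 1) = ff (-x) k * (-x - k) := fallingFactorial_succ _ _
      have h2 : ff (x + (((k + 1 : ℕ) : ℤ) - 1 : ℤ)) (k + 1) =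
          (x + k) * ff (x + ((k : ℤ) - 1 : ℤ)) k := by
        rw [fallingFactorial_succ']
        congr 1
        · push_cast; abel
        · congr 1; push_cast; abel
      have h3 : Commute (ff (x + ((k : ℤ) - 1 : ℤ)) k) (x + k) := by
        refine fallingFactorial_commute (Commute.add_right ?_ ?_) k
        · exact (Commute.refl x).add_left (Int.cast_commute _ _)
        · exact (Nat.cast_commute _ _).symm
      rw [h1, h2, ih, ← h3.eq, pow_succ, mul_neg_one, neg_smul, smul_mul_assoc, ← smul_neg,
        ← mul_neg]
      congr 2
      abel
  exact key k x

lemma fallingFactorial_intCast (z : ℤ) (k : ℕ) :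
    ff (z : R) k = ((k.factorial : ℚ_[p]) * (Ring.choose z k : ℤ)) • (1 : R) := by
  have h1 : (z : R) = algebraMap ℚ_[p] R z := (map_intCast _ z).symm
  have h2 : Polynomial.aeval z (descPochhammer ℤ k) = k.factorial • Ring.choose z k := by
    rw [Polynomial.aeval_eq_smeval, Ring.descPochhammer_eq_factorial_smul_choose]
  have h3 : ff (z : ℚ_[p]) k = (k.factorial : ℚ_[p]) * (Ring.choose z k : ℤ) := by
    rw [fallingFactorial, ← descPochhammer_map (Int.castRingHom ℚ_[p]), ← algebraMap_int_eq,
      Polynomial.aeval_map_algebraMap, ← eq_intCast (algebraMap ℤ ℚ_[p]) z,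
      Polynomial.aeval_algebraMap_apply, h2]
    simp
  rw [h1, fallingFactorial, Polynomial.aeval_algebraMap_apply, Algebra.algebraMap_eq_smul_one]
  congr 1

/-- If `y a = a x`, then `P(y) a = a P(x)` for the falling factorials `P`. -/
lemma fallingFactorial_mul_comm {x y a : R} (h : y * a = a * x) (k : ℕ) :
    ff y k * a = a * ff x k := by
  induction k with
  | zero => simp
  | succ k ih =>
    rw [fallingFactorial_succ, fallingFactorial_succ, mul_assoc, sub_mul, h,
      (Nat.cast_commute k a).eq, ← mul_sub, ← mul_assoc, ih, mul_assoc]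

end DescPochhammer

section Sl2

variable {p : ℕ} [Fact p.Prime] {R : Type*} [Ring R] [Algebra ℚ_[p] R] {e f t : R}

local notation "ff" => fallingFactorial p

lemma lower_mul_pow_succ (h : f * e = e * f + t) (ht : t * e = e * (t - 2)) (a : ℕ) :
    f * e ^ (a + 1) = e ^ (a + 1) * f + (a + 1 : ℕ) • (e ^ a * (t - a)) := by
  induction a with
  | zero => simp [h]
  | succ a ih =>
    have h1 : (t - a) * e = e * (t - 2 - a) := by
      rw [sub_mul, ht, mul_sub _ _ (a : R), (Nat.cast_commute a e).eq]
    rw [pow_succ e (a + 1), ← mul_assoc, ih, add_mul, mul_assoc, h, smul_mul_assoc, mul_assoc _ _ e,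
      h1, mul_add, ← mul_assoc, ← mul_assoc (e ^ a), ← pow_succ, ← pow_succ]
    have hk : (a : R) = (a : ℤ) • (1 : R) := by simp
    have h2 : (2 : R) = (2 : ℤ) • (1 : R) := by simp
    have hk' : ((a + 1 : ℕ) : R) = (a + 1 : ℤ) • (1 : R) := by simp
    simp only [← natCast_zsmul, mul_sub, hk, h2, hk', mul_smul_comm, mul_one]
    push_cast
    module

lemma fallingFactorial_pascal (z : R) (a b k : ℕ) :
    ((a.choose (k + 1) * (b + 1).choose (k + 1) * (k + 1).factorial : ℕ) : ℚ_[p]) •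
      ff z (k + 1) =
    ((a.choose (k + 1) * b.choose (k + 1) * (k + 1).factorial : ℕ) : ℚ_[p]) • ff (z - 1) (k + 1) +
    ((a.choose k * b.choose k * k.factorial * (a - k) : ℕ) : ℚ_[p]) •
      ((z + b - k) * ff (z - 1) k) := by
  have hc : ff (z - 1) k * (z - 1 - k) = (z - 1 - k) * ff (z - 1) k :=
    fallingFactorial_commute ((Commute.refl _).sub_right (Nat.cast_commute k _).symm) k
  rw [fallingFactorial_succ', fallingFactorial_succ, hc]
  have h1 : (a.choose k * b.choose k * k.factorial * (a - k) : ℕ) =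
      a.choose (k + 1) * b.choose k * (k + 1).factorial := by
    have := Nat.choose_succ_right_eq a k
    rw [Nat.factorial_succ]
    calc _ = (a.choose k * (a - k)) * (b.choose k * k.factorial) := by ring
      _ = _ := by rw [← this]; ring
  rw [h1, Nat.choose_succ_succ' b k]
  have h2 : (b.choose (k + 1) : ℚ_[p]) * (k + 1) = b.choose k * ((b : ℚ_[p]) - k) := by
    rcases le_or_gt k b with hkb | hkb
    · have := Nat.choose_succ_right_eq b k
      rw [← Nat.cast_sub hkb]
      exact_mod_cast this
    · simp [Nat.choose_eq_zero_of_lt hkb, Nat.choose_eq_zero_of_lt (Nat.lt_succ_of_lt hkb)]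
  have hk : (k : R) = (k : ℚ_[p]) • (1 : R) := by rw [Algebra.smul_def, map_natCast, mul_one]
  have hb : (b : R) = (b : ℚ_[p]) • (1 : R) := by rw [Algebra.smul_def, map_natCast, mul_one]
  rw [← smul_mul_assoc, ← smul_mul_assoc, ← smul_mul_assoc, ← add_mul, hk, hb]
  congr 1
  push_cast
  match_scalars
  · ring
  · linear_combination ((a.choose (k + 1) : ℚ_[p]) * ((k + 1).factorial : ℚ_[p])) * h2

lemma lower_pow_mul_pow (h : f * e = e * f + t) (ht : t * e = e * (t - 2))
    (htf : f * t = (t - 2) * f) (a b : ℕ) :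
    f ^ b * e ^ a = ∑ k ∈ Finset.range (b + 1),
      ((a.choose k * b.choose k * k.factorial : ℕ) : ℚ_[p]) •
        (e ^ (a - k) * ff (t + (2 * k - a - b : ℤ)) k * f ^ (b - k)) := by
  induction b with
  | zero => simp
  | succ b ih =>
    have hz : ∀ k : ℕ, f * ff (t + (2 * k - a - b : ℤ)) k =
        ff (t + (2 * k - a - (b + 1 : ℕ) : ℤ) - 1) k * f := by
      intro k
      refine (fallingFactorial_mul_comm ?_ k).symm
      rw [mul_add, htf, ← (Int.cast_commute _ f).eq, ← add_mul]
      congr 1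
      push_cast
      simp only [← one_add_one_eq_two (R := R)]
      abel
    let A : ℕ → R := fun k => ((a.choose k * b.choose k * k.factorial : ℕ) : ℚ_[p]) •
      (e ^ (a - k) * ff (t + (2 * k - a - (b + 1 : ℕ) : ℤ) - 1) k * f ^ (b + 1 - k))
    let B : ℕ → R := fun k => ((a.choose k * b.choose k * k.factorial * (a - k) : ℕ) : ℚ_[p]) •
      (e ^ (a - (k + 1)) * ((t - (a - (k + 1) : ℤ)) * ff (t + (2 * k - a - b : ℤ)) k)
        * f ^ (b - k))
    have h1 : ∀ k ∈ Finset.range (b + 1), f * (((a.choose k * b.choose k * k.factorial : ℕ) : ℚ_[p]) •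
        (e ^ (a - k) * ff (t + (2 * k - a - b : ℤ)) k * f ^ (b - k))) = A k + B k := by
      intro k hk
      rw [Finset.mem_range] at hk
      have hb : b + 1 - k = (b - k) + 1 := by omega
      have hA : A k = ((a.choose k * b.choose k * k.factorial : ℕ) : ℚ_[p]) •
          (e ^ (a - k) * (f * ff (t + (2 * k - a - b : ℤ)) k) * f ^ (b - k)) := by
        simp only [A]
        rw [hz, hb, pow_succ']
        simp only [mul_assoc]
      rcases lt_trichotomy a k with hak | hak | hak
      · simp [A, B, Nat.choose_eq_zero_of_lt hak]
      · simp only [hA, B]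
        simp [hak, mul_assoc]
      · obtain ⟨c, rfl⟩ : ∃ c, a = k + c + 1 := ⟨a - k - 1, by omega⟩
        have e1 : k + c + 1 - k = c + 1 := by omega
        have e2 : k + c + 1 - (k + 1) = c := by omega
        have e3 : (((k + c + 1 : ℕ) - (k + 1) : ℤ) : R) = (c : R) := by push_cast; abel
        rw [hA]
        simp only [B]
        rw [e1, e2, e3, mul_smul_comm, ← mul_assoc f, ← mul_assoc f, lower_mul_pow_succ h ht,
          Nat.cast_mul _ (c + 1), mul_smul, ← smul_add]
        congr 1
        rw [← Nat.cast_smul_eq_nsmul ℚ_[p]]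
        simp only [add_mul, smul_mul_assoc, mul_assoc]
    have h2 : ∀ k, ((a.choose (k + 1) * (b + 1).choose (k + 1) * (k + 1).factorial : ℕ) : ℚ_[p]) •
        (e ^ (a - (k + 1)) * ff (t + (2 * (k + 1 : ℕ) - a - (b + 1 : ℕ) : ℤ)) (k + 1) *
          f ^ (b + 1 - (k + 1))) = A (k + 1) + B k := by
      intro k
      have e1 : (t - (a - (k + 1) : ℤ)) = t + (2 * (k + 1 : ℕ) - a - (b + 1 : ℕ) : ℤ) + b - k := by
        push_cast; simp only [mul_add, two_mul]; abel
      have e2 : t + (2 * k - a - b : ℤ) = t + (2 * (k + 1 : ℕ) - a - (b + 1 : ℕ) : ℤ) - 1 := by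
        push_cast; simp only [mul_add, two_mul]; abel
      simp only [A, B]
      rw [e1, e2, Nat.add_sub_add_right, ← smul_mul_assoc, ← mul_smul_comm,
        fallingFactorial_pascal]
      simp only [mul_add, add_mul, mul_smul_comm, smul_mul_assoc]
    rw [pow_succ', mul_assoc, ih, Finset.mul_sum, Finset.sum_congr rfl h1, Finset.sum_add_distrib,
      Finset.sum_range_succ' _ (b + 1), Finset.sum_congr rfl fun k _ => h2 k,
      Finset.sum_add_distrib]
    have h3 : ∑ k ∈ Finset.range (b + 1), A k = ∑ k ∈ Finset.range (b + 1), A (k + 1) + A 0 := by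
      rw [← Finset.sum_range_succ' A, Finset.sum_range_succ A (b + 1)]
      simp [A]
    rw [h3]
    simp only [A]
    simp
    abel

end Sl2

section LevelModule

variable {p : ℕ} [Fact p.Prime]

local notation "ff" => fallingFactorial p

lemma smul_mem_of_norm_le_one (N : Submodule ℤ_[p] (Ug p)) {x : Ug p} (hx : x ∈ N) {c : ℚ_[p]}
    (hc : ‖c‖ ≤ 1) : c • x ∈ N :=
  N.smul_mem (⟨c, hc⟩ : ℤ_[p]) hx

variable (n m : ℕ)

/-- The `ℤ_p`-span of the elements `q_i! (p^n x)^i / i!`. -/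
def powSpan (x : Ug p) : Submodule ℤ_[p] (Ug p) :=
  Submodule.span ℤ_[p] (Set.range fun i => levelCoeff p n m i • x ^ i)

/-- The `ℤ_p`-span of the elements `q_i! p^(n i) binom(x, i)`. -/
def binomSpan (x : Ug p) : Submodule ℤ_[p] (Ug p) :=
  Submodule.span ℤ_[p] (Set.range fun i => levelCoeff p n m i • ff x i)

variable {n m}

lemma pow_mem_powSpan (x : Ug p) (i : ℕ) : levelCoeff p n m i • x ^ i ∈ powSpan n m x :=
  Submodule.subset_span ⟨i, rfl⟩

lemma fallingFactorial_mem_binomSpan (x : Ug p) (i : ℕ) :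
    levelCoeff p n m i • ff x i ∈ binomSpan n m x :=
  Submodule.subset_span ⟨i, rfl⟩

lemma span_range_mul_le {N : Submodule ℤ_[p] (Ug p)} {x y : ℕ → Ug p}
    (h : ∀ i j, x i * y j ∈ N) :
    Submodule.span ℤ_[p] (Set.range x) * Submodule.span ℤ_[p] (Set.range y) ≤ N := by
  rw [Submodule.span_mul_span, Submodule.span_le]
  rintro _ ⟨_, ⟨i, rfl⟩, _, ⟨j, rfl⟩, rfl⟩
  exact h i j

lemma powSpan_mul_le (x : Ug p) : powSpan n m x * powSpan n m x ≤ powSpan n m x := by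
  refine span_range_mul_le fun i j => ?_
  have h : (levelCoeff p n m i • x ^ i) * (levelCoeff p n m j • x ^ j) =
      (levelCoeff p n m i * levelCoeff p n m j / levelCoeff p n m (i + j)) •
        (levelCoeff p n m (i + j) • x ^ (i + j)) := by
    rw [smul_mul_smul_comm, smul_smul, div_mul_cancel₀ _ (levelCoeff_ne_zero n m _), pow_add]
  rw [h]
  exact smul_mem_of_norm_le_one _ (pow_mem_powSpan x _) (norm_levelCoeff_mul_div_le n m i j)

lemma sum_fallingFactorial_mem {N P Q : Submodule ℤ_[p] (Ug p)} {x y : Ug p} (hxy : Commute x y)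
    (hx : ∀ i, levelCoeff p n m i • ff x i ∈ P) (hy : ∀ i, levelCoeff p n m i • ff y i ∈ Q)
    (hN : P * Q ≤ N) (k : ℕ) : levelCoeff p n m k • ff (x + y) k ∈ N := by
  rw [fallingFactorial_add hxy, Finset.smul_sum]
  refine sum_mem fun ⟨i, j⟩ hij => ?_
  obtain rfl : i + j = k := by simpa using hij
  have h : levelCoeff p n m (i + j) • ((i + j).choose i : ℚ_[p]) • (ff x i * ff y j) =
      (levelCoeff p n m (i + j) * (i + j).choose i / (levelCoeff p n m i * levelCoeff p n m j)) •
        ((levelCoeff p n m i • ff x i) * (levelCoeff p n m j • ff y j)) := by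
    rw [smul_mul_smul_comm, smul_smul, smul_smul, div_mul_cancel₀]
    exact mul_ne_zero (levelCoeff_ne_zero n m _) (levelCoeff_ne_zero n m _)
  rw [h]
  exact smul_mem_of_norm_le_one _ (hN (Submodule.mul_mem_mul (hx i) (hy j)))
    (norm_levelCoeff_choose_div_le n m i j)

lemma fallingFactorial_add_int_mem (x : Ug p) (z : ℤ) (k : ℕ) :
    levelCoeff p n m k • ff (x + z) k ∈ binomSpan n m x := by
  refine sum_fallingFactorial_mem (Q := 1) (Int.cast_commute z x).symm
    (fallingFactorial_mem_binomSpan x) (fun i => ?_) (mul_one _).le k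
  rw [fallingFactorial_intCast, smul_smul, ← mul_assoc]
  refine smul_mem_of_norm_le_one 1 (Submodule.one_le.mp le_rfl) ?_
  rw [norm_mul]
  exact mul_le_one₀ (norm_levelCoeff_mul_factorial_le n m i) (norm_nonneg _)
    (Padic.norm_int_le_one _)

lemma fallingFactorial_neg_mem (x : Ug p) (k : ℕ) :
    levelCoeff p n m k • ff (-x) k ∈ binomSpan n m x := by
  rw [fallingFactorial_neg, smul_comm]
  exact smul_mem_of_norm_le_one _ (fallingFactorial_add_int_mem x _ k) (by simp)

lemma binomSpan_mul_le (x : Ug p) : binomSpan n m x * binomSpan n m x ≤ binomSpan n m x := by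
  refine span_range_mul_le fun i j => ?_
  have hx : x = (x - i) + (i : ℤ) := by simp
  have h1 : (levelCoeff p n m i • ff x i) * (levelCoeff p n m j • ff x j) =
      levelCoeff p n m j • (levelCoeff p n m i • ff x i) * ff ((x - i) + (i : ℤ)) j := by
    rw [← hx, mul_smul_comm, smul_mul_assoc, smul_mul_assoc, smul_mul_assoc]
  have hc : Commute (x - i) ((i : ℤ) : Ug p) := (Int.cast_commute _ _).symm
  rw [h1, fallingFactorial_add hc, Finset.mul_sum]
  refine sum_mem fun ⟨a, c⟩ hac => ?_
  obtain rfl : a + c = j := by simpa using hac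
  dsimp only
  rw [fallingFactorial_intCast]
  have h2 : levelCoeff p n m (a + c) • (levelCoeff p n m i • ff x i) *
      ((a + c).choose a : ℚ_[p]) • (ff (x - i) a *
        ((c.factorial : ℚ_[p]) * (Ring.choose (i : ℤ) c : ℤ)) • (1 : Ug p)) =
      ((levelCoeff p n m (a + c) * (a + c).choose a / (levelCoeff p n m a * levelCoeff p n m c)) *
        (levelCoeff p n m c * c.factorial) * (Ring.choose (i : ℤ) c : ℤ) *
        (levelCoeff p n m i * levelCoeff p n m a / levelCoeff p n m (i + a))) •
        (levelCoeff p n m (i + a) • ff x (i + a)) := by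
    rw [← fallingFactorial_mul_sub x i a]
    simp only [smul_mul_assoc, mul_smul_comm, mul_one, smul_smul]
    congr 1
    have h1 := levelCoeff_ne_zero (p := p) n m (i + a)
    have h2 := levelCoeff_ne_zero (p := p) n m a
    have h3 := levelCoeff_ne_zero (p := p) n m c
    field_simp
  rw [h2]
  refine smul_mem_of_norm_le_one _ (fallingFactorial_mem_binomSpan x _) ?_
  rw [norm_mul, norm_mul, norm_mul]
  refine mul_le_one₀ (mul_le_one₀ (mul_le_one₀ ?_ (norm_nonneg _) ?_) (norm_nonneg _) ?_)
    (norm_nonneg _) ?_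
  · exact norm_levelCoeff_choose_div_le n m a c
  · exact norm_levelCoeff_mul_factorial_le n m c
  · exact Padic.norm_int_le_one _
  · exact norm_levelCoeff_mul_div_le n m i a

lemma mul_pow_of_mul_eq {h e : Ug p} {z : ℤ} (H : h * e = e * (h + z)) (i : ℕ) :
    h * e ^ i = e ^ i * (h + (i * z : ℤ)) := by
  induction i with
  | zero => simp
  | succ i ih =>
    rw [pow_succ, ← mul_assoc, ih, mul_assoc, add_mul, H, (Int.cast_commute _ e).eq, ← mul_add,
      ← mul_assoc, add_assoc, ← Int.cast_add]
    congr 3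
    push_cast
    ring

lemma pow_mul_of_mul_eq {h f : Ug p} {z : ℤ} (H : f * h = (h + z) * f) (i : ℕ) :
    f ^ i * h = (h + (i * z : ℤ)) * f ^ i := by
  induction i with
  | zero => simp
  | succ i ih =>
    rw [pow_succ', mul_assoc, ih, ← mul_assoc, mul_add, H, ← (Int.cast_commute _ f).eq, ← add_mul,
      mul_assoc, add_assoc, ← Int.cast_add]
    congr 3
    push_cast
    ring

lemma binomSpan_mul_powSpan_le {h e : Ug p} {z : ℤ} (H : h * e = e * (h + z)) :
    binomSpan n m h * powSpan n m e ≤ powSpan n m e * binomSpan n m h := by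
  refine span_range_mul_le fun i j => ?_
  have key := fallingFactorial_mul_comm (p := p) (mul_pow_of_mul_eq H j) i
  have h1 : (levelCoeff p n m i • ff h i) * (levelCoeff p n m j • e ^ j) =
      (levelCoeff p n m j • e ^ j) * (levelCoeff p n m i • ff (h + (j * z : ℤ)) i) := by
    rw [smul_mul_smul_comm, smul_mul_smul_comm, key, mul_comm (levelCoeff p n m i)]
  rw [h1]
  exact Submodule.mul_mem_mul (pow_mem_powSpan _ _) (fallingFactorial_add_int_mem _ _ _)

lemma powSpan_mul_binomSpan_le {h f : Ug p} {z : ℤ} (H : f * h = (h + z) * f) :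
    powSpan n m f * binomSpan n m h ≤ binomSpan n m h * powSpan n m f := by
  refine span_range_mul_le fun j i => ?_
  have key := fallingFactorial_mul_comm (p := p) (pow_mul_of_mul_eq H j).symm i
  have h1 : (levelCoeff p n m j • f ^ j) * (levelCoeff p n m i • ff h i) =
      (levelCoeff p n m i • ff (h + (j * z : ℤ)) i) * (levelCoeff p n m j • f ^ j) := by
    rw [smul_mul_smul_comm, smul_mul_smul_comm, key, mul_comm (levelCoeff p n m i)]
  rw [h1]
  exact Submodule.mul_mem_mul (fallingFactorial_add_int_mem _ _ _) (pow_mem_powSpan _ _)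

lemma binomSpan_mul_comm_le {x y : Ug p} (H : Commute x y) :
    binomSpan n m x * binomSpan n m y ≤ binomSpan n m y * binomSpan n m x := by
  refine span_range_mul_le fun i j => ?_
  have hc : Commute (levelCoeff p n m i • ff x i) (levelCoeff p n m j • ff y j) :=
    ((fallingFactorial_commute_fallingFactorial H i j).smul_left _).smul_right _
  rw [hc.eq]
  exact Submodule.mul_mem_mul (fallingFactorial_mem_binomSpan _ _)
    (fallingFactorial_mem_binomSpan _ _)

lemma powSpan_lower_mul_raise_le {e f h₁ h₂ : Ug p} (hc : Commute h₁ h₂)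
    (h : f * e = e * f + (h₂ - h₁)) (he : (h₂ - h₁) * e = e * ((h₂ - h₁) - 2))
    (hf : f * (h₂ - h₁) = ((h₂ - h₁) - 2) * f) :
    powSpan n m f * powSpan n m e ≤
      powSpan n m e * (binomSpan n m h₁ * binomSpan n m h₂) * powSpan n m f := by
  refine span_range_mul_le fun b a => ?_
  rw [smul_mul_smul_comm, lower_pow_mul_pow (p := p) h he hf, Finset.smul_sum]
  refine sum_mem fun k hk => ?_
  rcases lt_or_ge a k with hak | hak
  · simp [Nat.choose_eq_zero_of_lt hak]
  obtain ⟨a, rfl⟩ := Nat.exists_eq_add_of_le hak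
  obtain ⟨b, rfl⟩ := Nat.exists_eq_add_of_le (Nat.lt_succ_iff.mp (Finset.mem_range.mp hk))
  rw [Nat.add_sub_cancel_left, Nat.add_sub_cancel_left]
  generalize (2 * k - (k + a : ℕ) - (k + b : ℕ) : ℤ) = z
  have hz : h₂ - h₁ + z = -h₁ + (h₂ + z) := by abel
  rw [hz]
  have hmem : levelCoeff p n m k • ff (-h₁ + (h₂ + z)) k ∈ binomSpan n m h₁ * binomSpan n m h₂ :=
    sum_fallingFactorial_mem (hc.add_right (Int.cast_commute z h₁).symm).neg_left
      (fallingFactorial_neg_mem h₁) (fun i => fallingFactorial_add_int_mem h₂ z i) le_rfl k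
  have h2 : (levelCoeff p n m (k + b) * levelCoeff p n m (k + a)) •
      (((k + a).choose k * (k + b).choose k * k.factorial : ℕ) : ℚ_[p]) •
        (e ^ a * ff (-h₁ + (h₂ + z)) k * f ^ b) =
      ((levelCoeff p n m (k + a) * (k + a).choose k / (levelCoeff p n m k * levelCoeff p n m a)) *
       (levelCoeff p n m (k + b) * (k + b).choose k / (levelCoeff p n m k * levelCoeff p n m b)) *
       (levelCoeff p n m k * k.factorial)) •
        ((levelCoeff p n m a • e ^ a) * (levelCoeff p n m k • ff (-h₁ + (h₂ + z)) k) *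
          (levelCoeff p n m b • f ^ b)) := by
    simp only [smul_mul_assoc, mul_smul_comm, smul_smul]
    congr 1
    have h1 := levelCoeff_ne_zero (p := p) n m k
    have h2 := levelCoeff_ne_zero (p := p) n m a
    have h3 := levelCoeff_ne_zero (p := p) n m b
    push_cast
    field_simp
  rw [h2]
  refine smul_mem_of_norm_le_one _ (Submodule.mul_mem_mul
    (Submodule.mul_mem_mul (pow_mem_powSpan _ _) hmem) (pow_mem_powSpan _ _)) ?_
  rw [norm_mul, norm_mul]
  exact mul_le_one₀ (mul_le_one₀ (norm_levelCoeff_choose_div_le n m k a) (norm_nonneg _)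
    (norm_levelCoeff_choose_div_le n m k b)) (norm_nonneg _)
    (norm_levelCoeff_mul_factorial_le n m k)

end LevelModule

section Relations

attribute [local instance 100] LieRing.ofAssociativeRing

variable (p : ℕ) [Fact p.Prime]

lemma Ug.ι_mul_sub (x y : GL2Lie p) :
    Ug.ι p x * Ug.ι p y - Ug.ι p y * Ug.ι p x = Ug.ι p (x * y - y * x) :=
  ((UniversalEnvelopingAlgebra.ι ℚ_[p] : GL2Lie p →ₗ⁅ℚ_[p]⁆ _).map_lie x y).symm

lemma Ug.h₁_mul_e : Ug.h₁ p * Ug.e p = Ug.e p * (Ug.h₁ p + (1 : ℤ)) := by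
  have h := Ug.ι_mul_sub p !![1, 0; 0, 0] !![0, 1; 0, 0]
  have h' : (!![1, 0; 0, 0] * !![0, 1; 0, 0] - !![0, 1; 0, 0] * !![1, 0; 0, 0] : GL2Lie p) =
      !![0, 1; 0, 0] := by
    ext i j; fin_cases i <;> fin_cases j <;> simp
  rw [h', sub_eq_iff_eq_add'] at h
  simpa [mul_add, Ug.e, Ug.f, Ug.h₁, Ug.h₂] using h

lemma Ug.h₂_mul_e : Ug.h₂ p * Ug.e p = Ug.e p * (Ug.h₂ p + (-1 : ℤ)) := by
  have h := Ug.ι_mul_sub p !![0, 0; 0, 1] !![0, 1; 0, 0]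
  have h' : (!![0, 0; 0, 1] * !![0, 1; 0, 0] - !![0, 1; 0, 0] * !![0, 0; 0, 1] : GL2Lie p) =
      -!![0, 1; 0, 0] := by
    ext i j; fin_cases i <;> fin_cases j <;> simp
  rw [h', sub_eq_iff_eq_add', map_neg] at h
  simpa [mul_add, Ug.e, Ug.f, Ug.h₁, Ug.h₂] using h

lemma Ug.f_mul_h₁ : Ug.f p * Ug.h₁ p = (Ug.h₁ p + (1 : ℤ)) * Ug.f p := by
  have h := Ug.ι_mul_sub p !![0, 0; 1, 0] !![1, 0; 0, 0]
  have h' : (!![0, 0; 1, 0] * !![1, 0; 0, 0] - !![1, 0; 0, 0] * !![0, 0; 1, 0] : GL2Lie p) =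
      !![0, 0; 1, 0] := by
    ext i j; fin_cases i <;> fin_cases j <;> simp
  rw [h', sub_eq_iff_eq_add'] at h
  simpa [add_mul, Ug.e, Ug.f, Ug.h₁, Ug.h₂] using h

lemma Ug.f_mul_h₂ : Ug.f p * Ug.h₂ p = (Ug.h₂ p + (-1 : ℤ)) * Ug.f p := by
  have h := Ug.ι_mul_sub p !![0, 0; 1, 0] !![0, 0; 0, 1]
  have h' : (!![0, 0; 1, 0] * !![0, 0; 0, 1] - !![0, 0; 0, 1] * !![0, 0; 1, 0] : GL2Lie p) =
      -!![0, 0; 1, 0] := by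
    ext i j; fin_cases i <;> fin_cases j <;> simp
  rw [h', sub_eq_iff_eq_add', map_neg] at h
  simpa [add_mul, Ug.e, Ug.f, Ug.h₁, Ug.h₂] using h

lemma Ug.h₁_commute_h₂ : Commute (Ug.h₁ p) (Ug.h₂ p) := by
  have h := Ug.ι_mul_sub p !![1, 0; 0, 0] !![0, 0; 0, 1]
  have h' : (!![1, 0; 0, 0] * !![0, 0; 0, 1] - !![0, 0; 0, 1] * !![1, 0; 0, 0] : GL2Lie p) =
      0 := by
    ext i j; fin_cases i <;> fin_cases j <;> simp
  rw [h', map_zero] at h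
  exact sub_eq_zero.mp h

lemma Ug.f_mul_e : Ug.f p * Ug.e p = Ug.e p * Ug.f p + (Ug.h₂ p - Ug.h₁ p) := by
  have h := Ug.ι_mul_sub p !![0, 0; 1, 0] !![0, 1; 0, 0]
  have h' : (!![0, 0; 1, 0] * !![0, 1; 0, 0] - !![0, 1; 0, 0] * !![0, 0; 1, 0] : GL2Lie p) =
      !![0, 0; 0, 1] - !![1, 0; 0, 0] := by
    ext i j; fin_cases i <;> fin_cases j <;> simp
  rw [h', sub_eq_iff_eq_add', map_sub] at h
  exact h

end Relations

section LevelModule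

variable (p : ℕ) [Fact p.Prime] (n m : ℕ)

lemma qFactorial_smul_dividedPow (x : Ug p) (i : ℕ) :
    qFactorial p m i • dividedPow p (p ^ n • x) i = levelCoeff p n m i • x ^ i := by
  rw [dividedPow, levelCoeff, smul_pow, ← Nat.cast_smul_eq_nsmul ℚ_[p],
    ← Nat.cast_smul_eq_nsmul ℚ_[p], smul_smul, smul_smul, pow_mul]
  push_cast
  congr 1
  ring

lemma qFactorial_smul_binom (x : Ug p) (i : ℕ) :
    qFactorial p m i • p ^ (n * i) • binom p x i = levelCoeff p n m i • fallingFactorial p x i := by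
  rw [binom, levelCoeff, ← Nat.cast_smul_eq_nsmul ℚ_[p], ← Nat.cast_smul_eq_nsmul ℚ_[p], smul_smul,
    smul_smul, fallingFactorial]
  push_cast
  rfl

lemma levelGen_eq (ν : Fin 4 → ℕ) : levelGen p n m ν =
    (levelCoeff p n m (ν 0) • Ug.e p ^ ν 0) *
    (levelCoeff p n m (ν 1) • fallingFactorial p (Ug.h₁ p) (ν 1)) *
    (levelCoeff p n m (ν 2) • fallingFactorial p (Ug.h₂ p) (ν 2)) *
    (levelCoeff p n m (ν 3) • Ug.f p ^ ν 3) := by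
  rw [levelGen, qFactorial_smul_dividedPow, qFactorial_smul_dividedPow, qFactorial_smul_binom,
    qFactorial_smul_binom]

lemma levelModule_eq : levelModule p n m = powSpan n m (Ug.e p) *
    (binomSpan n m (Ug.h₁ p) * binomSpan n m (Ug.h₂ p)) * powSpan n m (Ug.f p) := by
  rw [powSpan, powSpan, binomSpan, binomSpan, Submodule.span_mul_span, Submodule.span_mul_span,
    Submodule.span_mul_span, levelModule]
  congr 1
  ext x
  constructor
  · rintro ⟨ν, rfl⟩
    rw [levelGen_eq, mul_assoc (_ • Ug.e p ^ ν 0)]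
    exact Set.mul_mem_mul (Set.mul_mem_mul ⟨_, rfl⟩ (Set.mul_mem_mul ⟨_, rfl⟩ ⟨_, rfl⟩)) ⟨_, rfl⟩
  · rintro ⟨_, ⟨_, ⟨i, rfl⟩, _, ⟨_, ⟨j, rfl⟩, _, ⟨k, rfl⟩, rfl⟩, rfl⟩, _, ⟨l, rfl⟩, rfl⟩
    refine ⟨![i, j, k, l], ?_⟩
    rw [levelGen_eq]
    simp [mul_assoc]

lemma levelModule_mul_le : levelModule p n m * levelModule p n m ≤ levelModule p n m := by
  rw [levelModule_eq]
  have hEE := powSpan_mul_le (n := n) (m := m) (Ug.e p)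
  have hFF := powSpan_mul_le (n := n) (m := m) (Ug.f p)
  have h11 := binomSpan_mul_le (n := n) (m := m) (Ug.h₁ p)
  have h22 := binomSpan_mul_le (n := n) (m := m) (Ug.h₂ p)
  have h21 := binomSpan_mul_comm_le (n := n) (m := m) (Ug.h₁_commute_h₂ p).symm
  have h1E := binomSpan_mul_powSpan_le (n := n) (m := m) (Ug.h₁_mul_e p)
  have h2E := binomSpan_mul_powSpan_le (n := n) (m := m) (Ug.h₂_mul_e p)
  have hF1 := powSpan_mul_binomSpan_le (n := n) (m := m) (Ug.f_mul_h₁ p)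
  have hF2 := powSpan_mul_binomSpan_le (n := n) (m := m) (Ug.f_mul_h₂ p)
  have hFE := powSpan_lower_mul_raise_le (n := n) (m := m) (Ug.h₁_commute_h₂ p) (Ug.f_mul_e p)
    (by
      rw [sub_mul, Ug.h₁_mul_e, Ug.h₂_mul_e, ← mul_sub, ← one_add_one_eq_two]
      congr 1; push_cast; abel)
    (by
      rw [mul_sub, Ug.f_mul_h₁, Ug.f_mul_h₂, ← sub_mul, ← one_add_one_eq_two]
      congr 1; push_cast; abel)
  generalize powSpan n m (Ug.e p) = E at *
  generalize powSpan n m (Ug.f p) = F at *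
  generalize binomSpan n m (Ug.h₁ p) = H₁ at *
  generalize binomSpan n m (Ug.h₂ p) = H₂ at *
  have hHH : H₁ * H₂ * (H₁ * H₂) ≤ H₁ * H₂ := calc
    H₁ * H₂ * (H₁ * H₂) = H₁ * (H₂ * H₁) * H₂ := by simp only [mul_assoc]
    _ ≤ H₁ * (H₁ * H₂) * H₂ := by gcongr
    _ = (H₁ * H₁) * (H₂ * H₂) := by simp only [mul_assoc]
    _ ≤ H₁ * H₂ := by gcongr
  have hHE : H₁ * H₂ * E ≤ E * (H₁ * H₂) := calc
    H₁ * H₂ * E = H₁ * (H₂ * E) := mul_assoc _ _ _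
    _ ≤ H₁ * (E * H₂) := by gcongr
    _ = (H₁ * E) * H₂ := (mul_assoc _ _ _).symm
    _ ≤ E * H₁ * H₂ := by gcongr
    _ = E * (H₁ * H₂) := mul_assoc _ _ _
  have hFH : F * (H₁ * H₂) ≤ H₁ * H₂ * F := calc
    F * (H₁ * H₂) = (F * H₁) * H₂ := (mul_assoc _ _ _).symm
    _ ≤ (H₁ * F) * H₂ := by gcongr
    _ = H₁ * (F * H₂) := mul_assoc _ _ _
    _ ≤ H₁ * (H₂ * F) := by gcongr
    _ = H₁ * H₂ * F := (mul_assoc _ _ _).symm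
  generalize H₁ * H₂ = H at *
  calc E * H * F * (E * H * F) = E * H * (F * E) * (H * F) := by simp only [mul_assoc]
    _ ≤ E * H * (E * H * F) * (H * F) := by gcongr
    _ = E * (H * E) * H * (F * H) * F := by simp only [mul_assoc]
    _ ≤ E * (E * H) * H * (H * F) * F := by gcongr
    _ = (E * E) * ((H * H) * H) * (F * F) := by simp only [mul_assoc]
    _ ≤ E * (H * H) * F := by gcongr
    _ ≤ E * H * F := by gcongr

lemma levelGen_zero : levelGen p n m 0 = 1 := by
  simp [levelGen_eq, levelCoeff, qFactorial]

theorem toSubmodule_levelAlg : Subalgebra.toSubmodule (levelAlg p n m) = levelModule p n m := by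
  have h1 : (1 : Ug p) ∈ levelModule p n m := Submodule.subset_span ⟨0, levelGen_zero p n m⟩
  refine le_antisymm ?_ (Submodule.span_le.mpr Algebra.subset_adjoin)
  exact Algebra.adjoin_le (S := (levelModule p n m).toSubalgebra h1 fun x y hx hy =>
    levelModule_mul_le p n m (Submodule.mul_mem_mul hx hy)) Submodule.subset_span

end LevelModule

section Dual

variable {p : ℕ} [Fact p.Prime] {n : ℕ}

open Classical in
/-- The functional `∑ ξ_κ x^κ ↦ ξ_μ`. -/
def AnDist.dual (μ : Idx →₀ ℕ) : AnDist p n :=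
  AnDist.ofBound (fun κ => if κ = μ then 1 else 0) (by
    refine ⟨⟨1 / 2, by norm_num, by norm_num⟩, 2 ^ μ.degree, by positivity, fun κ => ?_⟩
    split_ifs with h
    · subst h
      simp
    · simp only [norm_zero]
      positivity)

lemma AnDist.dual_eval_monom [DecidableEq (Idx →₀ ℕ)] (μ κ : Idx →₀ ℕ) :
    (AnDist.dual μ : AnDist p n).eval (monom κ) = if κ = μ then 1 else 0 := by
  rw [AnDist.dual, AnDist.ofBound_monom]
  congr

lemma AnDist.dual_eval (μ : Idx →₀ ℕ) (F : WideOpenFun p) :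
    (AnDist.dual μ : AnDist p n).eval F = F.coeff μ := by
  classical
  refine ((AnDist.dual μ : AnDist p n).hasSum F).unique ?_
  simp only [dual_eval_monom, mul_ite, mul_one, mul_zero]
  exact hasSum_ite_eq μ (F.coeff μ) |>.congr_fun (by
    intro κ
    by_cases h : κ = μ <;> simp [h])

variable (p) in
/-- The point `(1 + p^n v)(1 + p^n w)` in the coordinates `x`. -/
def pointMul (n : ℕ) {B : Type} [CommRing B] [Algebra ℚ_[p] B] (v w : Fin 2 → Fin 2 → B) :
    Fin 2 → Fin 2 → B :=
  fun i j => v i j + w i j + (p : ℚ_[p]) ^ n • ∑ k, v i k * w k j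

lemma lift_comp_comul {B : Type} [CommRing B] [Algebra ℚ_[p] B] (v w : Fin 2 → Fin 2 → B) :
    (Algebra.TensorProduct.lift (Coord.aeval v) (Coord.aeval w) fun _ _ => Commute.all _ _).comp
      (Coord.comul p n) = Coord.aeval (pointMul p n v w) := by
  refine Coord.algHom_ext fun i j => ?_
  simp [Coord.comul, pointMul]

lemma AnDist.mul_eval_monom_of_points {B : Type} [CommRing B] [Algebra ℚ_[p] B]
    {v w : Fin 2 → Fin 2 → B} {ℓ : B →ₗ[ℚ_[p]] ℚ_[p]} {δ δ' : AnDist p n}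
    (h : ∀ μ κ, ℓ (Coord.aeval v (Coord.mon p n μ) * Coord.aeval w (Coord.mon p n κ)) =
      δ.eval (monom μ) * δ'.eval (monom κ)) (μ : Idx →₀ ℕ) :
    (δ * δ').eval (monom μ) = ℓ (Coord.aeval (pointMul p n v w) (Coord.mon p n μ)) := by
  rw [AnDist.mul_eval_monom, ← lift_comp_comul, AlgHom.comp_apply]
  have key : LinearMap.mul' ℚ_[p] ℚ_[p] ∘ₗ TensorProduct.map δ.toPoly δ'.toPoly =
      ℓ ∘ₗ (Algebra.TensorProduct.lift (Coord.aeval v) (Coord.aeval w)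
        fun _ _ => Commute.all _ _).toLinearMap := by
    refine TensorProduct.ext (Module.Basis.ext (MvPolynomial.basisMonomials Idx ℚ_[p]) fun μ =>
      Module.Basis.ext (MvPolynomial.basisMonomials Idx ℚ_[p]) fun κ => ?_)
    rw [MvPolynomial.coe_basisMonomials]
    change δ.toPoly (Coord.mon p n μ) * δ'.toPoly (Coord.mon p n κ) =
      ℓ (Algebra.TensorProduct.lift (Coord.aeval v) (Coord.aeval w) (fun _ _ => Commute.all _ _)
        (Coord.mon p n μ ⊗ₜ Coord.mon p n κ))
    rw [Algebra.TensorProduct.lift_tmul, h, toPoly_mon, toPoly_mon]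
  exact LinearMap.congr_fun key _

lemma Coord.aeval_mon {B : Type} [CommRing B] [Algebra ℚ_[p] B] (v : Fin 2 → Fin 2 → B)
    (μ : Idx →₀ ℕ) : Coord.aeval v (Coord.mon p n μ) = μ.prod fun ij k => v ij.1 ij.2 ^ k := by
  refine (MvPolynomial.aeval_monomial (fun ij : Idx => v ij.1 ij.2) μ (1 : ℚ_[p])).trans ?_
  rw [map_one, one_mul]

/-- The point with coordinate `b` at `s` and all other coordinates `0`. -/
def axisPoint {B : Type} [Zero B] (s : Idx) (b : B) : Fin 2 → Fin 2 → B :=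
  fun i j => if (i, j) = s then b else 0

lemma aeval_axisPoint_single {B : Type} [CommRing B] [Algebra ℚ_[p] B] (s : Idx) (b : B) (k : ℕ) :
    Coord.aeval (axisPoint s b) (Coord.mon p n (Finsupp.single s k)) = b ^ k := by
  rw [Coord.aeval_mon, Finsupp.prod_single_index (by simp)]
  simp [axisPoint]

lemma aeval_axisPoint_of_ne {B : Type} [CommRing B] [Algebra ℚ_[p] B] (s : Idx) (b : B)
    {μ : Idx →₀ ℕ} (h : ∀ k, μ ≠ Finsupp.single s k) :
    Coord.aeval (axisPoint s b) (Coord.mon p n μ) = 0 := by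
  rw [Coord.aeval_mon]
  obtain ⟨t, hts, ht⟩ : ∃ t, t ≠ s ∧ μ t ≠ 0 := by
    by_contra! hc
    refine h (μ s) (Finsupp.ext fun t => ?_)
    by_cases hts : t = s
    · simp [hts]
    · simp [hc t hts, Finsupp.single_eq_of_ne hts]
  refine Finset.prod_eq_zero (i := t) (by simpa using ht) ?_
  simp [axisPoint, hts, ht]

lemma pointMul_axisPoint {B : Type} [CommRing B] [Algebra ℚ_[p] B] (s : Idx) (b c : B) :
    pointMul p n (axisPoint s b) (axisPoint s c) = axisPoint s
      (b + c + (if s.1 = s.2 then (p : ℚ_[p]) ^ n else 0) • (b * c)) := by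
  obtain ⟨s, t⟩ := s
  funext i j
  fin_cases s <;> fin_cases t <;> fin_cases i <;> fin_cases j <;>
    simp [pointMul, axisPoint]

lemma AnDist.dual_single_mul (s : Idx) (k : ℕ) :
    (AnDist.dual (Finsupp.single s k) * AnDist.dual (Finsupp.single s 1) : AnDist p n) =
      (k + 1 : ℚ_[p]) • AnDist.dual (Finsupp.single s (k + 1)) +
      ((if s.1 = s.2 then (p : ℚ_[p]) ^ n else 0) * k) • AnDist.dual (Finsupp.single s k) := by
  classical
  let ℓ : DualNumber (Polynomial ℚ_[p]) →ₗ[ℚ_[p]] ℚ_[p] :=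
    { toFun := fun b => b.snd.coeff k
      map_add' := fun _ _ => by simp
      map_smul' := fun _ _ => by simp }
  have hsnd : ∀ b, ℓ b = b.snd.coeff k := fun _ => rfl
  let X : DualNumber (Polynomial ℚ_[p]) := TrivSqZeroExt.inl Polynomial.X
  have hX : ∀ i : ℕ, X ^ i = TrivSqZeroExt.inl (Polynomial.X ^ i) := fun i => by
    simp [X]
  have hinj : ∀ i j : ℕ, Finsupp.single s i = Finsupp.single s j ↔ i = j := fun i j =>
    (Finsupp.single_injective s).eq_iff
  have key := AnDist.mul_eval_monom_of_points (n := n) (v := axisPoint s X)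
    (w := axisPoint s (DualNumber.eps : DualNumber (Polynomial ℚ_[p]))) (ℓ := ℓ) (δ := AnDist.dual (Finsupp.single s k))
    (δ' := AnDist.dual (Finsupp.single s 1)) ?_
  · refine AnDist.ext fun μ => ?_
    rw [key, pointMul_axisPoint, AnDist.eval_add, AnDist.eval_smul, AnDist.eval_smul,
      AnDist.dual_eval_monom, AnDist.dual_eval_monom]
    by_cases hμ : ∃ j, μ = Finsupp.single s j
    · obtain ⟨j, rfl⟩ := hμ
      rw [aeval_axisPoint_single, hsnd, TrivSqZeroExt.snd_pow]
      simp only [hinj]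
      generalize (if s.1 = s.2 then (p : ℚ_[p]) ^ n else 0) = c
      rcases j with _ | j
      · simp
        rintro rfl
        simp
      · have h : (Polynomial.X ^ j * (1 + c • Polynomial.X) : Polynomial ℚ_[p]) =
            Polynomial.X ^ j + c • Polynomial.X ^ (j + 1) := by
          rw [mul_add, mul_one, mul_smul_comm, pow_succ]
        have hC : (j + 1 : Polynomial ℚ_[p]) = Polynomial.C (j + 1 : ℚ_[p]) := by simp
        have hsn : (X + DualNumber.eps + c • (X * DualNumber.eps)).snd = 1 + c • Polynomial.X := by
          simp [X]
        have hfs : (X + DualNumber.eps + c • (X * DualNumber.eps)).fst = Polynomial.X := by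
          simp [X]
        rw [hsn, hfs, smul_eq_mul, Nat.pred_succ, h, nsmul_eq_mul,
          Nat.cast_succ, hC, Polynomial.coeff_C_mul, Polynomial.coeff_add, Polynomial.coeff_smul,
          Polynomial.coeff_X_pow, Polynomial.coeff_X_pow]
        rcases eq_or_ne k j with rfl | h1
        · simp
        · rcases eq_or_ne k (j + 1) with rfl | h2
          · simp [mul_comm]
          · simp [h1, h2, h1.symm, h2.symm]
    · push Not at hμ
      rw [aeval_axisPoint_of_ne s _ hμ, map_zero, if_neg (hμ _), if_neg (hμ _)]
      simp
  · intro μ κ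
    rw [AnDist.dual_eval_monom, AnDist.dual_eval_monom]
    by_cases hμ : ∃ j, μ = Finsupp.single s j
    · by_cases hκ : ∃ j, κ = Finsupp.single s j
      · obtain ⟨i, rfl⟩ := hμ
        obtain ⟨j, rfl⟩ := hκ
        rw [aeval_axisPoint_single, aeval_axisPoint_single, hsnd]
        rcases j with _ | _ | j
        · simp only [hinj]
          rw [pow_zero, mul_one, hX]
          simp
        · simp only [hinj]
          rw [zero_add, pow_one, hX]
          simp [Polynomial.coeff_X_pow, eq_comm]
        · rw [pow_succ, pow_succ, mul_assoc _ _ DualNumber.eps, DualNumber.eps_mul_eps]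
          simp
      · push Not at hκ
        rw [aeval_axisPoint_of_ne s _ hκ, mul_zero, map_zero, if_neg (hκ _), mul_zero]
    · push Not at hμ
      rw [aeval_axisPoint_of_ne s _ hμ, zero_mul, map_zero, if_neg (hμ _), zero_mul]

end Dual

section Integral

variable (p : ℕ) [Fact p.Prime]

/-- Polynomials with coefficients in `ℤ_p` and without terms of degree less than `k`. -/
def intOrder (k : ℕ) : AddSubgroup (MvPolynomial Idx ℚ_[p]) where
  carrier := {P | ∀ ν, ‖P.coeff ν‖ ≤ 1 ∧ (ν.degree < k → P.coeff ν = 0)}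
  zero_mem' := by simp
  add_mem' := by
    intro P Q hP hQ ν
    rw [MvPolynomial.coeff_add]
    refine ⟨(IsUltrametricDist.norm_add_le_max _ _).trans (max_le (hP ν).1 (hQ ν).1), fun h => ?_⟩
    rw [(hP ν).2 h, (hQ ν).2 h, add_zero]
  neg_mem' := by
    intro P hP ν
    rw [MvPolynomial.coeff_neg, norm_neg, neg_eq_zero]
    exact hP ν

variable {p}

lemma intOrder_anti {k l : ℕ} (h : k ≤ l) : intOrder p l ≤ intOrder p k :=
  fun _ hP ν => ⟨(hP ν).1, fun hν => (hP ν).2 (hν.trans_le h)⟩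

lemma mul_mem_intOrder {k l : ℕ} {P Q : MvPolynomial Idx ℚ_[p]} (hP : P ∈ intOrder p k)
    (hQ : Q ∈ intOrder p l) : P * Q ∈ intOrder p (k + l) := by
  classical
  intro ν
  rw [MvPolynomial.coeff_mul]
  constructor
  · refine IsUltrametricDist.norm_sum_le_of_forall_le_of_nonneg zero_le_one fun x _ => ?_
    rw [norm_mul]
    exact mul_le_one₀ (hP _).1 (norm_nonneg _) (hQ _).1
  · intro h
    refine Finset.sum_eq_zero fun x hx => ?_
    rw [Finset.HasAntidiagonal.mem_antidiagonal] at hx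
    rw [← hx, map_add] at h
    rcases lt_or_ge x.1.degree k with h1 | h1
    · rw [(hP _).2 h1, zero_mul]
    · rw [(hQ _).2 (by omega), mul_zero]

lemma smul_mem_intOrder {k : ℕ} {c : ℚ_[p]} {P : MvPolynomial Idx ℚ_[p]} (hc : ‖c‖ ≤ 1)
    (hP : P ∈ intOrder p k) : c • P ∈ intOrder p k := by
  intro ν
  rw [MvPolynomial.coeff_smul, smul_eq_mul, norm_mul]
  exact ⟨mul_le_one₀ hc (norm_nonneg _) (hP ν).1, fun h => by rw [(hP ν).2 h, mul_zero]⟩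

lemma monomial_mem_intOrder (μ : Idx →₀ ℕ) :
    MvPolynomial.monomial μ (1 : ℚ_[p]) ∈ intOrder p μ.degree := by
  classical
  intro ν
  rw [MvPolynomial.coeff_monomial]
  split_ifs with h
  · simp [h]
  · simp

lemma X_mem_intOrder (s : Idx) : (MvPolynomial.X s : MvPolynomial Idx ℚ_[p]) ∈ intOrder p 1 := by
  have h := monomial_mem_intOrder (p := p) (Finsupp.single s 1)
  rwa [Finsupp.degree_single] at h

lemma pointMul_sub_mem {n : ℕ} {v w : Fin 2 → Fin 2 → MvPolynomial Idx ℚ_[p]}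
    (hv : ∀ i j, v i j ∈ intOrder p 1) (hw : ∀ i j, w i j ∈ intOrder p 1) (i j : Fin 2) :
    pointMul p n v w i j - (v i j + w i j) ∈ intOrder p 2 := by
  rw [pointMul, add_sub_cancel_left]
  exact smul_mem_intOrder (norm_prime_pow_le_one n)
    (sum_mem fun k _ => mul_mem_intOrder (hv i k) (hw k j))

lemma axisPoint_mem_intOrder (s : Idx) (i j : Fin 2) :
    axisPoint s (MvPolynomial.X s : MvPolynomial Idx ℚ_[p]) i j ∈ intOrder p 1 := by
  rw [axisPoint]
  split_ifs
  · exact X_mem_intOrder s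
  · exact zero_mem _

lemma aeval_mon_sub_mem {n : ℕ} {v : Fin 2 → Fin 2 → MvPolynomial Idx ℚ_[p]}
    (hv : ∀ i j, v i j - MvPolynomial.X (i, j) ∈ intOrder p 2) (μ : Idx →₀ ℕ) :
    Coord.aeval v (Coord.mon p n μ) - MvPolynomial.monomial μ 1 ∈ intOrder p (μ.degree + 1) := by
  have hmul : ∀ μ κ : Idx →₀ ℕ,
      Coord.aeval v (Coord.mon p n μ) - MvPolynomial.monomial μ 1 ∈ intOrder p (μ.degree + 1) →
      Coord.aeval v (Coord.mon p n κ) - MvPolynomial.monomial κ 1 ∈ intOrder p (κ.degree + 1) →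
      Coord.aeval v (Coord.mon p n (μ + κ)) - MvPolynomial.monomial (μ + κ) 1 ∈
        intOrder p ((μ + κ).degree + 1) := by
    intro μ κ hμ hκ
    have h1 : MvPolynomial.monomial (μ + κ) (1 : ℚ_[p]) =
        MvPolynomial.monomial μ 1 * MvPolynomial.monomial κ 1 := by
      rw [MvPolynomial.monomial_mul, one_mul]
    have h2 : Coord.aeval v (Coord.mon p n (μ + κ)) - MvPolynomial.monomial (μ + κ) 1 =
        (Coord.aeval v (Coord.mon p n μ) - MvPolynomial.monomial μ 1) *
          (Coord.aeval v (Coord.mon p n κ) - MvPolynomial.monomial κ 1) +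
        (Coord.aeval v (Coord.mon p n μ) - MvPolynomial.monomial μ 1) *
          MvPolynomial.monomial κ 1 +
        MvPolynomial.monomial μ 1 *
          (Coord.aeval v (Coord.mon p n κ) - MvPolynomial.monomial κ 1) := by
      rw [← Coord.mon_mul, map_mul, h1]
      ring
    rw [h2, map_add]
    refine add_mem (add_mem ?_ ?_) ?_
    · exact intOrder_anti (by omega) (mul_mem_intOrder hμ hκ)
    · exact intOrder_anti (by omega) (mul_mem_intOrder hμ (monomial_mem_intOrder κ))
    · exact intOrder_anti (by omega) (mul_mem_intOrder (monomial_mem_intOrder μ) hκ)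
  have hzero : Coord.aeval v (Coord.mon p n 0) - MvPolynomial.monomial 0 1 ∈
      intOrder p ((0 : Idx →₀ ℕ).degree + 1) := by
    rw [Coord.mon_zero, map_one, MvPolynomial.monomial_zero', map_one, sub_self]
    exact zero_mem _
  induction μ using Finsupp.induction_linear with
  | zero => exact hzero
  | add μ κ hμ hκ => exact hmul μ κ hμ hκ
  | single s k =>
    induction k with
    | zero => rw [Finsupp.single_zero]; exact hzero
    | succ k ih =>
      rw [Finsupp.single_add]
      refine hmul _ _ ih ?_
      rw [Finsupp.degree_single, ← Coord.x_eq_mon s.1 s.2, Coord.aeval_x]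
      exact hv s.1 s.2

end Integral

section Product

variable {p : ℕ} [Fact p.Prime] {n : ℕ}

lemma coeff_eq_zero_of_mem_supported {s : Idx} {P : MvPolynomial Idx ℚ_[p]}
    (hP : P ∈ MvPolynomial.supported ℚ_[p] {t | t ≠ s}) {ν : Idx →₀ ℕ} (hν : ν s ≠ 0) :
    P.coeff ν = 0 := by
  by_contra h
  have h1 : s ∈ P.vars := (MvPolynomial.mem_vars_iff_mem_support s).mpr
    ⟨ν, MvPolynomial.mem_support_iff.mpr h, Finsupp.mem_support_iff.mpr hν⟩
  exact MvPolynomial.mem_supported.mp hP h1 rfl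

lemma coeff_mul_X_pow_of_mem_supported {s : Idx} {P : MvPolynomial Idx ℚ_[p]}
    (hP : P ∈ MvPolynomial.supported ℚ_[p] {t | t ≠ s}) {ν : Idx →₀ ℕ} (hν : ν s = 0) (j k : ℕ) :
    (P * MvPolynomial.X s ^ j).coeff (ν + Finsupp.single s k) =
      P.coeff ν * (if j = k then 1 else 0) := by
  rw [MvPolynomial.X_pow_eq_monomial, MvPolynomial.coeff_mul_monomial', mul_one]
  have hle : Finsupp.single s j ≤ ν + Finsupp.single s k ↔ j ≤ k := by
    rw [Finsupp.single_le_iff]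
    simp [hν]
  rcases lt_trichotomy j k with h | h | h
  · rw [if_pos (hle.mpr h.le), if_neg h.ne, mul_zero]
    apply coeff_eq_zero_of_mem_supported hP
    simp [hν]
    omega
  · subst h
    simp
  · rw [if_neg (hle.not.mpr (by omega)), if_neg h.ne', mul_zero]

lemma AnDist.mul_dual_single_eval {v : Fin 2 → Fin 2 → MvPolynomial Idx ℚ_[p]} {δ : AnDist p n}
    {ν : Idx →₀ ℕ} {s : Idx} (k : ℕ)
    (hδ : ∀ μ, δ.eval (monom μ) = (Coord.aeval v (Coord.mon p n μ)).coeff ν)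
    (hv : ∀ i j, v i j ∈ MvPolynomial.supported ℚ_[p] {t | t ≠ s}) (hν : ν s = 0)
    (μ : Idx →₀ ℕ) :
    (δ * AnDist.dual (Finsupp.single s k)).eval (monom μ) =
      (Coord.aeval (pointMul p n v (axisPoint s (MvPolynomial.X s))) (Coord.mon p n μ)).coeff
        (ν + Finsupp.single s k) := by
  classical
  refine AnDist.mul_eval_monom_of_points
    (ℓ := MvPolynomial.lcoeff ℚ_[p] (ν + Finsupp.single s k)) (fun μ κ => ?_) μ
  have hmem : Coord.aeval v (Coord.mon p n μ) ∈ MvPolynomial.supported ℚ_[p] {t | t ≠ s} := by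
    rw [Coord.aeval_mon]
    exact Subalgebra.prod_mem _ fun i _ => pow_mem (hv _ _) _
  rw [MvPolynomial.lcoeff_apply, hδ, AnDist.dual_eval_monom]
  by_cases hκ : ∃ j, κ = Finsupp.single s j
  · obtain ⟨j, rfl⟩ := hκ
    rw [aeval_axisPoint_single, coeff_mul_X_pow_of_mem_supported hmem hν]
    simp [(Finsupp.single_injective s).eq_iff]
  · push Not at hκ
    rw [aeval_axisPoint_of_ne s _ hκ, mul_zero, MvPolynomial.coeff_zero, if_neg (hκ _), mul_zero]

/-- The product of the functionals dual to `b^ν₀₁`, `a^ν₀₀`, `d^ν₁₁` and `c^ν₁₀`. -/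
def AnDist.pbw (ν : Idx →₀ ℕ) : AnDist p n :=
  AnDist.dual (Finsupp.single (0, 1) (ν (0, 1))) * AnDist.dual (Finsupp.single (0, 0) (ν (0, 0))) *
    AnDist.dual (Finsupp.single (1, 1) (ν (1, 1))) *
    AnDist.dual (Finsupp.single (1, 0) (ν (1, 0)))

lemma axisPoint_mem_supported {s t : Idx} (h : s ≠ t) (i j : Fin 2) :
    axisPoint s (MvPolynomial.X s : MvPolynomial Idx ℚ_[p]) i j ∈
      MvPolynomial.supported ℚ_[p] {u | u ≠ t} := by
  rw [axisPoint]
  split_ifs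
  · exact MvPolynomial.X_mem_supported.mpr h
  · exact zero_mem _

lemma pointMul_mem_supported {v w : Fin 2 → Fin 2 → MvPolynomial Idx ℚ_[p]} {t : Idx}
    (hv : ∀ i j, v i j ∈ MvPolynomial.supported ℚ_[p] {u | u ≠ t})
    (hw : ∀ i j, w i j ∈ MvPolynomial.supported ℚ_[p] {u | u ≠ t}) (i j : Fin 2) :
    pointMul p n v w i j ∈ MvPolynomial.supported ℚ_[p] {u | u ≠ t} :=
  add_mem (add_mem (hv i j) (hw i j))
    (Subalgebra.smul_mem _ (sum_mem fun k _ => mul_mem (hv i k) (hw k j)) _)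

lemma pointMul_mem_intOrder {v w : Fin 2 → Fin 2 → MvPolynomial Idx ℚ_[p]}
    (hv : ∀ i j, v i j ∈ intOrder p 1) (hw : ∀ i j, w i j ∈ intOrder p 1) (i j : Fin 2) :
    pointMul p n v w i j ∈ intOrder p 1 := by
  have h := add_mem (intOrder_anti one_le_two (pointMul_sub_mem (n := n) hv hw i j))
    (add_mem (hv i j) (hw i j))
  rwa [sub_add_cancel] at h

lemma AnDist.pbw_eval_monom : ∃ v : Fin 2 → Fin 2 → MvPolynomial Idx ℚ_[p],
    (∀ i j, v i j - MvPolynomial.X (i, j) ∈ intOrder p 2) ∧ ∀ ν μ : Idx →₀ ℕ,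
      (AnDist.pbw ν : AnDist p n).eval (monom μ) =
        (Coord.aeval v (Coord.mon p n μ)).coeff ν := by
  classical
  let x : Idx → Fin 2 → Fin 2 → MvPolynomial Idx ℚ_[p] := fun s => axisPoint s (MvPolynomial.X s)
  have hx : ∀ s i j, x s i j ∈ intOrder p 1 := axisPoint_mem_intOrder
  have hx2 := pointMul_mem_intOrder (n := n) (hx (0, 1)) (hx (0, 0))
  have hx3 := pointMul_mem_intOrder (n := n) hx2 (hx (1, 1))
  refine ⟨pointMul p n (pointMul p n (pointMul p n (x (0, 1)) (x (0, 0))) (x (1, 1))) (x (1, 0)),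
    fun i j => ?_, fun ν μ => ?_⟩
  · have h1 := pointMul_sub_mem (n := n) hx3 (hx (1, 0)) i j
    have h2 := pointMul_sub_mem (n := n) hx2 (hx (1, 1)) i j
    have h3 := pointMul_sub_mem (n := n) (hx (0, 1)) (hx (0, 0)) i j
    have h4 : x (0, 1) i j + x (0, 0) i j + x (1, 1) i j + x (1, 0) i j =
        MvPolynomial.X (i, j) := by
      fin_cases i <;> fin_cases j <;> simp [x, axisPoint]
    have h := add_mem (add_mem h1 h2) h3
    rw [← h4]
    convert h using 1
    ring
  · have h1 : ∀ μ, (AnDist.dual (Finsupp.single (0, 1) (ν (0, 1))) : AnDist p n).eval (monom μ) =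
        (Coord.aeval (x (0, 1)) (Coord.mon p n μ)).coeff (Finsupp.single (0, 1) (ν (0, 1))) := by
      intro μ
      rw [AnDist.dual_eval_monom]
      by_cases hμ : ∃ j, μ = Finsupp.single (0, 1) j
      · obtain ⟨j, rfl⟩ := hμ
        rw [aeval_axisPoint_single, MvPolynomial.coeff_X_pow]
      · push Not at hμ
        rw [aeval_axisPoint_of_ne _ _ hμ, MvPolynomial.coeff_zero, if_neg (hμ _)]
    have h2 := AnDist.mul_dual_single_eval (s := (0, 0)) (ν (0, 0)) h1
      (axisPoint_mem_supported (by simp)) (by simp)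
    have h3 := AnDist.mul_dual_single_eval (s := (1, 1)) (ν (1, 1)) h2
      (pointMul_mem_supported (axisPoint_mem_supported (by simp))
        (axisPoint_mem_supported (by simp))) (by simp)
    have h4 := AnDist.mul_dual_single_eval (s := (1, 0)) (ν (1, 0)) h3
      (pointMul_mem_supported (pointMul_mem_supported (axisPoint_mem_supported (by simp))
        (axisPoint_mem_supported (by simp))) (axisPoint_mem_supported (by simp))) (by simp) μ
    have hν : Finsupp.single (0, 1) (ν (0, 1)) + Finsupp.single (0, 0) (ν (0, 0)) +
        Finsupp.single (1, 1) (ν (1, 1)) + Finsupp.single (1, 0) (ν (1, 0)) = ν := by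
      ext ⟨i, j⟩
      fin_cases i <;> fin_cases j <;> simp
    rw [hν] at h4
    exact h4

lemma AnDist.norm_pbw_eval_monom_le (ν μ : Idx →₀ ℕ) :
    ‖(AnDist.pbw ν : AnDist p n).eval (monom μ)‖ ≤ 1 := by
  obtain ⟨v, hv, h⟩ := AnDist.pbw_eval_monom (p := p) (n := n)
  have h1 := add_mem (intOrder_anti (Nat.le_succ _) (aeval_mon_sub_mem (n := n) hv μ))
    (monomial_mem_intOrder μ)
  rw [sub_add_cancel] at h1
  rw [h]
  exact (h1 ν).1

lemma AnDist.pbw_eval_monom_of_degree_le [DecidableEq (Idx →₀ ℕ)] {ν μ : Idx →₀ ℕ}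
    (hνμ : ν.degree ≤ μ.degree) :
    (AnDist.pbw ν : AnDist p n).eval (monom μ) = if ν = μ then 1 else 0 := by
  obtain ⟨v, hv, h⟩ := AnDist.pbw_eval_monom (p := p) (n := n)
  have h1 := (aeval_mon_sub_mem (n := n) hv μ ν).2 (Nat.lt_succ_of_le hνμ)
  rw [MvPolynomial.coeff_sub, sub_eq_zero, MvPolynomial.coeff_monomial] at h1
  rw [h, h1]
  simp [eq_comm]

end Product

section Tangent

variable {p : ℕ} [Fact p.Prime] {n : ℕ}

lemma AnDist.eval_sum {ι : Type*} (s : Finset ι) (δ : ι → AnDist p n) (F : WideOpenFun p) :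
    (∑ i ∈ s, δ i).eval F = ∑ i ∈ s, (δ i).eval F := by
  classical
  induction s using Finset.induction_on with
  | empty => rfl
  | insert i s hi ih => rw [Finset.sum_insert hi, Finset.sum_insert hi, AnDist.eval_add, ih]

variable (p n) in
/-- The linear form `∑ ξ_μ x^μ ↦ ∑ ξ_ij a_ij` on the linear terms. -/
def linearDist : GL2Lie p →ₗ[ℚ_[p]] AnDist p n where
  toFun a := ∑ s : Idx, a s.1 s.2 • AnDist.dual (Finsupp.single s 1)
  map_add' a b := by simp [add_smul, Finset.sum_add_distrib]
  map_smul' c a := by simp [mul_smul, Finset.smul_sum]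

lemma linearDist_eval (a : GL2Lie p) (F : WideOpenFun p) :
    (linearDist p n a).eval F = ∑ s : Idx, a s.1 s.2 * F.coeff (Finsupp.single s 1) := by
  change AnDist.eval (∑ s : Idx, a s.1 s.2 • AnDist.dual (Finsupp.single s 1)) F = _
  rw [AnDist.eval_sum]
  simp [AnDist.eval_smul, AnDist.dual_eval]

lemma linearDist_single (i j : Fin 2) (c : ℚ_[p]) :
    linearDist p n (Matrix.single i j c) = c • AnDist.dual (Finsupp.single (i, j) 1) := by
  change ∑ s : Idx, Matrix.single i j c s.1 s.2 • AnDist.dual (Finsupp.single s 1) = _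
  rw [Finset.sum_eq_single (i, j)]
  · simp
  · rintro ⟨k, l⟩ - h
    rw [Matrix.single_apply_of_ne, zero_smul]
    rintro ⟨rfl, rfl⟩
    exact h rfl
  · simp

/-- The tangent vector at the unit element with coordinates `a`. -/
def tangentHom (n : ℕ) (a : GL2Lie p) : Coord p n →ₐ[ℚ_[p]] DualNumber ℚ_[p] :=
  Coord.aeval fun i j => a i j • DualNumber.eps

lemma fst_tangentHom (a : GL2Lie p) (f : Coord p n) :
    (tangentHom n a f).fst = Coord.counit p n f := by
  have h : (TrivSqZeroExt.fstHom ℚ_[p] ℚ_[p] ℚ_[p]).comp (tangentHom n a) = Coord.counit p n := by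
    refine Coord.algHom_ext fun i j => ?_
    simp [tangentHom, Coord.counit]
  exact AlgHom.congr_fun h f

lemma Coord.mon_induction {P : Coord p n → Prop} (h1 : P 1) (hadd : ∀ f g, P f → P g → P (f + g))
    (hsmul : ∀ (c : ℚ_[p]) f, P f → P (c • f)) (hX : ∀ i j f, P f → P (Coord.x p n i j * f))
    (f : Coord p n) : P f := by
  induction f using MvPolynomial.induction_on with
  | C a =>
    have h : (MvPolynomial.C a : Coord p n) = a • (1 : Coord p n) := by
      rw [Algebra.smul_def, mul_one]
      rfl
    rw [h]
    exact hsmul a _ h1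
  | add f g hf hg => exact hadd f g hf hg
  | mul_X f s hf =>
    have h : (MvPolynomial.X s * f : MvPolynomial Idx ℚ_[p]) = f * MvPolynomial.X s := mul_comm _ _
    exact h ▸ hX s.1 s.2 f hf

lemma counit_mon (μ : Idx →₀ ℕ) : Coord.counit p n (Coord.mon p n μ) =
    (AnDist.dual 0 : AnDist p n).eval (monom μ) := by
  classical
  rw [AnDist.dual_eval_monom, Coord.counit, Coord.aeval_mon]
  split_ifs with h
  · simp [h]
  · obtain ⟨s, hs⟩ := Finsupp.ne_iff.mp h
    exact Finset.prod_eq_zero (i := s) (by simpa using hs) (zero_pow hs)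

lemma AnDist.dual_zero : (AnDist.dual 0 : AnDist p n) = 1 :=
  AnDist.ext fun μ => by rw [AnDist.one_eval_monom, counit_mon]

lemma linearDist_toPoly (a : GL2Lie p) (f : Coord p n) :
    (linearDist p n a).toPoly f = (tangentHom n a f).snd := by
  classical
  let L : Coord p n →ₗ[ℚ_[p]] ℚ_[p] :=
    TrivSqZeroExt.sndHom ℚ_[p] ℚ_[p] ∘ₗ (tangentHom n a).toLinearMap
  have h : (linearDist p n a).toPoly = L := by
    refine Coord.linearMap_ext fun μ => ?_
    change _ = (tangentHom n a (Coord.mon p n μ)).snd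
    rw [AnDist.toPoly_mon, linearDist_eval]
    simp only [coeff_monom]
    by_cases hμ : μ = 0
    · subst hμ
      rw [Coord.mon_zero, map_one]
      simp
    · obtain ⟨s, hs⟩ := Finsupp.ne_iff.mp hμ
      obtain ⟨κ, rfl⟩ : ∃ κ, μ = Finsupp.single s 1 + κ :=
        ⟨μ - Finsupp.single s 1, by
          rw [add_tsub_cancel_of_le]
          exact Finsupp.single_le_iff.mpr (Nat.one_le_iff_ne_zero.mpr hs)⟩
      have h1 : (tangentHom n a (Coord.mon p n (Finsupp.single s 1 + κ))).snd =
          a s.1 s.2 * Coord.counit p n (Coord.mon p n κ) := by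
        rw [← Coord.mon_mul, map_mul, TrivSqZeroExt.snd_mul, fst_tangentHom, fst_tangentHom,
          ← Coord.x_eq_mon s.1 s.2, Coord.counit, Coord.aeval_x, ← Coord.counit, tangentHom,
          Coord.aeval_x]
        simp
      rw [h1, counit_mon, AnDist.dual_eval_monom]
      by_cases hκ : κ = 0
      · subst hκ
        rw [Finset.sum_eq_single s]
        · simp
        · intro t _ hts
          rw [add_zero, if_neg, mul_zero]
          exact fun h => hts (Finsupp.single_left_injective one_ne_zero h)
        · simp
      · rw [if_neg hκ, mul_zero]
        refine Finset.sum_eq_zero fun t _ => ?_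
        rw [if_neg, mul_zero]
        intro h
        apply hκ
        have := congrArg Finsupp.degree h
        rw [map_add, Finsupp.degree_single, Finsupp.degree_single] at this
        exact (Finsupp.degree_eq_zero_iff κ).mp (by omega)
  exact LinearMap.congr_fun h f

/-- The functional `x ⊗ y ↦ x.snd * y.snd`. -/
def sndTensor (p : ℕ) [Fact p.Prime] :
    DualNumber ℚ_[p] ⊗[ℚ_[p]] DualNumber ℚ_[p] →ₗ[ℚ_[p]] ℚ_[p] :=
  LinearMap.mul' ℚ_[p] ℚ_[p] ∘ₗ TensorProduct.map (TrivSqZeroExt.sndHom ℚ_[p] ℚ_[p])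
    (TrivSqZeroExt.sndHom ℚ_[p] ℚ_[p])

/-- The pair of tangent vectors `(a, b)`, composed with the comultiplication. -/
def tangentPair (n : ℕ) (a b : GL2Lie p) :
    Coord p n →ₐ[ℚ_[p]] DualNumber ℚ_[p] ⊗[ℚ_[p]] DualNumber ℚ_[p] :=
  (Algebra.TensorProduct.map (tangentHom n a) (tangentHom n b)).comp (Coord.comul p n)

lemma linearDist_mul_eval (a b : GL2Lie p) (μ : Idx →₀ ℕ) :
    (linearDist p n a * linearDist p n b).eval (monom μ) =
      sndTensor p (tangentPair n a b (Coord.mon p n μ)) := by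
  rw [AnDist.mul_eval_monom, tangentPair, AlgHom.comp_apply, sndTensor, LinearMap.comp_apply]
  congr 1
  have h : TensorProduct.map (linearDist p n a).toPoly (linearDist p n b).toPoly =
      TensorProduct.map (TrivSqZeroExt.sndHom ℚ_[p] ℚ_[p]) (TrivSqZeroExt.sndHom ℚ_[p] ℚ_[p]) ∘ₗ
        (Algebra.TensorProduct.map (tangentHom n a) (tangentHom n b)).toLinearMap := by
    refine TensorProduct.ext' fun f g => ?_
    rw [TensorProduct.map_tmul, linearDist_toPoly, linearDist_toPoly]
    rfl
  exact LinearMap.congr_fun h _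

lemma tangentPair_x (a b : GL2Lie p) (i j : Fin 2) : tangentPair n a b (Coord.x p n i j) =
    a i j • (DualNumber.eps ⊗ₜ 1) + b i j • (1 ⊗ₜ DualNumber.eps) +
      ((p : ℚ_[p]) ^ n * (a * b) i j) • (DualNumber.eps ⊗ₜ[ℚ_[p]] DualNumber.eps) := by
  simp only [tangentPair, AlgHom.comp_apply, Coord.comul, Coord.aeval_x, map_add, map_smul, map_sum,
    Algebra.TensorProduct.map_tmul, map_one, tangentHom, Matrix.mul_apply, Finset.smul_sum,
    Finset.mul_sum, Finset.sum_smul, TensorProduct.smul_tmul', TensorProduct.tmul_smul, smul_smul]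
  congr 1
  refine Finset.sum_congr rfl fun k _ => ?_
  congr 2
  ring

lemma algHom_eq_add_of_nilpotent {T : Type} [CommRing T] [Algebra ℚ_[p] T]
    {V W : Coord p n →ₐ[ℚ_[p]] T} {η : T} {z : GL2Lie p} (hη : η * η = 0)
    (hW : ∀ i j, W (Coord.x p n i j) * η = 0)
    (hV : ∀ i j, V (Coord.x p n i j) = W (Coord.x p n i j) + z i j • η) (f : Coord p n) :
    W f * η = Coord.counit p n f • η ∧ V f = W f + (tangentHom n z f).snd • η := by
  induction f using Coord.mon_induction with
  | h1 => simp
  | hadd f g hf hg =>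
    simp only [map_add, add_mul, add_smul, hf.1, hg.1, TrivSqZeroExt.snd_add, true_and]
    rw [hf.2, hg.2]
    abel
  | hsmul c f hf =>
    simp only [map_smul, smul_mul_assoc, hf.1, TrivSqZeroExt.snd_smul, smul_assoc, true_and]
    rw [hf.2, smul_add]
  | hX i j f hf =>
    have hc : Coord.counit p n (Coord.x p n i j) = 0 := Coord.aeval_x _ i j
    have ht : (tangentHom n z (Coord.x p n i j * f)).snd = z i j * Coord.counit p n f := by
      rw [map_mul, TrivSqZeroExt.snd_mul, fst_tangentHom, fst_tangentHom, hc, tangentHom,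
        Coord.aeval_x]
      simp
    refine ⟨?_, ?_⟩
    · rw [map_mul, mul_right_comm, hW, map_mul, hc]
      simp
    · rw [ht, map_mul, map_mul, hf.2, hV]
      simp only [mul_add, add_mul, smul_mul_assoc, mul_smul_comm, hW, hη, smul_zero, add_zero]
      rw [mul_comm η, hf.1, smul_smul]

lemma tangentPair_eq_add (a b : GL2Lie p) (f : Coord p n) :
    tangentPair n a b f = (Algebra.TensorProduct.comm ℚ_[p] _ _) (tangentPair n b a f) +
      (tangentHom n ((p : ℚ_[p]) ^ n • (a * b - b * a)) f).snd •
        (DualNumber.eps ⊗ₜ[ℚ_[p]] DualNumber.eps) := by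
  have he : (DualNumber.eps * DualNumber.eps : DualNumber ℚ_[p]) = 0 := DualNumber.eps_mul_eps
  have hx : ∀ i j, (Algebra.TensorProduct.comm ℚ_[p] (DualNumber ℚ_[p]) (DualNumber ℚ_[p]))
      (tangentPair n b a (Coord.x p n i j)) = a i j • (DualNumber.eps ⊗ₜ 1) +
      b i j • (1 ⊗ₜ DualNumber.eps) +
    ((p : ℚ_[p]) ^ n * (b * a) i j) • (DualNumber.eps ⊗ₜ[ℚ_[p]] DualNumber.eps) := by
    intro i j
    rw [tangentPair_x]
    simp only [map_add, map_smul, Algebra.TensorProduct.comm_tmul]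
    abel
  refine (algHom_eq_add_of_nilpotent
    (T := DualNumber ℚ_[p] ⊗[ℚ_[p]] DualNumber ℚ_[p]) (V := tangentPair n a b)
    (W := (Algebra.TensorProduct.comm ℚ_[p] (DualNumber ℚ_[p]) (DualNumber ℚ_[p])).toAlgHom.comp
      (tangentPair n b a)) (z := (p : ℚ_[p]) ^ n • (a * b - b * a)) ?_ ?_ ?_ f).2
  · simp [he]
  · intro i j
    refine (congrArg (· * _) (hx i j)).trans ?_
    simp [add_mul, he]
  · intro i j
    refine Eq.trans ?_ (congrArg (· + _) (hx i j).symm)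
    rw [tangentPair_x, Matrix.smul_apply, Matrix.sub_apply, smul_eq_mul]
    module

lemma linearDist_commutator (a b : GL2Lie p) :
    linearDist p n a * linearDist p n b - linearDist p n b * linearDist p n a =
      linearDist p n ((p : ℚ_[p]) ^ n • (a * b - b * a)) := by
  rw [sub_eq_iff_eq_add]
  refine AnDist.ext fun μ => ?_
  have hcomm : ∀ t, sndTensor p (Algebra.TensorProduct.comm ℚ_[p] _ _ t) = sndTensor p t := by
    intro t
    induction t using TensorProduct.induction_on with
    | zero => simp
    | add x y hx hy => rw [map_add, map_add, hx, hy, map_add]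
    | tmul x y => simp [sndTensor, mul_comm]
  rw [AnDist.eval_add, linearDist_mul_eval, linearDist_mul_eval, tangentPair_eq_add a b _,
    map_add, hcomm, map_smul, ← AnDist.toPoly_mon, linearDist_toPoly, add_comm]
  simp [sndTensor]

end Tangent

section TangentMap

attribute [local instance 100] LieRing.ofAssociativeRing

variable (p : ℕ) [Fact p.Prime] (n : ℕ)

/-- The linear form `F ↦ d/dt F(e^{tX})` at `t = 0` is a Lie algebra homomorphism in `X`. -/
def tangentLie : GL2Lie p →ₗ⁅ℚ_[p]⁆ AnDist p n :=
  { ((p : ℚ_[p]) ^ n)⁻¹ • linearDist p n with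
    map_lie' := by
      intro a b
      change ((p : ℚ_[p]) ^ n)⁻¹ • linearDist p n (a * b - b * a) =
        (((p : ℚ_[p]) ^ n)⁻¹ • linearDist p n a) * (((p : ℚ_[p]) ^ n)⁻¹ • linearDist p n b) -
        (((p : ℚ_[p]) ^ n)⁻¹ • linearDist p n b) * (((p : ℚ_[p]) ^ n)⁻¹ • linearDist p n a)
      rw [smul_mul_smul_comm, smul_mul_smul_comm, ← smul_sub, linearDist_commutator, map_smul,
        smul_smul, mul_assoc, inv_mul_cancel₀ (pow_ne_zero _ prime_cast_ne_zero), mul_one] }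

/-- The algebra homomorphism `λ : U(𝔤) → D^an(𝔾(n)°)`. -/
def tangentAlgHom : Ug p →ₐ[ℚ_[p]] AnDist p n :=
  UniversalEnvelopingAlgebra.lift ℚ_[p] (tangentLie p n)

lemma tangentAlgHom_ι (X : GL2Lie p) :
    tangentAlgHom p n (Ug.ι p X) = ((p : ℚ_[p]) ^ n)⁻¹ • linearDist p n X :=
  UniversalEnvelopingAlgebra.lift_ι_apply ℚ_[p] (tangentLie p n) X

variable {p n} in
lemma Ug.algHom_ext {A : Type} [Ring A] [Algebra ℚ_[p] A] {f g : Ug p →ₐ[ℚ_[p]] A}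
    (h : ∀ X, f (Ug.ι p X) = g (Ug.ι p X)) : f = g :=
  UniversalEnvelopingAlgebra.hom_ext ℚ_[p] (LieHom.ext h)

end TangentMap

section Exponential

variable {p : ℕ} [Fact p.Prime]

lemma norm_prod_pow_le {y : Idx → ℚ_[p]} (μ : Idx →₀ ℕ) :
    ‖μ.prod fun s k => y s ^ k‖ ≤ ‖y‖ ^ μ.degree := by
  have h : μ.degree = ∑ s ∈ μ.support, μ s := rfl
  rw [Finsupp.prod, norm_prod, h, ← Finset.prod_pow_eq_pow_sum]
  refine Finset.prod_le_prod (fun _ _ => norm_nonneg _) fun s _ => ?_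
  rw [norm_pow]
  gcongr
  exact norm_le_pi_norm y s

lemma exists_eq_single_add {ι : Type*} {μ : ι →₀ ℕ} (h : μ ≠ 0) :
    ∃ s κ, μ = Finsupp.single s 1 + κ := by
  obtain ⟨s, hs⟩ := Finsupp.ne_iff.mp h
  refine ⟨s, μ - Finsupp.single s 1, ?_⟩
  rw [add_tsub_cancel_of_le]
  exact Finsupp.single_le_iff.mpr (Nat.one_le_iff_ne_zero.mpr hs)

lemma WideOpenFun.norm_sub_linear_le (F : WideOpenFun p) : ∃ C : ℝ, ∀ y : Idx → ℚ_[p],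
    ‖y‖ ≤ 1 / 2 → ‖(∑' μ : Idx →₀ ℕ, F.coeff μ * μ.prod fun s k => y s ^ k) - F.coeff 0 -
      ∑ s : Idx, F.coeff (Finsupp.single s 1) * y s‖ ≤ C * ‖y‖ ^ 2 := by
  classical
  obtain ⟨C, hC⟩ := F.bddAbove (r := 1 / 2) (by norm_num) (by norm_num)
  have hC' : ∀ μ : Idx →₀ ℕ, ‖F.coeff μ‖ * (1 / 2) ^ μ.degree ≤ C := fun μ => hC ⟨μ, rfl⟩
  have hC0 : 0 ≤ C := (by positivity : (0 : ℝ) ≤ _).trans (hC' 0)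
  refine ⟨C * 4, fun y hy => ?_⟩
  have hsum : Summable fun μ : Idx →₀ ℕ => F.coeff μ * μ.prod fun s k => y s ^ k := by
    refine NonarchimedeanAddGroup.summable_of_tendsto_cofinite_zero ?_
    refine squeeze_zero_norm (fun μ => ?_) (F.tendsto (r := 1 / 2) (by norm_num) (by norm_num))
    rw [norm_mul]
    gcongr
    exact (norm_prod_pow_le μ).trans (by gcongr)
  have h0 : HasSum (fun μ : Idx →₀ ℕ => if μ = 0 then F.coeff 0 else 0) (F.coeff 0) :=
    hasSum_ite_eq 0 _
  have h1 : HasSum (fun μ : Idx →₀ ℕ => ∑ s : Idx,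
      if μ = Finsupp.single s 1 then F.coeff (Finsupp.single s 1) * y s else 0)
      (∑ s : Idx, F.coeff (Finsupp.single s 1) * y s) :=
    hasSum_sum fun s _ => hasSum_ite_eq _ _
  have h := (hsum.hasSum.sub h0).sub h1
  rw [← h.tsum_eq]
  refine IsUltrametricDist.norm_tsum_le_of_forall_le_of_nonneg (by positivity) fun μ => ?_
  rcases lt_trichotomy μ.degree 1 with hμ | hμ | hμ
  · obtain rfl : μ = 0 := (Finsupp.degree_eq_zero_iff μ).mp (by omega)
    rw [if_pos rfl, Finset.sum_eq_zero]
    · simp; positivity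
    · intro s _
      rw [if_neg]
      intro h
      have := congrArg Finsupp.degree h
      simp at this
  · obtain ⟨s, rfl⟩ : ∃ s, μ = Finsupp.single s 1 := by
      obtain ⟨s, κ, rfl⟩ := exists_eq_single_add (μ := μ) (by rintro rfl; simp at hμ)
      rw [map_add, Finsupp.degree_single] at hμ
      obtain rfl : κ = 0 := (Finsupp.degree_eq_zero_iff κ).mp (by omega)
      exact ⟨s, add_zero _⟩
    rw [if_neg, Finset.sum_eq_single s]
    · simp; positivity
    · intro t _ hts
      rw [if_neg]
      exact fun h => hts (Finsupp.single_left_injective one_ne_zero h).symm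
    · simp
    · simp
  · rw [if_neg (by rintro rfl; simp at hμ), Finset.sum_eq_zero, sub_zero, sub_zero, norm_mul]
    · obtain ⟨k, hk⟩ := Nat.exists_eq_add_of_le hμ
      calc ‖F.coeff μ‖ * ‖μ.prod fun s k => y s ^ k‖
          ≤ ‖F.coeff μ‖ * ‖y‖ ^ μ.degree := by gcongr; exact norm_prod_pow_le μ
        _ = ‖F.coeff μ‖ * (‖y‖ ^ k * ‖y‖ ^ 2) := by rw [hk, ← pow_add]; ring_nf
        _ ≤ ‖F.coeff μ‖ * ((1 / 2) ^ k * ‖y‖ ^ 2) := by gcongr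
        _ = (‖F.coeff μ‖ * (1 / 2) ^ μ.degree) * 4 * ‖y‖ ^ 2 := by
          rw [hk, pow_add]; norm_num; ring
        _ ≤ C * 4 * ‖y‖ ^ 2 := by gcongr; exact hC' μ
    · intro s _
      rw [if_neg]
      rintro rfl
      simp at hμ

lemma WideOpenFun.hasFDerivAt (F : WideOpenFun p) :
    HasFDerivAt (fun y : Idx → ℚ_[p] => ∑' μ : Idx →₀ ℕ, F.coeff μ * μ.prod fun s k => y s ^ k)
      (∑ s : Idx, F.coeff (Finsupp.single s 1) • ContinuousLinearMap.proj (R := ℚ_[p])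
        (φ := fun _ : Idx => ℚ_[p]) s) 0 := by
  obtain ⟨C, hC⟩ := F.norm_sub_linear_le
  have h0 : (∑' μ : Idx →₀ ℕ, F.coeff μ * μ.prod fun s k => (0 : Idx → ℚ_[p]) s ^ k) =
      F.coeff 0 := by
    have := hC 0 (by simp)
    simp only [norm_zero, Pi.zero_apply, mul_zero, Finset.sum_const_zero, sub_zero] at this
    refine sub_eq_zero.mp (norm_le_zero_iff.mp (this.trans (by simp)))
  rw [hasFDerivAt_iff_isLittleO_nhds_zero, h0]
  refine Asymptotics.IsBigO.trans_isLittleO (g := fun y : Idx → ℚ_[p] => ‖y‖ ^ 2) ?_ ?_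
  · refine Asymptotics.IsBigO.of_bound C ?_
    filter_upwards [Metric.closedBall_mem_nhds (0 : Idx → ℚ_[p]) (by norm_num : (0 : ℝ) < 1 / 2)]
      with y hy
    rw [mem_closedBall_zero_iff] at hy
    have := hC y hy
    simpa using this
  · exact Asymptotics.isLittleO_norm_pow_id one_lt_two

end Exponential

section Exp

variable {p : ℕ} [Fact p.Prime]

lemma inv_pow_le_norm_factorial (k : ℕ) : ((p : ℝ)⁻¹) ^ k ≤ ‖(k.factorial : ℚ_[p])‖ := by
  have hp : 1 < p := (Fact.out : p.Prime).one_lt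
  have hv : padicValNat p k.factorial ≤ k := by
    have h := sub_one_mul_padicValNat_factorial (p := p) k
    calc padicValNat p k.factorial ≤ (p - 1) * padicValNat p k.factorial :=
          Nat.le_mul_of_pos_left _ (by omega)
      _ ≤ k := by omega
  rw [norm_natCast_eq_zpow k.factorial_ne_zero, zpow_neg, zpow_natCast, inv_pow]
  gcongr
  exact_mod_cast hp.le

lemma hasDerivAt_exp_smul {A : Type*} [NormedRing A] [NormedAlgebra ℚ_[p] A] [Algebra ℚ A]
    [CompleteSpace A] (L : A →L[ℚ_[p]] ℚ_[p]) (X : A) :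
    HasDerivAt (fun t : ℚ_[p] => L (NormedSpace.exp (t • X))) (L X) 0 := by
  have hp : (0 : ℝ) < p := by exact_mod_cast (Fact.out : p.Prime).pos
  have hr : 0 < (NormedSpace.expSeries ℚ_[p] A).radius := by
    refine lt_of_lt_of_le ?_ (FormalMultilinearSeries.le_radius_of_bound _
      (max 1 ‖(1 : A)‖) (r := (p : NNReal)⁻¹) fun k => ?_)
    · simp
    · rw [NormedSpace.expSeries, norm_smul, norm_inv]
      have h1 : ‖ContinuousMultilinearMap.mkPiAlgebraFin ℚ_[p] k A‖ ≤ max 1 ‖(1 : A)‖ :=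
        ContinuousMultilinearMap.norm_mkPiAlgebraFin_le
      have h2 := inv_pow_le_norm_factorial (p := p) k
      have h3 : 0 < ((p : ℝ)⁻¹) ^ k := by positivity
      calc _ ≤ (((p : ℝ)⁻¹) ^ k)⁻¹ * max 1 ‖(1 : A)‖ * ((p : ℝ)⁻¹) ^ k := by
            gcongr
            simp
        _ = _ := by field_simp
  have h1 := hasFDerivAt_exp_zero_of_radius_pos hr
  have h2 : HasDerivAt (fun t : ℚ_[p] => t • X) X 0 := by
    simpa using (hasDerivAt_id (0 : ℚ_[p])).smul_const X
  have h3 : HasDerivAt (fun t : ℚ_[p] => NormedSpace.exp (t • X)) X 0 := by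
    rw [← zero_smul ℚ_[p] X] at h1
    exact h1.comp_hasDerivAt 0 h2
  exact L.hasFDerivAt.comp_hasDerivAt 0 h3

lemma hasDerivAt_exp_smul_apply (X : GL2Lie p) (i j : Fin 2) :
    HasDerivAt (fun t : ℚ_[p] => NormedSpace.exp (t • X) i j) (X i j) 0 := by
  let E : GL2Lie p →L[ℚ_[p]] ℚ_[p] :=
    { Matrix.entryLinearMap ℚ_[p] ℚ_[p] i j with
      cont := continuous_id.matrix_elem i j }
  let _ := Matrix.linftyOpNormedRing (n := Fin 2) (α := ℚ_[p])
  let _ := Matrix.linftyOpNormedAlgebra (n := Fin 2) (R := ℚ_[p]) (α := ℚ_[p])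
  have _ : @CompleteSpace (GL2Lie p) PseudoMetricSpace.toUniformSpace :=
    FiniteDimensional.complete ℚ_[p] (GL2Lie p)
  exact hasDerivAt_exp_smul E X

end Exp

section Tangent

variable {p : ℕ} [Fact p.Prime]

lemma isTangentMap_iff {n : ℕ} (lam : Ug p →ₐ[ℚ_[p]] AnDist p n) :
    IsTangentMap n lam ↔ lam = tangentAlgHom p n := by
  have key : ∀ (X : GL2Lie p) (F : WideOpenFun p),
      HasDerivAt (fun t : ℚ_[p] => F.evalAt n (NormedSpace.exp (t • X)))
        ((tangentAlgHom p n (Ug.ι p X)).eval F) 0 := by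
    intro X F
    rw [tangentAlgHom_ι, AnDist.eval_smul, linearDist_eval]
    let y : ℚ_[p] → Idx → ℚ_[p] := fun t s =>
      (NormedSpace.exp (t • X) - 1) s.1 s.2 / (p : ℚ_[p]) ^ n
    have hy0 : y 0 = 0 := by
      funext s
      simp [y, NormedSpace.exp_zero]
    have hy : HasDerivAt y (fun s => X s.1 s.2 / (p : ℚ_[p]) ^ n) 0 := by
      refine hasDerivAt_pi.mpr fun s => ?_
      exact ((hasDerivAt_exp_smul_apply X s.1 s.2).sub_const _).div_const _
    have hF := F.hasFDerivAt
    rw [← hy0] at hF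
    have h := hF.comp_hasDerivAt 0 hy
    have hL : (∑ s : Idx, F.coeff (Finsupp.single s 1) • ContinuousLinearMap.proj (R := ℚ_[p])
        (φ := fun _ : Idx => ℚ_[p]) s) (fun s => X s.1 s.2 / (p : ℚ_[p]) ^ n) =
        ((p : ℚ_[p]) ^ n)⁻¹ * ∑ s : Idx, X s.1 s.2 * F.coeff (Finsupp.single s 1) := by
      simp only [_root_.sum_apply, _root_.smul_apply, ContinuousLinearMap.proj_apply, smul_eq_mul,
        Finset.mul_sum]
      exact Finset.sum_congr rfl fun s _ => by ring
    rw [hL] at h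
    exact h
  refine ⟨fun h => Ug.algHom_ext fun X => ?_, fun h => h ▸ key⟩
  refine ContinuousLinearMap.ext fun F => ?_
  exact (h X F).unique (key X F)

end Tangent

section PBW

variable {p : ℕ} [Fact p.Prime] {n : ℕ}

lemma AnDist.dual_single_pow {s : Idx} (hs : s.1 ≠ s.2) (k : ℕ) :
    (AnDist.dual (Finsupp.single s 1) : AnDist p n) ^ k =
      (k.factorial : ℚ_[p]) • AnDist.dual (Finsupp.single s k) := by
  induction k with
  | zero => simp [AnDist.dual_zero]
  | succ k ih =>
    rw [pow_succ, ih, smul_mul_assoc, AnDist.dual_single_mul, if_neg hs, zero_mul, zero_smul,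
      add_zero, smul_smul, Nat.factorial_succ]
    push_cast
    rw [mul_comm]

lemma AnDist.fallingFactorial_eq {s : Idx} (hs : s.1 = s.2) {x : AnDist p n}
    (hx : (p : ℚ_[p]) ^ n • x = AnDist.dual (Finsupp.single s 1)) (k : ℕ) :
    (p : ℚ_[p]) ^ (n * k) • fallingFactorial p x k =
      (k.factorial : ℚ_[p]) • AnDist.dual (Finsupp.single s k) := by
  induction k with
  | zero => simp [AnDist.dual_zero]
  | succ k ih =>
    have hk : (k : AnDist p n) = (k : ℚ_[p]) • (1 : AnDist p n) := by
      rw [Algebra.smul_def, map_natCast, mul_one]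
    have h : (p : ℚ_[p]) ^ (n * (k + 1)) • fallingFactorial p x (k + 1) =
        ((p : ℚ_[p]) ^ (n * k) • fallingFactorial p x k) *
          ((p : ℚ_[p]) ^ n • x - ((p : ℚ_[p]) ^ n * k) • 1) := by
      rw [fallingFactorial_succ, hk, mul_smul, ← smul_sub, smul_mul_smul_comm, ← pow_add,
        mul_add, mul_one]
    rw [h, ih, hx, mul_sub, smul_mul_assoc, AnDist.dual_single_mul, if_pos hs, mul_smul_comm,
      mul_one, Nat.factorial_succ]
    push_cast
    module

variable (p n)

lemma tangentAlgHom_single (i j : Fin 2) (X : GL2Lie p) (hX : X = Matrix.single i j 1) :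
    (p : ℚ_[p]) ^ n • tangentAlgHom p n (Ug.ι p X) =
      AnDist.dual (Finsupp.single (i, j) 1) := by
  rw [tangentAlgHom_ι, smul_smul, mul_inv_cancel₀ (pow_ne_zero _ prime_cast_ne_zero), one_smul, hX,
    linearDist_single, one_smul]

lemma map_levelCoeff_smul_pow (lam : Ug p →ₐ[ℚ_[p]] AnDist p n) (m : ℕ) {x : Ug p} {s : Idx}
    (hs : s.1 ≠ s.2) (hx : (p : ℚ_[p]) ^ n • lam x = AnDist.dual (Finsupp.single s 1)) (k : ℕ) :
    lam (levelCoeff p n m k • x ^ k) =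
      (qFactorial p m k : ℚ_[p]) • AnDist.dual (Finsupp.single s k) := by
  have h := AnDist.dual_single_pow (p := p) (n := n) hs k
  rw [← hx, smul_pow, ← pow_mul] at h
  rw [map_smul, map_pow, levelCoeff, mul_right_comm, mul_smul _ ((p : ℚ_[p]) ^ (n * k)), h,
    smul_smul, mul_assoc, inv_mul_cancel₀ (factorial_cast_ne_zero k), mul_one]

lemma map_levelCoeff_smul_fallingFactorial (lam : Ug p →ₐ[ℚ_[p]] AnDist p n) (m : ℕ) {x : Ug p}
    {s : Idx} (hs : s.1 = s.2)
    (hx : (p : ℚ_[p]) ^ n • lam x = AnDist.dual (Finsupp.single s 1)) (k : ℕ) :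
    lam (levelCoeff p n m k • fallingFactorial p x k) =
      (qFactorial p m k : ℚ_[p]) • AnDist.dual (Finsupp.single s k) := by
  have h := AnDist.fallingFactorial_eq hs hx k
  have h1 : lam (fallingFactorial p x k) = fallingFactorial p (lam x) k :=
    (Polynomial.aeval_algHom_apply lam x _).symm
  rw [map_smul, h1, levelCoeff, mul_right_comm, mul_smul _ ((p : ℚ_[p]) ^ (n * k)), h,
    smul_smul, mul_assoc, inv_mul_cancel₀ (factorial_cast_ne_zero k), mul_one]

/-- The factor `∏ q^(m)_ν !`. -/
def qProd (p m : ℕ) (ν : Idx →₀ ℕ) : ℕ :=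
  qFactorial p m (ν (0, 1)) * qFactorial p m (ν (0, 0)) * qFactorial p m (ν (1, 1)) *
    qFactorial p m (ν (1, 0))

/-- The generators `levelGen`, indexed by the exponents of the four coordinates. -/
def levelBasisElem (m : ℕ) (ν : Idx →₀ ℕ) : Ug p :=
  levelGen p n m ![ν (0, 1), ν (0, 0), ν (1, 1), ν (1, 0)]

lemma range_levelBasisElem (m : ℕ) :
    Set.range (levelBasisElem p n m) = Set.range (levelGen p n m) := by
  ext x
  constructor
  · rintro ⟨ν, rfl⟩
    exact ⟨_, rfl⟩
  · rintro ⟨ν, rfl⟩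
    refine ⟨Finsupp.single (0, 1) (ν 0) + Finsupp.single (0, 0) (ν 1) +
      Finsupp.single (1, 1) (ν 2) + Finsupp.single (1, 0) (ν 3), ?_⟩
    rw [levelBasisElem]
    congr 1
    funext i
    fin_cases i <;> simp

lemma tangentAlgHom_levelBasisElem (m : ℕ) (ν : Idx →₀ ℕ) :
    tangentAlgHom p n (levelBasisElem p n m ν) = (qProd p m ν : ℚ_[p]) • AnDist.pbw ν := by
  have he := tangentAlgHom_single p n 0 1 !![0, 1; 0, 0] (by
    ext i j; fin_cases i <;> fin_cases j <;> simp)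
  have h1 := tangentAlgHom_single p n 0 0 !![1, 0; 0, 0] (by
    ext i j; fin_cases i <;> fin_cases j <;> simp)
  have h2 := tangentAlgHom_single p n 1 1 !![0, 0; 0, 1] (by
    ext i j; fin_cases i <;> fin_cases j <;> simp)
  have hf := tangentAlgHom_single p n 1 0 !![0, 0; 1, 0] (by
    ext i j; fin_cases i <;> fin_cases j <;> simp)
  rw [levelBasisElem, levelGen_eq, map_mul, map_mul, map_mul, Ug.e, Ug.h₁, Ug.h₂, Ug.f,
    map_levelCoeff_smul_pow p n _ m (by simp) he,
    map_levelCoeff_smul_fallingFactorial p n _ m (by simp) h1,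
    map_levelCoeff_smul_fallingFactorial p n _ m (by simp) h2,
    map_levelCoeff_smul_pow p n _ m (by simp) hf]
  simp only [smul_mul_smul_comm, AnDist.pbw, qProd]
  simp

end PBW

section Coordinates

variable {p : ℕ} [Fact p.Prime] {n : ℕ}

/-- The exponents of degree less than that of `ν`. -/
def lowerDegree (ν : Idx →₀ ℕ) : Finset (Idx →₀ ℕ) :=
  (Finsupp.finite_of_degree_lt ν.degree).toFinset

lemma mem_lowerDegree {ν κ : Idx →₀ ℕ} : κ ∈ lowerDegree ν ↔ κ.degree < ν.degree :=
  Set.Finite.mem_toFinset _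

lemma tendsto_pow_degree {t : ℝ} (h0 : 0 ≤ t) (h1 : t < 1) :
    Filter.Tendsto (fun ν : Idx →₀ ℕ => t ^ ν.degree) Filter.cofinite (𝓝 0) := by
  have h : Filter.Tendsto (fun ν : Idx →₀ ℕ => ν.degree) Filter.cofinite Filter.atTop := by
    rw [Filter.tendsto_atTop]
    intro b
    rw [Filter.eventually_cofinite]
    exact (Finsupp.finite_of_degree_le b).subset fun κ hκ => (not_le.mp hκ).le
  exact (tendsto_pow_atTop_nhds_zero_of_lt_one h0 h1).comp h

lemma AnDist.pbw_eval (ν : Idx →₀ ℕ) (F : WideOpenFun p) :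
    (AnDist.pbw ν : AnDist p n).eval F = F.coeff ν +
      ∑ κ ∈ lowerDegree ν, (AnDist.pbw ν : AnDist p n).eval (monom κ) * F.coeff κ := by
  classical
  have hν : ν ∉ lowerDegree ν := by simp [mem_lowerDegree]
  have h := (AnDist.pbw ν : AnDist p n).hasSum F
  rw [h.unique (hasSum_sum_of_ne_finset_zero (s := insert ν (lowerDegree ν)) ?_),
    Finset.sum_insert hν, AnDist.pbw_eval_monom_of_degree_le le_rfl, if_pos rfl, mul_one]
  · simp only [mul_comm]
  · intro κ hκ
    rw [Finset.mem_insert, mem_lowerDegree, not_or] at hκ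
    rw [AnDist.pbw_eval_monom_of_degree_le (by omega), if_neg (Ne.symm hκ.1), mul_zero]

lemma norm_add_sum_le {x : (Idx →₀ ℕ) → ℚ_[p]} {a : ℚ_[p]} {ν : Idx →₀ ℕ} {C r : ℝ} (hr0 : 0 < r)
    (hr1 : r < 1) (hC : 0 ≤ C) (ha : ‖a‖ * r ^ ν.degree ≤ C)
    (hx : ∀ κ ∈ lowerDegree ν, ‖x κ‖ * r ^ κ.degree ≤ C) :
    ‖a + ∑ κ ∈ lowerDegree ν, (AnDist.pbw ν : AnDist p n).eval (monom κ) * x κ‖ * r ^ ν.degree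
      ≤ C := by
  have hr : 0 < r ^ ν.degree := by positivity
  rw [← le_div_iff₀ hr] at ha ⊢
  refine (IsUltrametricDist.norm_add_le_max _ _).trans (max_le ha ?_)
  refine IsUltrametricDist.norm_sum_le_of_forall_le_of_nonneg (by positivity) fun κ hκ => ?_
  rw [norm_mul, le_div_iff₀ hr]
  calc _ ≤ 1 * ‖x κ‖ * r ^ κ.degree :=
        mul_le_mul (mul_le_mul_of_nonneg_right (AnDist.norm_pbw_eval_monom_le ν κ) (norm_nonneg _))
          (pow_le_pow_of_le_one hr0.le hr1.le (mem_lowerDegree.mp hκ).le) hr.le (by positivity)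
    _ ≤ C := by rw [one_mul]; exact hx κ hκ

lemma AnDist.norm_pbw_eval_le (r : Set.Ioo (0 : ℝ) 1) (ν : Idx →₀ ℕ) (F : WideOpenFun p) :
    ‖(AnDist.pbw ν : AnDist p n).eval F‖ * (r : ℝ) ^ ν.degree ≤ gaussNorm r F := by
  rw [AnDist.pbw_eval]
  exact norm_add_sum_le r.2.1 r.2.2 (apply_nonneg _ _) (le_gaussNorm r F ν)
    fun κ _ => le_gaussNorm r F κ

/-- A family of coefficients that satisfies the Gauss norm bounds of `F` belongs to `𝒪`. -/
lemma mem_wideOpenSubmodule_of_norm_le {x : MvPowerSeries Idx ℚ_[p]} (F : WideOpenFun p)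
    (h : ∀ (r : Set.Ioo (0 : ℝ) 1) (ν : Idx →₀ ℕ),
      ‖MvPowerSeries.coeff ν x‖ * (r : ℝ) ^ ν.degree ≤ gaussNorm r F) :
    x ∈ wideOpenSubmodule p := by
  intro r h0 h1
  obtain ⟨s, hrs, hs1⟩ := exists_between h1
  have hs0 : 0 < s := h0.trans hrs
  have ht : Filter.Tendsto (fun ν : Idx →₀ ℕ => gaussNorm ⟨s, hs0, hs1⟩ F * (r / s) ^ ν.degree)
      Filter.cofinite (𝓝 0) := by
    simpa using (tendsto_pow_degree (by positivity) ((div_lt_one hs0).mpr hrs)).const_mul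
      (gaussNorm ⟨s, hs0, hs1⟩ F)
  refine squeeze_zero (fun ν => by positivity) (fun ν => ?_) ht
  calc _ = (‖MvPowerSeries.coeff ν x‖ * s ^ ν.degree) * (r / s) ^ ν.degree := by
        rw [mul_assoc, ← mul_pow, mul_div_cancel₀ _ hs0.ne']
    _ ≤ _ := by gcongr; exact h ⟨s, hs0, hs1⟩ ν

variable (n) in
/-- The map `F ↦ ∑ δ_ν(F) x^ν`, for the functionals `δ_ν = AnDist.pbw ν`. -/
def pbwTransform : WideOpenFun p →ₗ[ℚ_[p]] WideOpenFun p where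
  toFun F := ⟨fun ν => (AnDist.pbw ν : AnDist p n).eval F,
    mem_wideOpenSubmodule_of_norm_le F fun r ν => AnDist.norm_pbw_eval_le r ν F⟩
  map_add' F G := WideOpenFun.ext fun ν => map_add (AnDist.pbw ν : AnDist p n).eval F G
  map_smul' c F := WideOpenFun.ext fun ν => map_smul (AnDist.pbw ν : AnDist p n).eval c F

lemma coeff_pbwTransform (F : WideOpenFun p) (ν : Idx →₀ ℕ) :
    (pbwTransform n F).coeff ν = (AnDist.pbw ν : AnDist p n).eval F := rfl

variable (n) in
/-- The coefficients of the solution `F` of `δ_ν(F) = G_ν`. -/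
def pbwInvCoeff (G : (Idx →₀ ℕ) → ℚ_[p]) (ν : Idx →₀ ℕ) : ℚ_[p] :=
  G ν - ∑ κ ∈ (lowerDegree ν).attach,
    (AnDist.pbw ν : AnDist p n).eval (monom κ.1) * pbwInvCoeff G κ.1
termination_by ν.degree
decreasing_by exact mem_lowerDegree.mp κ.2

lemma pbwInvCoeff_eq (G : (Idx →₀ ℕ) → ℚ_[p]) (ν : Idx →₀ ℕ) :
    pbwInvCoeff n G ν = G ν - ∑ κ ∈ lowerDegree ν,
      (AnDist.pbw ν : AnDist p n).eval (monom κ) * pbwInvCoeff n G κ := by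
  rw [pbwInvCoeff, Finset.sum_attach (lowerDegree ν)
    (fun κ => (AnDist.pbw ν : AnDist p n).eval (monom κ) * pbwInvCoeff n G κ)]

lemma pbwTransform_norm_coeff_le (r : Set.Ioo (0 : ℝ) 1) {C : ℝ} (hC : 0 ≤ C)
    {x : (Idx →₀ ℕ) → ℚ_[p]} {G : (Idx →₀ ℕ) → ℚ_[p]}
    (h : ∀ ν, x ν = G ν - ∑ κ ∈ lowerDegree ν,
      (AnDist.pbw ν : AnDist p n).eval (monom κ) * x κ)
    (hG : ∀ ν, ‖G ν‖ * (r : ℝ) ^ ν.degree ≤ C) (ν : Idx →₀ ℕ) :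
    ‖x ν‖ * (r : ℝ) ^ ν.degree ≤ C := by
  induction hd : ν.degree using Nat.strong_induction_on generalizing ν with
  | _ d ih =>
    subst hd
    have h1 : x ν = -(-G ν + ∑ κ ∈ lowerDegree ν,
        (AnDist.pbw ν : AnDist p n).eval (monom κ) * x κ) := by
      rw [h ν]; ring
    rw [h1, norm_neg]
    refine norm_add_sum_le r.2.1 r.2.2 hC (by rw [norm_neg]; exact hG ν) fun κ hκ => ?_
    exact ih _ (mem_lowerDegree.mp hκ) κ rfl

lemma gaussNorm_le_gaussNorm_pbwTransform (r : Set.Ioo (0 : ℝ) 1) (F : WideOpenFun p) :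
    gaussNorm r F ≤ gaussNorm r (pbwTransform n F) :=
  gaussNorm_le r F fun ν => pbwTransform_norm_coeff_le (n := n) r (apply_nonneg _ _)
    (x := fun ν => F.coeff ν) (G := fun ν => (pbwTransform n F).coeff ν)
    (fun ν => by rw [coeff_pbwTransform, AnDist.pbw_eval, add_sub_cancel_right])
    (le_gaussNorm r _) ν

lemma gaussNorm_pbwTransform_le (r : Set.Ioo (0 : ℝ) 1) (F : WideOpenFun p) :
    gaussNorm r (pbwTransform n F) ≤ gaussNorm r F :=
  gaussNorm_le r _ fun ν => AnDist.norm_pbw_eval_le r ν F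

lemma eq_zero_of_gaussNorm_eq_zero {F : WideOpenFun p} (r : Set.Ioo (0 : ℝ) 1)
    (h : gaussNorm r F = 0) : F = 0 := by
  refine WideOpenFun.ext fun ν => ?_
  have h1 := le_gaussNorm r F ν
  have h2 : 0 < (r : ℝ) ^ ν.degree := pow_pos r.2.1 _
  rw [h] at h1
  have h3 : ‖F.coeff ν‖ ≤ 0 := by
    by_contra hc
    exact absurd h1 (not_le.mpr (mul_pos (not_le.mp hc) h2))
  rw [map_zero]
  exact norm_le_zero_iff.mp h3

lemma pbwTransform_bijective : Function.Bijective (pbwTransform n : WideOpenFun p →ₗ[ℚ_[p]] _) := by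
  constructor
  · rw [← LinearMap.ker_eq_bot, LinearMap.ker_eq_bot']
    intro F hF
    let r : Set.Ioo (0 : ℝ) 1 := ⟨1 / 2, by norm_num, by norm_num⟩
    refine eq_zero_of_gaussNorm_eq_zero r (le_antisymm ?_ (apply_nonneg _ _))
    have h := gaussNorm_le_gaussNorm_pbwTransform (n := n) r F
    rwa [hF, map_zero] at h
  · intro G
    let x : MvPowerSeries Idx ℚ_[p] := pbwInvCoeff n fun ν => G.coeff ν
    let F : WideOpenFun p := ⟨x, mem_wideOpenSubmodule_of_norm_le G fun r ν =>
      pbwTransform_norm_coeff_le r (apply_nonneg _ _) (pbwInvCoeff_eq _) (le_gaussNorm r G) ν⟩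
    have hF : ∀ ν, F.coeff ν = pbwInvCoeff n (fun ν => G.coeff ν) ν := fun _ => rfl
    refine ⟨F, WideOpenFun.ext fun ν => ?_⟩
    rw [coeff_pbwTransform, AnDist.pbw_eval]
    simp only [hF]
    rw [pbwInvCoeff_eq]
    exact sub_add_cancel _ _

lemma continuous_of_gaussNorm_le {T : WideOpenFun p →ₗ[ℚ_[p]] WideOpenFun p}
    (h : ∀ r F, gaussNorm r (T F) ≤ gaussNorm r F) : Continuous T := by
  refine WithSeminorms.continuous_of_isBounded gauss_withSeminorms gauss_withSeminorms T
    fun r => ⟨{r}, 1, fun F => ?_⟩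
  rw [Finset.sup_singleton, one_smul]
  exact h r F

variable (p n) in
/-- The automorphism `F ↦ ∑ δ_ν(F) x^ν` of the topological vector space `𝒪`. -/
def pbwEquiv : WideOpenFun p ≃L[ℚ_[p]] WideOpenFun p where
  __ := LinearEquiv.ofBijective (pbwTransform n) pbwTransform_bijective
  continuous_toFun := continuous_of_gaussNorm_le gaussNorm_pbwTransform_le
  continuous_invFun := by
    refine continuous_of_gaussNorm_le
      (T := (LinearEquiv.ofBijective (pbwTransform n) pbwTransform_bijective).symm.toLinearMap)
      fun r F => (gaussNorm_le_gaussNorm_pbwTransform (n := n) r _).trans_eq ?_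
    exact congrArg _ (LinearEquiv.apply_symm_apply
      (LinearEquiv.ofBijective (pbwTransform n) pbwTransform_bijective) F)

lemma coeff_pbwEquiv (F : WideOpenFun p) (ν : Idx →₀ ℕ) :
    (pbwEquiv p n F).coeff ν = (AnDist.pbw ν : AnDist p n).eval F := rfl

lemma gaussNorm_pbwEquiv (r : Set.Ioo (0 : ℝ) 1) (F : WideOpenFun p) :
    gaussNorm r (pbwEquiv p n F) = gaussNorm r F :=
  le_antisymm (gaussNorm_pbwTransform_le r F) (gaussNorm_le_gaussNorm_pbwTransform r F)

variable (p n) in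
/-- The functions `y^ν` dual to the functionals `δ_ν`. -/
def dualMonom (ν : Idx →₀ ℕ) : WideOpenFun p := (pbwEquiv p n).symm (monom ν)

lemma AnDist.pbw_eval_dualMonom [DecidableEq (Idx →₀ ℕ)] (ν κ : Idx →₀ ℕ) :
    (AnDist.pbw ν : AnDist p n).eval (dualMonom p n κ) = if ν = κ then 1 else 0 := by
  rw [← coeff_pbwEquiv, dualMonom, ContinuousLinearEquiv.apply_symm_apply, coeff_monom]

lemma gaussNorm_dualMonom_le (r : Set.Ioo (0 : ℝ) 1) (ν : Idx →₀ ℕ) :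
    gaussNorm r (dualMonom p n ν) ≤ (r : ℝ) ^ ν.degree := by
  rw [← gaussNorm_pbwEquiv (n := n), dualMonom, ContinuousLinearEquiv.apply_symm_apply]
  exact gaussNorm_monom_le r ν

/-- The distribution `δ ∘ T` for a continuous endomorphism `T` of `𝒪`. -/
def AnDist.comp (δ : AnDist p n) (T : WideOpenFun p →L[ℚ_[p]] WideOpenFun p) : AnDist p n :=
  ContinuousLinearMap.comp δ.eval T

lemma AnDist.comp_eval (δ : AnDist p n) (T : WideOpenFun p →L[ℚ_[p]] WideOpenFun p)
    (F : WideOpenFun p) : (δ.comp T).eval F = δ.eval (T F) := rfl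

lemma AnDist.hasSum_pbw (δ : AnDist p n) (F : WideOpenFun p) :
    HasSum (fun ν => (AnDist.pbw ν : AnDist p n).eval F * δ.eval (dualMonom p n ν)) (δ.eval F) := by
  have h := (δ.comp (pbwEquiv p n).symm).hasSum (pbwEquiv p n F)
  simp only [AnDist.comp_eval, coeff_pbwEquiv] at h
  simpa [dualMonom] using h

lemma AnDist.ext_dualMonom {δ δ' : AnDist p n}
    (h : ∀ ν, δ.eval (dualMonom p n ν) = δ'.eval (dualMonom p n ν)) : δ = δ' := by
  refine ContinuousLinearMap.ext fun F => ?_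
  refine (δ.hasSum_pbw F).unique ?_
  have h' := δ'.hasSum_pbw F
  simp only [← h] at h'
  exact h'

lemma AnDist.exists_bound_dualMonom (δ : AnDist p n) : ∃ r : Set.Ioo (0 : ℝ) 1, ∃ C : ℝ, 0 ≤ C ∧
    ∀ ν : Idx →₀ ℕ, ‖δ.eval (dualMonom p n ν)‖ ≤ C * (r : ℝ) ^ ν.degree :=
  (δ.comp (pbwEquiv p n).symm).exists_bound

/-- The distribution with values `d_ν` on the functions `y^ν`. -/
def AnDist.ofDual (d : (Idx →₀ ℕ) → ℚ_[p]) (h : ∃ r : Set.Ioo (0 : ℝ) 1, ∃ C : ℝ, 0 ≤ C ∧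
    ∀ μ : Idx →₀ ℕ, ‖d μ‖ ≤ C * (r : ℝ) ^ μ.degree) : AnDist p n :=
  (AnDist.ofBound d h : AnDist p n).comp (pbwEquiv p n)

lemma AnDist.ofDual_eval_dualMonom (d : (Idx →₀ ℕ) → ℚ_[p]) (h) (ν : Idx →₀ ℕ) :
    (AnDist.ofDual d h : AnDist p n).eval (dualMonom p n ν) = d ν := by
  rw [AnDist.ofDual, AnDist.comp_eval, dualMonom]
  simp only [ContinuousLinearEquiv.coe_coe, ContinuousLinearEquiv.apply_symm_apply]
  exact AnDist.ofBound_monom d h ν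

/-- If `|δ(y^ν)| ≤ C r^|ν|`, then `|δ(F)| ≤ C ‖F‖_r`. -/
lemma AnDist.norm_eval_le {δ : AnDist p n} {r : Set.Ioo (0 : ℝ) 1} {C : ℝ} (hC : 0 ≤ C)
    (h : ∀ ν : Idx →₀ ℕ, ‖δ.eval (dualMonom p n ν)‖ ≤ C * (r : ℝ) ^ ν.degree)
    (F : WideOpenFun p) : ‖δ.eval F‖ ≤ C * gaussNorm r F := by
  rw [← (δ.hasSum_pbw F).tsum_eq]
  refine IsUltrametricDist.norm_tsum_le_of_forall_le_of_nonneg (by positivity) fun ν => ?_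
  rw [norm_mul]
  calc _ ≤ ‖(AnDist.pbw ν : AnDist p n).eval F‖ * (C * (r : ℝ) ^ ν.degree) := by gcongr; exact h ν
    _ = C * (‖(AnDist.pbw ν : AnDist p n).eval F‖ * (r : ℝ) ^ ν.degree) := by ring
    _ ≤ _ := by gcongr; exact AnDist.norm_pbw_eval_le r ν F

end Coordinates

section FactorialBounds

variable (p : ℕ) [Fact p.Prime]

lemma exists_norm_qFactorial_le (m : ℕ) : ∃ r : Set.Ioo (0 : ℝ) 1, ∃ C : ℝ, 0 ≤ C ∧
    ∀ k : ℕ, ‖(qFactorial p m k : ℚ_[p])‖ ≤ C * (r : ℝ) ^ k := by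
  have hp : 1 < (p : ℝ) := by exact_mod_cast (Fact.out : p.Prime).one_lt
  have hM : p ^ (m + 1) ≠ 0 := pow_ne_zero _ (Fact.out : p.Prime).ne_zero
  have hr0 : 0 < ((p : ℝ)⁻¹) ^ ((p ^ (m + 1) : ℕ) : ℝ)⁻¹ := by positivity
  have hr1 : ((p : ℝ)⁻¹) ^ ((p ^ (m + 1) : ℕ) : ℝ)⁻¹ < 1 :=
    Real.rpow_lt_one (by positivity) (inv_lt_one_of_one_lt₀ hp) (by positivity)
  have hr : (((p : ℝ)⁻¹) ^ ((p ^ (m + 1) : ℕ) : ℝ)⁻¹) ^ (p ^ (m + 1)) = (p : ℝ)⁻¹ :=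
    Real.rpow_inv_natCast_pow (by positivity) hM
  generalize ((p : ℝ)⁻¹) ^ ((p ^ (m + 1) : ℕ) : ℝ)⁻¹ = r at hr0 hr1 hr
  refine ⟨⟨r, hr0, hr1⟩, p, by positivity, fun k => ?_⟩
  have h1 : p ^ (k / p ^ (m + 1)) ∣ qFactorial p m k := by
    rw [qFactorial, pow_succ, ← Nat.div_div_eq_div_mul]
    generalize k / p ^ m = N
    refine dvd_trans ?_ (Nat.factorial_dvd_factorial (Nat.mul_div_le N p))
    rw [padicValNat_dvd_iff_le (Nat.factorial_ne_zero _), padicValNat_factorial_mul]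
    omega
  obtain ⟨c, hc⟩ := h1
  have h2 : k < p ^ (m + 1) * (k / p ^ (m + 1)) + p ^ (m + 1) := by
    have := Nat.lt_div_mul_add (a := k) (Nat.pos_of_ne_zero hM)
    rwa [mul_comm] at this
  rw [hc, Nat.cast_mul, norm_mul, Nat.cast_pow, norm_pow, Padic.norm_p, ← hr, ← pow_mul]
  calc r ^ (p ^ (m + 1) * (k / p ^ (m + 1))) * ‖(c : ℚ_[p])‖
      ≤ r ^ (p ^ (m + 1) * (k / p ^ (m + 1))) * 1 := by
        gcongr; exact norm_natCast_le_one c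
    _ = p * r ^ (p ^ (m + 1) * (k / p ^ (m + 1)) + p ^ (m + 1)) := by
        rw [pow_add r, hr]; field_simp
    _ ≤ p * r ^ k := by
        gcongr ?_ * ?_
        exact pow_le_pow_of_le_one hr0.le hr1.le h2.le

lemma exists_pow_le_norm_qFactorial {s : ℝ} (h0 : 0 ≤ s) (h1 : s < 1) :
    ∃ m : ℕ, ∀ k : ℕ, s ^ k ≤ ‖(qFactorial p m k : ℚ_[p])‖ := by
  have hp : 1 < p := (Fact.out : p.Prime).one_lt
  obtain ⟨N, hN⟩ := exists_pow_lt_of_lt_one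
    (show 0 < (p : ℝ)⁻¹ by have : 0 < (p : ℝ) := by exact_mod_cast (by omega)
                           positivity) h1
  obtain ⟨m, hm⟩ : ∃ m, N ≤ p ^ m := ⟨N, (Nat.lt_pow_self hp).le⟩
  refine ⟨m, fun k => ?_⟩
  calc s ^ k ≤ s ^ (p ^ m * (k / p ^ m)) :=
        pow_le_pow_of_le_one h0 h1.le (Nat.mul_div_le k _)
    _ = (s ^ (p ^ m)) ^ (k / p ^ m) := pow_mul _ _ _
    _ ≤ ((p : ℝ)⁻¹) ^ (k / p ^ m) := by
        gcongr
        exact (pow_le_pow_of_le_one h0 h1.le hm).trans hN.le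
    _ ≤ _ := inv_pow_le_norm_factorial _

lemma degree_eq_add (ν : Idx →₀ ℕ) :
    ν.degree = ν (0, 1) + ν (0, 0) + ν (1, 1) + ν (1, 0) := by
  rw [Finsupp.degree_eq_sum, Fintype.sum_prod_type]
  simp only [Fin.sum_univ_two]
  ring

lemma exists_norm_qProd_le (m : ℕ) : ∃ r : Set.Ioo (0 : ℝ) 1, ∃ C : ℝ, 0 ≤ C ∧
    ∀ ν : Idx →₀ ℕ, ‖(qProd p m ν : ℚ_[p])‖ ≤ C * (r : ℝ) ^ ν.degree := by
  obtain ⟨r, C, hC, h⟩ := exists_norm_qFactorial_le p m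
  have hr := r.2.1
  refine ⟨r, C * C * C * C, by positivity, fun ν => ?_⟩
  rw [qProd, degree_eq_add, Nat.cast_mul, Nat.cast_mul, Nat.cast_mul, norm_mul, norm_mul, norm_mul]
  calc _ ≤ (C * (r : ℝ) ^ ν (0, 1)) * (C * (r : ℝ) ^ ν (0, 0)) * (C * (r : ℝ) ^ ν (1, 1)) *
        (C * (r : ℝ) ^ ν (1, 0)) := by gcongr <;> apply h
    _ = _ := by ring

lemma exists_pow_le_norm_qProd {s : ℝ} (h0 : 0 ≤ s) (h1 : s < 1) :
    ∃ m : ℕ, ∀ ν : Idx →₀ ℕ, s ^ ν.degree ≤ ‖(qProd p m ν : ℚ_[p])‖ := by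
  obtain ⟨m, h⟩ := exists_pow_le_norm_qFactorial p h0 h1
  refine ⟨m, fun ν => ?_⟩
  rw [qProd, degree_eq_add, Nat.cast_mul, Nat.cast_mul, Nat.cast_mul, norm_mul, norm_mul, norm_mul,
    pow_add, pow_add, pow_add]
  gcongr <;> apply h

lemma qProd_cast_ne_zero (m : ℕ) (ν : Idx →₀ ℕ) : (qProd p m ν : ℚ_[p]) ≠ 0 := by
  have h := fun i => qFactorial_ne_zero (p := p) m (ν i)
  exact_mod_cast mul_ne_zero (mul_ne_zero (mul_ne_zero (h _) (h _)) (h _)) (h _)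

end FactorialBounds

section LevelBasis

variable (p : ℕ) [Fact p.Prime] (n m : ℕ)

instance : IsScalarTower ℤ_[p] ℚ_[p] (AnDist p n) := ⟨fun a b x => mul_smul (a : ℚ_[p]) b x⟩

/-- The elements `levelBasisElem`, as elements of the algebra `levelAlg`. -/
def levelAlgElem (ν : Idx →₀ ℕ) : levelAlg p n m :=
  ⟨levelBasisElem p n m ν, Algebra.subset_adjoin ⟨_, rfl⟩⟩

/-- The linear form `u ↦ λ(u)(y^κ)` on the algebra `levelAlg`. -/
def levelEval (κ : Idx →₀ ℕ) : levelAlg p n m →ₗ[ℤ_[p]] ℚ_[p] where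
  toFun u := (tangentAlgHom p n u).eval (dualMonom p n κ)
  map_add' u v := by
    rw [Subalgebra.coe_add, map_add]
    rfl
  map_smul' c u := by
    have h : ((c • u : levelAlg p n m) : Ug p) = (c : ℚ_[p]) • (u : Ug p) := rfl
    rw [h, map_smul, AnDist.eval_smul]
    rfl

lemma levelEval_levelAlgElem [DecidableEq (Idx →₀ ℕ)] (ν κ : Idx →₀ ℕ) :
    levelEval p n m κ (levelAlgElem p n m ν) = if ν = κ then (qProd p m κ : ℚ_[p]) else 0 := by
  change (tangentAlgHom p n (levelBasisElem p n m ν)).eval (dualMonom p n κ) = _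
  rw [tangentAlgHom_levelBasisElem, AnDist.eval_smul, AnDist.pbw_eval_dualMonom]
  split_ifs with h <;> simp [h]

lemma linearIndependent_levelAlgElem : LinearIndependent ℤ_[p] (levelAlgElem p n m) := by
  classical
  rw [linearIndependent_iff']
  intro s c hc κ hκ
  have h := congrArg (levelEval p n m κ) hc
  rw [map_sum, map_zero] at h
  simp only [map_smul, levelEval_levelAlgElem, smul_ite, smul_zero] at h
  rw [Finset.sum_ite_eq' s κ, if_pos hκ] at h
  have h2 : (c κ : ℚ_[p]) * (qProd p m κ : ℚ_[p]) = 0 := h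
  exact Subtype.ext ((mul_eq_zero.mp h2).resolve_right (qProd_cast_ne_zero p m κ))

lemma span_levelAlgElem : ⊤ ≤ Submodule.span ℤ_[p] (Set.range (levelAlgElem p n m)) := by
  have h1 : (Submodule.span ℤ_[p] (Set.range (levelAlgElem p n m))).map
      (levelAlg p n m).val.toLinearMap = Subalgebra.toSubmodule (levelAlg p n m) := by
    rw [Submodule.map_span, ← Set.range_comp, toSubmodule_levelAlg, levelModule,
      ← range_levelBasisElem]
    rfl
  intro u _
  have h2 : (u : Ug p) ∈ Subalgebra.toSubmodule (levelAlg p n m) := u.2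
  rw [← h1] at h2
  obtain ⟨v, hv, hvu⟩ := h2
  rwa [← Subtype.ext hvu]

/-- The `ℤ_p`-basis of the algebra `levelAlg` given by its generators. -/
def levelBasis : Module.Basis (Idx →₀ ℕ) ℤ_[p] (levelAlg p n m) :=
  Module.Basis.mk (linearIndependent_levelAlgElem p n m) (span_levelAlgElem p n m)

lemma tangentAlgHom_eval_dualMonom (u : levelAlg p n m) (ν : Idx →₀ ℕ) :
    (tangentAlgHom p n u).eval (dualMonom p n ν) =
      (qProd p m ν : ℚ_[p]) * ((levelBasis p n m).repr u ν : ℚ_[p]) := by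
  classical
  let φ : levelAlg p n m →ₗ[ℤ_[p]] ℚ_[p] :=
    ((levelBasis p n m).coord ν).smulRight (qProd p m ν : ℚ_[p])
  have h : levelEval p n m ν = φ := by
    refine (levelBasis p n m).ext fun κ => ?_
    rw [LinearMap.smulRight_apply, Module.Basis.coord_apply, Module.Basis.repr_self,
      Finsupp.single_apply, levelBasis, Module.Basis.mk_apply, levelEval_levelAlgElem]
    split_ifs <;> simp
  have h2 : levelEval p n m ν u = ((levelBasis p n m).repr u ν : ℚ_[p]) * (qProd p m ν : ℚ_[p]) :=
    LinearMap.congr_fun h u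
  rw [mul_comm]
  exact h2

end LevelBasis

section PadicIntLimits

variable {p : ℕ} [Fact p.Prime]

lemma padicInt_eq_zero_of_forall_pow_dvd {c : ℤ_[p]} (h : ∀ k : ℕ, (p : ℤ_[p]) ^ k ∣ c) : c = 0 := by
  by_contra hc
  have h1 := (PadicInt.norm_le_pow_iff_mem_span_pow c (c.valuation + 1)).mpr
    (Ideal.mem_span_singleton.mpr (h _))
  rw [PadicInt.norm_le_pow_iff_le_valuation c hc] at h1
  omega

lemma padicInt_exists_limit {f : ℕ → ℤ_[p]} (h : ∀ k, (p : ℤ_[p]) ^ k ∣ f (k + 1) - f k) :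
    ∃ c, ∀ k, (p : ℤ_[p]) ^ k ∣ c - f k := by
  have hmono : ∀ k l, k ≤ l → (p : ℤ_[p]) ^ k ∣ f l - f k := by
    intro k l hkl
    induction l, hkl using Nat.le_induction with
    | base => simp
    | succ l hkl ih =>
      have := dvd_add ((pow_dvd_pow _ hkl).trans (h l)) ih
      rwa [sub_add_sub_cancel] at this
  have hI : ∀ (k : ℕ) (z : ℤ_[p]),
      z ∈ (IsLocalRing.maximalIdeal ℤ_[p] ^ k • ⊤ : Submodule ℤ_[p] ℤ_[p]) ↔
        (p : ℤ_[p]) ^ k ∣ z := by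
    intro k z
    rw [smul_eq_mul, Ideal.mul_top, PadicInt.maximalIdeal_eq_span_p, Ideal.span_singleton_pow,
      Ideal.mem_span_singleton]
  obtain ⟨c, hc⟩ := IsPrecomplete.prec (I := IsLocalRing.maximalIdeal ℤ_[p]) (M := ℤ_[p])
    inferInstance (f := f) (fun {k l} hkl => by
      rw [SModEq.sub_mem, hI, ← dvd_neg, neg_sub]
      exact hmono k l hkl)
  refine ⟨c, fun k => ?_⟩
  have := hc k
  rwa [SModEq.sub_mem, hI, ← dvd_neg, neg_sub] at this

end PadicIntLimits

section CompletionCoordinates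

variable {p : ℕ} [Fact p.Prime] {A : Type} [Ring A] [Algebra ℤ_[p] A]

lemma mul_prime_pow_eq_smul (c : A) (k : ℕ) : c * (p : A) ^ k = (p : ℤ_[p]) ^ k • c := by
  rw [Algebra.smul_def, map_pow, map_natCast, ((Nat.cast_commute p c).pow_left k).eq]

lemma mem_pIdeal {k : ℕ} {a : A} : a ∈ pIdeal p A k ↔ ∃ c, a = (p : ℤ_[p]) ^ k • c := by
  rw [pIdeal, Ideal.mem_span_singleton']
  simp only [mul_prime_pow_eq_smul, eq_comm]

lemma mem_pIdeal_iff_repr {ι : Type} (b : Module.Basis ι ℤ_[p] A) {k : ℕ} {a : A} :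
    a ∈ pIdeal p A k ↔ ∀ s, (p : ℤ_[p]) ^ k ∣ b.repr a s := by
  constructor
  · intro h s
    obtain ⟨c, rfl⟩ := mem_pIdeal.mp h
    rw [map_smul]
    exact ⟨_, rfl⟩
  · intro h
    rw [← b.linearCombination_repr a, Finsupp.linearCombination_apply]
    refine sum_mem fun s _ => ?_
    obtain ⟨d, hd⟩ := h s
    exact mem_pIdeal.mpr ⟨d • b s, (congrArg (· • b s) hd).trans (mul_smul _ _ _)⟩

namespace PadicCompletion

lemma mk_eq_of_le (x : PadicCompletion p A) {k l : ℕ} (hkl : k ≤ l) {a : A}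
    (ha : Ideal.Quotient.mk (pIdeal p A l) a = x.1 l) :
    Ideal.Quotient.mk (pIdeal p A k) a = x.1 k := by
  induction l, hkl using Nat.le_induction with
  | base => exact ha
  | succ l hkl ih =>
    refine ih ?_
    rw [← (mem_padicCompletionSubalgebra p A x.1).mp x.2 l, ← ha]
    rfl

lemma exists_coord {ι : Type} (b : Module.Basis ι ℤ_[p] A) (x : PadicCompletion p A) (s : ι) :
    ∃ c : ℤ_[p], ∀ (k : ℕ) (a : A), Ideal.Quotient.mk (pIdeal p A k) a = x.1 k →
      (p : ℤ_[p]) ^ k ∣ c - b.repr a s := by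
  choose a ha using fun k => Ideal.Quotient.mk_surjective (x.1 k)
  have key : ∀ k a', Ideal.Quotient.mk (pIdeal p A k) a' = x.1 k →
      (p : ℤ_[p]) ^ k ∣ b.repr (a k) s - b.repr a' s := by
    intro k a' h
    have h1 : a k - a' ∈ pIdeal p A k := by
      rw [← Ideal.Quotient.mk_eq_mk_iff_sub_mem, ha, h]
    have h2 := (mem_pIdeal_iff_repr b).mp h1 s
    rwa [map_sub] at h2
  obtain ⟨c, hc⟩ := padicInt_exists_limit (f := fun k => b.repr (a k) s) (fun k => by
    rw [← dvd_neg, neg_sub]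
    exact key k (a (k + 1)) (mk_eq_of_le x k.le_succ (ha _)))
  refine ⟨c, fun k a' h => ?_⟩
  have := dvd_add (hc k) (key k a' h)
  rwa [sub_add_sub_cancel] at this

/-- The coordinates of an element of the `p`-adic completion of `A` with respect to a basis
of `A`. -/
def coord {ι : Type} (b : Module.Basis ι ℤ_[p] A) (x : PadicCompletion p A) (s : ι) : ℤ_[p] :=
  (exists_coord b x s).choose

variable {ι : Type} (b : Module.Basis ι ℤ_[p] A)

lemma coord_spec (x : PadicCompletion p A) (s : ι) {k : ℕ} {a : A}
    (h : Ideal.Quotient.mk (pIdeal p A k) a = x.1 k) :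
    (p : ℤ_[p]) ^ k ∣ coord b x s - b.repr a s :=
  (exists_coord b x s).choose_spec k a h

lemma eq_coord {x : PadicCompletion p A} {s : ι} {c : ℤ_[p]}
    (h : ∀ k, ∃ a, Ideal.Quotient.mk (pIdeal p A k) a = x.1 k ∧
      (p : ℤ_[p]) ^ k ∣ c - b.repr a s) : coord b x s = c := by
  refine sub_eq_zero.mp (padicInt_eq_zero_of_forall_pow_dvd fun k => ?_)
  obtain ⟨a, ha, hc⟩ := h k
  have := dvd_sub (coord_spec b x s ha) hc
  rwa [sub_sub_sub_cancel_right] at this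

lemma coord_of (a : A) (s : ι) : coord b (of p A a) s = b.repr a s :=
  eq_coord b fun _ => ⟨a, rfl, by simp⟩

lemma coord_add (x y : PadicCompletion p A) (s : ι) :
    coord b (x + y) s = coord b x s + coord b y s := by
  refine eq_coord b fun k => ?_
  obtain ⟨a, ha⟩ := Ideal.Quotient.mk_surjective (x.1 k)
  obtain ⟨a', ha'⟩ := Ideal.Quotient.mk_surjective (y.1 k)
  refine ⟨a + a', ?_, ?_⟩
  · rw [map_add, ha, ha']
    rfl
  · rw [map_add, Finsupp.add_apply, add_sub_add_comm]
    exact dvd_add (coord_spec b x s ha) (coord_spec b y s ha')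

lemma coord_smul (c : ℤ_[p]) (x : PadicCompletion p A) (s : ι) :
    coord b (c • x) s = c * coord b x s := by
  refine eq_coord b fun k => ?_
  obtain ⟨a, ha⟩ := Ideal.Quotient.mk_surjective (x.1 k)
  refine ⟨c • a, ?_, ?_⟩
  · change c • Ideal.Quotient.mk (pIdeal p A k) a = c • x.1 k
    rw [ha]
  · rw [map_smul, Finsupp.smul_apply, smul_eq_mul, ← mul_sub]
    exact dvd_mul_of_dvd_right (coord_spec b x s ha) _

lemma coord_finite (x : PadicCompletion p A) (k : ℕ) :
    {s | ¬ (p : ℤ_[p]) ^ k ∣ coord b x s}.Finite := by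
  obtain ⟨a, ha⟩ := Ideal.Quotient.mk_surjective (x.1 k)
  refine (b.repr a).support.finite_toSet.subset fun s hs => ?_
  by_contra h
  have h1 := coord_spec b x s ha
  rw [Finsupp.notMem_support_iff.mp h, sub_zero] at h1
  exact hs h1

lemma coord_injective : Function.Injective (coord b : PadicCompletion p A → ι → ℤ_[p]) := by
  intro x y h
  refine Subtype.ext (funext fun k => ?_)
  obtain ⟨a, ha⟩ := Ideal.Quotient.mk_surjective (x.1 k)
  obtain ⟨a', ha'⟩ := Ideal.Quotient.mk_surjective (y.1 k)
  rw [← ha, ← ha', Ideal.Quotient.mk_eq_mk_iff_sub_mem, mem_pIdeal_iff_repr b]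
  intro s
  have h1 := dvd_sub (coord_spec b y s ha') (coord_spec b x s ha)
  rw [h, sub_sub_sub_cancel_left] at h1
  rwa [map_sub]

lemma exists_coord_eq {c : ι → ℤ_[p]} (hc : ∀ k : ℕ, {s | ¬ (p : ℤ_[p]) ^ k ∣ c s}.Finite) :
    ∃ x : PadicCompletion p A, coord b x = c := by
  classical
  let a : ℕ → A := fun k => ∑ s ∈ (hc k).toFinset, c s • b s
  have ha : ∀ k s, (p : ℤ_[p]) ^ k ∣ c s - b.repr (a k) s := by
    intro k s
    have h : b.repr (a k) s = if s ∈ (hc k).toFinset then c s else 0 := by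
      simp only [a, map_sum, map_smul, Module.Basis.repr_self, Finsupp.coe_finsetSum,
        Finset.sum_apply, Finsupp.smul_apply, Finsupp.single_apply, smul_eq_mul, mul_ite, mul_one,
        mul_zero, Finset.sum_ite_eq']
    rw [h]
    split_ifs with hs
    · simp
    · rw [sub_zero]
      by_contra hn
      exact hs ((hc k).mem_toFinset.mpr hn)
  refine ⟨⟨fun k => Ideal.Quotient.mk _ (a k),
    (mem_padicCompletionSubalgebra p A _).mpr fun k => ?_⟩,
    funext fun s => eq_coord b fun k => ⟨a k, rfl, ha k s⟩⟩
  change Ideal.Quotient.mk (pIdeal p A k) (a (k + 1)) = Ideal.Quotient.mk _ (a k)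
  rw [Ideal.Quotient.mk_eq_mk_iff_sub_mem, mem_pIdeal_iff_repr b]
  intro s
  have h1 := dvd_sub (ha k s) ((pow_dvd_pow _ k.le_succ).trans (ha (k + 1) s))
  rw [sub_sub_sub_cancel_left] at h1
  rwa [map_sub]

lemma exists_eq_smul_of_pow_dvd_coord {x : PadicCompletion p A} {k : ℕ}
    (h : ∀ s, (p : ℤ_[p]) ^ k ∣ coord b x s) : ∃ y, x = (p : ℤ_[p]) ^ k • y := by
  choose d hd using h
  have hp : (p : ℤ_[p]) ^ k ≠ 0 := pow_ne_zero _ (by exact_mod_cast (Fact.out : p.Prime).ne_zero)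
  obtain ⟨y, hy⟩ := exists_coord_eq b (c := d) (fun l => by
    refine (coord_finite b x (k + l)).subset fun s hs h' => hs ?_
    rwa [hd, pow_add, mul_dvd_mul_iff_left hp] at h')
  refine ⟨y, coord_injective b (funext fun s => ?_)⟩
  rw [coord_smul, hy, hd]

lemma exists_eq_of_add_smul {ι : Type} (b : Module.Basis ι ℤ_[p] A) (x : PadicCompletion p A) (k : ℕ) :
    ∃ (a : A) (y : PadicCompletion p A), x = of p A a + (p : ℤ_[p]) ^ k • y := by
  obtain ⟨a, ha⟩ := Ideal.Quotient.mk_surjective (x.1 k)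
  obtain ⟨y, hy⟩ := exists_eq_smul_of_pow_dvd_coord b (x := x - of p A a) (k := k) (fun s => by
    have h := coord_spec b x s ha
    have h1 := coord_add b (x - of p A a) (of p A a) s
    rw [sub_add_cancel, coord_of] at h1
    rwa [h1, add_sub_cancel_right] at h)
  exact ⟨a, y, by rw [← hy, add_sub_cancel]⟩

end PadicCompletion

end CompletionCoordinates

section LatticeTopology

variable {p : ℕ} {E : Type} [AddCommGroup E] {Λ : AddSubgroup E}

lemma continuous_latticeTopology_iff {G : Type*} [AddCommGroup G] [TopologicalSpace G]
    [IsTopologicalAddGroup G] (f : E →+ G) :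
    Continuous[latticeTopology p Λ, _] f ↔
      ∀ U ∈ 𝓝 (0 : G), ∃ k : ℕ, ∀ y ∈ Λ, f (p ^ k • y) ∈ U := by
  let _ : TopologicalSpace E := latticeTopology p Λ
  constructor
  · intro hf U hU
    obtain ⟨V, hVU, hV, h0⟩ := mem_nhds_iff.mp hU
    obtain ⟨k, hk⟩ := hV.preimage hf 0 (by rwa [Set.mem_preimage, map_zero])
    refine ⟨k, fun y hy => hVU ?_⟩
    have := hk y hy
    rwa [zero_add] at this
  · intro h
    refine continuous_def.mpr fun V hV x hx => ?_
    have h1 : (fun u => f x + u) ⁻¹' V ∈ 𝓝 (0 : G) := by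
      refine (hV.preimage (continuous_const_add (f x))).mem_nhds ?_
      rw [Set.mem_preimage, add_zero]
      exact hx
    obtain ⟨k, hk⟩ := h _ h1
    refine ⟨k, fun y hy => ?_⟩
    rw [Set.mem_preimage, map_add]
    exact hk y hy

end LatticeTopology

section StrongTopology

variable {p : ℕ} [Fact p.Prime] {n : ℕ}

instance : IsTopologicalAddGroup (AnDist p n) :=
  inferInstanceAs (IsTopologicalAddGroup (WideOpenFun p →L[ℚ_[p]] ℚ_[p]))

instance : ContinuousSMul ℚ_[p] (AnDist p n) :=
  inferInstanceAs (ContinuousSMul ℚ_[p] (WideOpenFun p →L[ℚ_[p]] ℚ_[p]))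

instance : T2Space (AnDist p n) :=
  inferInstanceAs (T2Space (WideOpenFun p →L[ℚ_[p]] ℚ_[p]))

lemma AnDist.hasBasis_nhds_zero : (𝓝 (0 : AnDist p n)).HasBasis
    (fun Bε : Set (WideOpenFun p) × ℝ => Bornology.IsVonNBounded ℚ_[p] Bε.1 ∧ 0 < Bε.2)
    (fun Bε => {δ | ∀ F ∈ Bε.1, ‖δ.eval F‖ < Bε.2}) := by
  have h := ContinuousLinearMap.hasBasis_nhds_zero_of_basis (𝕜₁ := ℚ_[p]) (𝕜₂ := ℚ_[p])
    (σ := RingHom.id ℚ_[p]) (E := WideOpenFun p) (Metric.nhds_basis_ball (x := (0 : ℚ_[p])))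
  refine h.to_hasBasis (fun Bε hB => ⟨Bε, hB, fun δ hδ F hF => ?_⟩)
    (fun Bε hB => ⟨Bε, hB, fun δ hδ F hF => ?_⟩)
  · exact mem_ball_zero_iff.mpr (hδ F hF)
  · exact mem_ball_zero_iff.mp (hδ F hF)

lemma isVonNBounded_iff_gaussNorm {B : Set (WideOpenFun p)} :
    Bornology.IsVonNBounded ℚ_[p] B ↔
      ∀ r : Set.Ioo (0 : ℝ) 1, ∃ M > 0, ∀ F ∈ B, gaussNorm r F < M :=
  gauss_withSeminorms.isVonNBounded_iff_seminorm_bounded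

lemma AnDist.exists_addSubgroup {U : Set (AnDist p n)} (hU : U ∈ 𝓝 0) :
    ∃ L : AddSubgroup (AnDist p n), (∀ a : ℤ_[p], ∀ x ∈ L, (a : ℚ_[p]) • x ∈ L) ∧
      (L : Set (AnDist p n)) ∈ 𝓝 0 ∧ (L : Set (AnDist p n)) ⊆ U := by
  obtain ⟨⟨B, ε⟩, ⟨hB, hε⟩, hBU⟩ := AnDist.hasBasis_nhds_zero.mem_iff.mp hU
  refine ⟨{ carrier := {δ | ∀ F ∈ B, ‖δ.eval F‖ < ε}
            zero_mem' := fun F _ => by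
              have : (0 : AnDist p n).eval F = 0 := rfl
              rwa [this, norm_zero]
            add_mem' := fun hδ hδ' F hF => (IsUltrametricDist.norm_add_le_max _ _).trans_lt
              (max_lt (hδ F hF) (hδ' F hF))
            neg_mem' := fun {δ} hδ F hF => by
              have : (-δ).eval F = -δ.eval F := rfl
              rw [this, norm_neg]
              exact hδ F hF }, fun a δ hδ F hF => ?_,
    AnDist.hasBasis_nhds_zero.mem_of_mem (i := (B, ε)) ⟨hB, hε⟩, hBU⟩
  rw [AnDist.eval_smul, norm_mul]
  exact (mul_le_of_le_one_left (norm_nonneg _) a.norm_le_one).trans_lt (hδ F hF)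

variable (p n) in
/-- The distributions with values in `ℤ_p` on all monomials. -/
def AnDist.unitSubring : Subring (AnDist p n) where
  carrier := {δ | ∀ μ, ‖δ.eval (monom μ)‖ ≤ 1}
  zero_mem' := fun μ => by
    have : (0 : AnDist p n).eval (monom μ) = 0 := rfl
    rw [this, norm_zero]
    exact zero_le_one
  add_mem' := fun hδ hδ' μ => (IsUltrametricDist.norm_add_le_max _ _).trans (max_le (hδ μ) (hδ' μ))
  neg_mem' := fun {δ} hδ μ => by
    have : (-δ).eval (monom μ) = -δ.eval (monom μ) := rfl
    rw [this, norm_neg]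
    exact hδ μ
  one_mem' := fun μ => by
    classical
    rw [AnDist.one_eval_monom, counit_mon, AnDist.dual_eval_monom]
    split_ifs <;> simp
  mul_mem' := fun {δ δ'} hδ hδ' μ => by
    rw [AnDist.mul_eval_monom]
    have key : ∀ t ∈ orderSpan p n μ.degree, ‖LinearMap.mul' ℚ_[p] ℚ_[p]
        (TensorProduct.map δ.toPoly δ'.toPoly t)‖ ≤ 1 := by
      intro t ht
      induction ht using AddSubgroup.closure_induction with
      | zero => simp
      | add x y _ _ hx hy =>
        rw [map_add, map_add]
        exact (IsUltrametricDist.norm_add_le_max _ _).trans (max_le hx hy)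
      | neg x _ hx => rwa [map_neg, map_neg, norm_neg]
      | mem x hx =>
        obtain ⟨c, κ, ν, hc, -, rfl⟩ := hx
        rw [map_smul, map_smul, TensorProduct.map_tmul, LinearMap.mul'_apply, AnDist.toPoly_mon,
          AnDist.toPoly_mon, norm_smul, norm_mul]
        exact mul_le_one₀ hc (by positivity) (mul_le_one₀ (hδ κ) (norm_nonneg _) (hδ' ν))
    exact key _ (comul_mon_mem μ)

lemma AnDist.eq_zero_of_forall_eq_smul {δ : AnDist p n}
    (h : ∀ k : ℕ, ∃ σ ∈ AnDist.unitSubring p n, δ = (p : ℤ_[p]) ^ k • σ) : δ = 0 := by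
  refine AnDist.ext fun μ => ?_
  change _ = (0 : ℚ_[p])
  have hp : ‖(p : ℚ_[p])‖ < 1 := Padic.norm_p_lt_one
  have h1 : ∀ k : ℕ, ‖δ.eval (monom μ)‖ ≤ ‖(p : ℚ_[p])‖ ^ k := by
    intro k
    obtain ⟨σ, hσ, rfl⟩ := h k
    have h2 : (p : ℤ_[p]) ^ k • σ = (p : ℚ_[p]) ^ k • σ := by
      rw [← algebraMap_smul ℚ_[p] ((p : ℤ_[p]) ^ k) σ, map_pow, map_natCast]
    rw [h2, AnDist.eval_smul, norm_mul, norm_pow]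
    exact mul_le_of_le_one_right (by positivity) (hσ μ)
  exact norm_le_zero_iff.mp (ge_of_tendsto'
    (tendsto_pow_atTop_nhds_zero_of_lt_one (norm_nonneg _) hp) h1)

end StrongTopology

section LevelMap

variable (p : ℕ) [Fact p.Prime] (n m : ℕ)

lemma exists_norm_qProd_mul_le (c : (Idx →₀ ℕ) → ℤ_[p]) : ∃ r : Set.Ioo (0 : ℝ) 1, ∃ C : ℝ,
    0 ≤ C ∧ ∀ ν : Idx →₀ ℕ, ‖(qProd p m ν : ℚ_[p]) * (c ν : ℚ_[p])‖ ≤ C * (r : ℝ) ^ ν.degree := by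
  obtain ⟨r, C, hC, h⟩ := exists_norm_qProd_le p m
  refine ⟨r, C, hC, fun ν => ?_⟩
  rw [norm_mul]
  exact (mul_le_of_le_one_right (norm_nonneg _) (c ν).norm_le_one).trans (h ν)

/-- The linear map underlying the extension of `λ` to the completion of `levelAlg`. -/
def completionLinear : LevelCompletion p n m →ₗ[ℤ_[p]] AnDist p n where
  toFun x := AnDist.ofDual
    (fun ν => (qProd p m ν : ℚ_[p]) * (PadicCompletion.coord (levelBasis p n m) x ν : ℚ_[p]))
    (exists_norm_qProd_mul_le p m _)
  map_add' x y := AnDist.ext_dualMonom fun ν => by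
    simp only [AnDist.eval_add, AnDist.ofDual_eval_dualMonom, PadicCompletion.coord_add,
      PadicInt.coe_add, mul_add]
  map_smul' c x := AnDist.ext_dualMonom fun ν => by
    rw [RingHom.id_apply, ← algebraMap_smul ℚ_[p] c (AnDist.ofDual _ _), AnDist.eval_smul,
      AnDist.ofDual_eval_dualMonom, AnDist.ofDual_eval_dualMonom, PadicCompletion.coord_smul,
      PadicInt.coe_mul, mul_left_comm]
    rfl

lemma completionLinear_eval_dualMonom (x : LevelCompletion p n m) (ν : Idx →₀ ℕ) :
    (completionLinear p n m x).eval (dualMonom p n ν) =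
      (qProd p m ν : ℚ_[p]) * (PadicCompletion.coord (levelBasis p n m) x ν : ℚ_[p]) :=
  AnDist.ofDual_eval_dualMonom _ _ ν

lemma completionLinear_of (u : levelAlg p n m) :
    completionLinear p n m (PadicCompletion.of p (levelAlg p n m) u) = tangentAlgHom p n u :=
  AnDist.ext_dualMonom fun ν => by
    rw [completionLinear_eval_dualMonom, PadicCompletion.coord_of, tangentAlgHom_eval_dualMonom]

lemma completionLinear_mem_unitSubring (x : LevelCompletion p n m) :
    completionLinear p n m x ∈ AnDist.unitSubring p n := by
  intro μ
  rw [← ((completionLinear p n m x).hasSum_pbw (monom μ)).tsum_eq]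
  refine IsUltrametricDist.norm_tsum_le_of_forall_le_of_nonneg zero_le_one fun ν => ?_
  rw [completionLinear_eval_dualMonom, norm_mul, norm_mul]
  exact mul_le_one₀ (AnDist.norm_pbw_eval_monom_le ν μ) (by positivity)
    (mul_le_one₀ (norm_natCast_le_one _) (norm_nonneg _) (PadicInt.norm_le_one _))

lemma completionLinear_mul (x y : LevelCompletion p n m) :
    completionLinear p n m (x * y) = completionLinear p n m x * completionLinear p n m y := by
  refine sub_eq_zero.mp (AnDist.eq_zero_of_forall_eq_smul fun k => ?_)
  obtain ⟨a, x', hx⟩ := PadicCompletion.exists_eq_of_add_smul (levelBasis p n m) x k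
  obtain ⟨b, y', hy⟩ := PadicCompletion.exists_eq_of_add_smul (levelBasis p n m) y k
  have hof : completionLinear p n m (PadicCompletion.of p (levelAlg p n m) a *
        PadicCompletion.of p (levelAlg p n m) b) =
      completionLinear p n m (PadicCompletion.of p (levelAlg p n m) a) *
        completionLinear p n m (PadicCompletion.of p (levelAlg p n m) b) := by
    rw [← map_mul, completionLinear_of, completionLinear_of, completionLinear_of,
      ← map_mul (tangentAlgHom p n)]
    rfl
  have h1 : x * y = PadicCompletion.of p (levelAlg p n m) a * PadicCompletion.of p (levelAlg p n m) b
      + (p : ℤ_[p]) ^ k • (x' * PadicCompletion.of p (levelAlg p n m) b + x * y') := by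
    rw [smul_add, ← smul_mul_assoc, ← mul_smul_comm, hy]
    nth_rw 1 2 [hx]
    rw [add_mul, mul_add, mul_add, add_mul]
    abel
  have h2 : completionLinear p n m x * completionLinear p n m y =
      completionLinear p n m (PadicCompletion.of p (levelAlg p n m) a) *
        completionLinear p n m (PadicCompletion.of p (levelAlg p n m) b) + (p : ℤ_[p]) ^ k •
      (completionLinear p n m x' * completionLinear p n m (PadicCompletion.of p (levelAlg p n m) b) +
        completionLinear p n m x * completionLinear p n m y') := by
    have h3 : ∀ {z w : LevelCompletion p n m} {c : levelAlg p n m},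
        z = PadicCompletion.of p (levelAlg p n m) c + (p : ℤ_[p]) ^ k • w →
        completionLinear p n m z = completionLinear p n m (PadicCompletion.of p (levelAlg p n m) c) +
          (p : ℤ_[p]) ^ k • completionLinear p n m w := by
      rintro _ w c rfl
      rw [map_add, map_smul]
    rw [h3 hy, mul_add, mul_smul_comm]
    nth_rewrite 1 [h3 hx]
    rw [add_mul, smul_mul_assoc, smul_add, add_assoc]
  have hS := completionLinear_mem_unitSubring p n m
  refine ⟨_, sub_mem (hS (x' * PadicCompletion.of p (levelAlg p n m) b + x * y'))
    (add_mem (mul_mem (hS x') (hS (PadicCompletion.of p (levelAlg p n m) b)))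
      (mul_mem (hS x) (hS y'))), ?_⟩
  rw [h1, h2, map_add, map_smul, hof, add_sub_add_left_eq_sub, smul_sub]

/-- The extension of `λ` to the completion of `levelAlg`. -/
def completionHom : LevelCompletion p n m →ₐ[ℤ_[p]] AnDist p n :=
  AlgHom.ofLinearMap (completionLinear p n m)
    (by
      have h := completionLinear_of p n m 1
      rwa [map_one (PadicCompletion.of p (levelAlg p n m)), Subalgebra.coe_one,
        map_one (tangentAlgHom p n)] at h)
    (completionLinear_mul p n m)

lemma completionHom_eval_dualMonom (x : LevelCompletion p n m) (ν : Idx →₀ ℕ) :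
    (completionHom p n m x).eval (dualMonom p n ν) =
      (qProd p m ν : ℚ_[p]) * (PadicCompletion.coord (levelBasis p n m) x ν : ℚ_[p]) :=
  completionLinear_eval_dualMonom p n m x ν

lemma completionHom_of (u : levelAlg p n m) :
    completionHom p n m (PadicCompletion.of p (levelAlg p n m) u) = tangentAlgHom p n u :=
  completionLinear_of p n m u

lemma completionHom_injective : Function.Injective (completionHom p n m) := by
  intro x y h
  refine PadicCompletion.coord_injective (levelBasis p n m) (funext fun ν => ?_)
  have h1 := completionHom_eval_dualMonom p n m x ν
  rw [h, completionHom_eval_dualMonom] at h1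
  exact Subtype.ext (mul_left_cancel₀ (qProd_cast_ne_zero p m ν) h1.symm)

lemma exists_pow_smul_completionHom_mem {U : Set (AnDist p n)} (hU : U ∈ 𝓝 0) :
    ∃ k : ℕ, ∀ x, p ^ k • completionHom p n m x ∈ U := by
  obtain ⟨⟨B, ε⟩, ⟨hB, hε⟩, hBU⟩ := AnDist.hasBasis_nhds_zero.mem_iff.mp hU
  obtain ⟨r, C, hC, h⟩ := exists_norm_qProd_le p m
  obtain ⟨M, hM, hBM⟩ := isVonNBounded_iff_gaussNorm.mp hB r
  obtain ⟨k, hk⟩ := exists_pow_lt_of_lt_one (show 0 < ε / (C * M + 1) by positivity)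
    (Padic.norm_p_lt_one (p := p))
  refine ⟨k, fun x => hBU fun F hF => ?_⟩
  have h1 : ‖(completionHom p n m x).eval F‖ ≤ C * gaussNorm r F := by
    refine AnDist.norm_eval_le hC (fun ν => ?_) F
    rw [completionHom_eval_dualMonom, norm_mul]
    exact (mul_le_of_le_one_right (norm_nonneg _) (PadicInt.norm_le_one _)).trans (h ν)
  have h2 : p ^ k • completionHom p n m x = (p : ℚ_[p]) ^ k • completionHom p n m x := by
    rw [← Nat.cast_smul_eq_nsmul ℚ_[p], Nat.cast_pow]
  rw [h2, AnDist.eval_smul, norm_mul, norm_pow]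
  calc _ ≤ ‖(p : ℚ_[p])‖ ^ k * (C * M) := by
        gcongr
        exact h1.trans (by gcongr; exact (hBM F hF).le)
    _ ≤ ‖(p : ℚ_[p])‖ ^ k * (C * M + 1) := by gcongr; linarith
    _ < ε / (C * M + 1) * (C * M + 1) := by gcongr
    _ = ε := by field_simp

lemma continuous_completionHom : Continuous (completionHom p n m) := by
  refine (continuous_latticeTopology_iff (p := p) (Λ := ⊤)
    (completionHom p n m : LevelCompletion p n m →+ AnDist p n)).mpr fun U hU => ?_
  obtain ⟨k, hk⟩ := exists_pow_smul_completionHom_mem p n m hU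
  refine ⟨k, fun y _ => ?_⟩
  rw [map_nsmul]
  exact hk y

lemma denseRange_of : DenseRange (PadicCompletion.of p (levelAlg p n m)) := by
  rw [DenseRange, dense_iff_inter_open]
  rintro U hU ⟨x, hx⟩
  obtain ⟨k, hk⟩ := hU x hx
  obtain ⟨a, y, hxa⟩ := PadicCompletion.exists_eq_of_add_smul (levelBasis p n m) x k
  refine ⟨_, ?_, a, rfl⟩
  have h := hk (-y) trivial
  have h1 : (p : ℤ_[p]) ^ k • y = p ^ k • y := by
    rw [← Nat.cast_smul_eq_nsmul ℤ_[p], Nat.cast_pow]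
  rw [hxa, h1, smul_neg, add_neg_cancel_right] at h
  exact h

lemma eq_completionHom {Ψ : LevelCompletion p n m → AnDist p n} (hc : Continuous Ψ)
    (h : ∀ u : levelAlg p n m, Ψ (PadicCompletion.of p (levelAlg p n m) u) = tangentAlgHom p n u) :
    Ψ = completionHom p n m :=
  (denseRange_of p n m).equalizer hc (continuous_completionHom p n m)
    (funext fun u => (h u).trans (completionHom_of p n m u).symm)

end LevelMap

section Limit

variable (p : ℕ) [Fact p.Prime] (n m : ℕ)

lemma completionHom_map {m m' : ℕ} (h : m ≤ m') (x : LevelCompletion p n m) :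
    completionHom p n m' (PadicCompletion.map p (Subalgebra.inclusion (levelAlg_mono p n h)) x) =
      completionHom p n m x := by
  refine sub_eq_zero.mp (AnDist.eq_zero_of_forall_eq_smul fun k => ?_)
  obtain ⟨a, y, rfl⟩ := PadicCompletion.exists_eq_of_add_smul (levelBasis p n m) x k
  refine ⟨_, sub_mem (completionLinear_mem_unitSubring p n m'
    (PadicCompletion.map p (Subalgebra.inclusion (levelAlg_mono p n h)) y))
    (completionLinear_mem_unitSubring p n m y), ?_⟩
  have h1 : PadicCompletion.map p (Subalgebra.inclusion (levelAlg_mono p n h))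
      (PadicCompletion.of p (levelAlg p n m) a) =
      PadicCompletion.of p (levelAlg p n m') (Subalgebra.inclusion (levelAlg_mono p n h) a) := rfl
  rw [map_add, map_add, map_add, map_smul, map_smul, map_smul, h1, completionHom_of,
    completionHom_of, Subalgebra.coe_inclusion, add_sub_add_left_eq_sub, smul_sub]
  rfl

lemma exists_completionHom_eq {δ : AnDist p n}
    (h : ∀ ν, ‖δ.eval (dualMonom p n ν)‖ ≤ ‖(qProd p m ν : ℚ_[p])‖)
    (h0 : Filter.Tendsto (fun ν => ‖δ.eval (dualMonom p n ν)‖ / ‖(qProd p m ν : ℚ_[p])‖)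
      Filter.cofinite (𝓝 0)) : ∃ x, completionHom p n m x = δ := by
  have hp : 0 < (p : ℝ) := by exact_mod_cast (Fact.out : p.Prime).pos
  let c : (Idx →₀ ℕ) → ℤ_[p] := fun ν => ⟨δ.eval (dualMonom p n ν) / qProd p m ν, by
    rw [norm_div]
    exact div_le_one_of_le₀ (h ν) (norm_nonneg _)⟩
  obtain ⟨x, hx⟩ := PadicCompletion.exists_coord_eq (levelBasis p n m) (c := c) (fun k => by
    have h1 := h0.eventually (gt_mem_nhds (show (0 : ℝ) < (p : ℝ) ^ (-(k : ℤ)) by positivity))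
    rw [Filter.eventually_cofinite] at h1
    refine h1.subset fun ν hν hlt => hν ?_
    rw [← Ideal.mem_span_singleton, ← PadicInt.norm_le_pow_iff_mem_span_pow, PadicInt.norm_def]
    change ‖δ.eval (dualMonom p n ν) / qProd p m ν‖ ≤ _
    rw [norm_div]
    exact hlt.le)
  refine ⟨x, AnDist.ext_dualMonom fun ν => ?_⟩
  rw [completionHom_eval_dualMonom, hx]
  exact mul_div_cancel₀ _ (qProd_cast_ne_zero p m ν)

variable {p n}

lemma AnDist.exists_tendsto_div_qProd (δ : AnDist p n) : ∃ m : ℕ, Filter.Tendsto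
    (fun ν => ‖δ.eval (dualMonom p n ν)‖ / ‖(qProd p m ν : ℚ_[p])‖) Filter.cofinite (𝓝 0) := by
  obtain ⟨r, C, hC, h⟩ := δ.exists_bound_dualMonom
  obtain ⟨s, hrs, hs1⟩ := exists_between r.2.2
  have hr0 := r.2.1
  have hs0 : 0 < s := r.2.1.trans hrs
  obtain ⟨m, hm⟩ := exists_pow_le_norm_qProd p hs0.le hs1
  have ht : Filter.Tendsto (fun ν : Idx →₀ ℕ => C * ((r : ℝ) / s) ^ ν.degree)
      Filter.cofinite (𝓝 0) := by
    simpa using (tendsto_pow_degree (by positivity) ((div_lt_one hs0).mpr hrs)).const_mul C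
  refine ⟨m, squeeze_zero (fun ν => by positivity) (fun ν => ?_) ht⟩
  rw [div_pow, ← mul_div_assoc]
  exact div_le_div₀ (by positivity) (h ν) (by positivity) (hm ν)

variable (p n)

lemma pow_smul_eq (k : ℕ) (δ : AnDist p n) : p ^ k • δ = (p : ℚ_[p]) ^ k • δ := by
  rw [← Nat.cast_smul_eq_nsmul ℚ_[p], Nat.cast_pow]

lemma smul_pbw_mem {L : AddSubgroup (AnDist p n)} {k : ℕ}
    (hL : ∀ x, p ^ k • completionHom p n m x ∈ L) {ν : Idx →₀ ℕ} {c : ℚ_[p]}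
    (hc : ‖c‖ ≤ ‖(p : ℚ_[p]) ^ k * qProd p m ν‖) : c • AnDist.pbw ν ∈ L := by
  have h0 : (p : ℚ_[p]) ^ k * qProd p m ν ≠ 0 :=
    mul_ne_zero (pow_ne_zero _ prime_cast_ne_zero) (qProd_cast_ne_zero p m ν)
  let z : ℤ_[p] := ⟨c / ((p : ℚ_[p]) ^ k * qProd p m ν), by
    rw [norm_div]
    exact div_le_one_of_le₀ hc (norm_nonneg _)⟩
  have hz : (z : ℚ_[p]) * ((p : ℚ_[p]) ^ k * qProd p m ν) = c := div_mul_cancel₀ c h0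
  have h := hL (z • PadicCompletion.of p (levelAlg p n m) (levelAlgElem p n m ν))
  have h1 : z • tangentAlgHom p n (levelBasisElem p n m ν) =
      (z : ℚ_[p]) • tangentAlgHom p n (levelBasisElem p n m ν) := rfl
  rw [map_smul, completionHom_of, levelAlgElem, h1, tangentAlgHom_levelBasisElem, pow_smul_eq,
    smul_smul, smul_smul] at h
  rwa [← hz, mul_left_comm, ← mul_assoc]

lemma isVonNBounded_smul_dualMonom (k : ℕ → ℕ) : Bornology.IsVonNBounded ℚ_[p]
    {F | ∃ (c : ℚ_[p]) (ν : Idx →₀ ℕ), F = c • dualMonom p n ν ∧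
      ∀ m, ‖c‖ * ‖(p : ℚ_[p]) ^ k m * qProd p m ν‖ ≤ 1} := by
  rw [isVonNBounded_iff_gaussNorm]
  intro r
  obtain ⟨m, hm⟩ := exists_pow_le_norm_qProd p r.2.1.le r.2.2
  have hp : 0 < ‖(p : ℚ_[p]) ^ k m‖ := norm_pos_iff.mpr (pow_ne_zero _ prime_cast_ne_zero)
  refine ⟨‖(p : ℚ_[p]) ^ k m‖⁻¹ + 1, by positivity, ?_⟩
  rintro _ ⟨c, ν, rfl, hc⟩
  refine lt_of_le_of_lt ?_ (lt_add_one _)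
  have h := hc m
  rw [norm_mul, mul_left_comm, ← le_div_iff₀' hp, one_div] at h
  rw [map_smul_eq_mul]
  refine le_trans ?_ h
  gcongr
  exact (gaussNorm_dualMonom_le r ν).trans (hm ν)

/-- A subgroup of `D^an` that contains a neighbourhood of `0` of each of the completions
is a neighbourhood of `0`. -/
lemma mem_nhds_zero_of_completionHom_mem (k : ℕ → ℕ) {L : AddSubgroup (AnDist p n)}
    (hL : ∀ m x, p ^ k m • completionHom p n m x ∈ L) : (L : Set (AnDist p n)) ∈ 𝓝 0 := by
  classical
  refine Filter.mem_of_superset (AnDist.hasBasis_nhds_zero.mem_of_mem (i := (_, 1))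
    ⟨isVonNBounded_smul_dualMonom p n k, one_pos⟩) fun δ hδ => ?_
  have hsingle : ∀ ν, δ.eval (dualMonom p n ν) • AnDist.pbw ν ∈ L := by
    intro ν
    obtain ⟨m, hm⟩ : ∃ m, ‖δ.eval (dualMonom p n ν)‖ ≤ ‖(p : ℚ_[p]) ^ k m * qProd p m ν‖ := by
      by_contra! hlt
      have h0 : 0 < ‖δ.eval (dualMonom p n ν)‖ := (norm_nonneg _).trans_lt (hlt 0)
      have h1 := hδ ((δ.eval (dualMonom p n ν))⁻¹ • dualMonom p n ν) ⟨_, ν, rfl, fun m => by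
        rw [norm_inv, inv_mul_le_one₀ h0]
        exact (hlt m).le⟩
      rw [map_smul, smul_eq_mul, inv_mul_cancel₀ (norm_pos_iff.mp h0), norm_one] at h1
      exact lt_irrefl _ h1
    exact smul_pbw_mem p n m (hL m) hm
  obtain ⟨m, hm⟩ := δ.exists_tendsto_div_qProd
  have hp0 : (p : ℚ_[p]) ^ k m ≠ 0 := pow_ne_zero _ prime_cast_ne_zero
  have hp : 0 < ‖(p : ℚ_[p]) ^ k m‖ := norm_pos_iff.mpr hp0
  have hfin := hm.eventually (gt_mem_nhds hp)
  rw [Filter.eventually_cofinite] at hfin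
  have hsum : ∑ ν ∈ hfin.toFinset, δ.eval (dualMonom p n ν) • (AnDist.pbw ν : AnDist p n) ∈ L :=
    sum_mem fun ν _ => hsingle ν
  set δ' := δ - ∑ ν ∈ hfin.toFinset, δ.eval (dualMonom p n ν) • (AnDist.pbw ν : AnDist p n)
    with hδ'
  have heval : ∀ κ, δ'.eval (dualMonom p n κ) =
      if κ ∈ hfin.toFinset then 0 else δ.eval (dualMonom p n κ) := by
    intro κ
    have h1 : δ'.eval (dualMonom p n κ) = δ.eval (dualMonom p n κ) - (∑ ν ∈ hfin.toFinset,
      δ.eval (dualMonom p n ν) • (AnDist.pbw ν : AnDist p n)).eval (dualMonom p n κ) := rfl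
    rw [h1, AnDist.eval_sum]
    simp only [AnDist.eval_smul, AnDist.pbw_eval_dualMonom, mul_ite, mul_one, mul_zero,
      Finset.sum_ite_eq']
    split_ifs <;> simp
  obtain ⟨x, hx⟩ := exists_completionHom_eq p n m (δ := ((p : ℚ_[p]) ^ k m)⁻¹ • δ')
    (fun ν => by
      have hq := norm_pos_iff.mpr (qProd_cast_ne_zero p m ν)
      rw [AnDist.eval_smul, heval]
      split_ifs with hν
      · simp
      · rw [Set.Finite.mem_toFinset, Set.mem_ofPred_eq, not_not, div_lt_iff₀ hq] at hν
        rw [norm_mul, norm_inv, inv_mul_le_iff₀ hp]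
        exact hν.le)
    (by
      have h1 := hm.const_mul ‖((p : ℚ_[p]) ^ k m)⁻¹‖
      rw [mul_zero] at h1
      refine squeeze_zero (fun ν => by positivity) (fun ν => ?_) h1
      rw [AnDist.eval_smul, heval, norm_mul, mul_div_assoc]
      split_ifs
      · rw [norm_zero, zero_div, mul_zero]
        positivity
      · exact le_rfl)
  have h1 := hL m x
  rw [hx, pow_smul_eq, smul_inv_smul₀ hp0, hδ'] at h1
  have h2 := add_mem h1 hsum
  rwa [sub_add_cancel] at h2

lemma exists_eq_inv_pow_tmul {A : Type} [Ring A] [Algebra ℤ_[p] A] (z : CompletionQ p A) :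
    ∃ (N : ℕ) (x : PadicCompletion p A), z = ((p : ℚ_[p]) ^ N)⁻¹ ⊗ₜ x := by
  have hp : ∀ N : ℕ, (p : ℚ_[p]) ^ N ≠ 0 := fun N => pow_ne_zero _ prime_cast_ne_zero
  have hsm : ∀ (a : ℤ_[p]) (c : ℚ_[p]) (x : PadicCompletion p A),
      (c ⊗ₜ (a • x) : CompletionQ p A) = ((a : ℚ_[p]) * c) ⊗ₜ x := fun a c x => by
    rw [← TensorProduct.smul_tmul]
    rfl
  induction z using TensorProduct.induction_on with
  | zero => exact ⟨0, 0, by rw [TensorProduct.tmul_zero]⟩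
  | tmul c x =>
    obtain ⟨N, hN⟩ : ∃ N : ℕ, ‖(p : ℚ_[p]) ^ N * c‖ ≤ 1 := by
      obtain ⟨N, hN⟩ := exists_pow_lt_of_lt_one (show 0 < (‖c‖ + 1)⁻¹ by positivity)
        (Padic.norm_p_lt_one (p := p))
      refine ⟨N, ?_⟩
      rw [norm_mul, norm_pow]
      calc _ ≤ (‖c‖ + 1)⁻¹ * (‖c‖ + 1) := by gcongr; linarith
        _ = 1 := inv_mul_cancel₀ (by positivity)
    let a : ℤ_[p] := ⟨_, hN⟩
    refine ⟨N, a • x, ?_⟩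
    rw [hsm]
    congr 1
    change c = (p : ℚ_[p]) ^ N * c * _
    rw [mul_right_comm, mul_inv_cancel₀ (hp N), one_mul]
  | add z w hz hw =>
    obtain ⟨N, x, rfl⟩ := hz
    obtain ⟨M, y, rfl⟩ := hw
    refine ⟨N + M, (p : ℤ_[p]) ^ M • x + (p : ℤ_[p]) ^ N • y, ?_⟩
    rw [TensorProduct.tmul_add, hsm, hsm]
    congr 2
    · push_cast
      rw [pow_add]
      field_simp [hp N, hp M]
    · push_cast
      rw [pow_add]
      field_simp [hp N, hp M]

lemma commute_ofId (c : ℚ_[p]) (δ : AnDist p n) :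
    Commute (Algebra.ofId ℚ_[p] (AnDist p n) c) δ := Algebra.commutes c δ

/-- The `ℚ_p`-linear extension of `completionHom`. -/
def completionQHom : LevelCompletionQ p n m →ₐ[ℚ_[p]] AnDist p n :=
  Algebra.TensorProduct.lift (Algebra.ofId ℚ_[p] (AnDist p n)) (completionHom p n m)
    fun c x => commute_ofId p n c (completionHom p n m x)

lemma completionQHom_tmul (c : ℚ_[p]) (x : LevelCompletion p n m) :
    completionQHom p n m (c ⊗ₜ x) = c • completionHom p n m x := by
  rw [completionQHom, Algebra.TensorProduct.lift_tmul, Algebra.smul_def]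
  rfl

lemma completionQHom_injective : Function.Injective (completionQHom p n m) := by
  rw [injective_iff_map_eq_zero]
  intro z hz
  obtain ⟨N, x, rfl⟩ := exists_eq_inv_pow_tmul p z
  rw [completionQHom_tmul, smul_eq_zero_iff_right
    (inv_ne_zero (pow_ne_zero _ prime_cast_ne_zero))] at hz
  rw [(map_eq_zero_iff _ (completionHom_injective p n m)).mp hz, TensorProduct.tmul_zero]

lemma completionQHom_levelTransition {m m' : ℕ} (h : m ≤ m') (z : LevelCompletionQ p n m) :
    completionQHom p n m' (levelTransition p n m m' h z) = completionQHom p n m z := by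
  induction z using TensorProduct.induction_on with
  | zero => rw [map_zero, map_zero, map_zero]
  | add z w hz hw => rw [map_add, map_add, map_add, hz, hw]
  | tmul c x =>
    rw [levelTransition, CompletionQ.map, Algebra.TensorProduct.map_tmul, completionQHom_tmul,
      completionQHom_tmul, completionHom_map p n h]
    rfl

/-- The map induced by the maps `completionQHom` on the direct limit. -/
def limitHom : LevelLimit p n →ₐ[ℚ_[p]] AnDist p n :=
  DirectLimit.Algebra.lift (LevelCompletionQ p n) (fun m m' h => levelTransition p n m m' h)
    (AnDist p n) (completionQHom p n) fun _ _ h z => completionQHom_levelTransition p n h z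

lemma limitHom_of (z : LevelCompletionQ p n m) :
    limitHom p n (LevelLimit.of p n m z) = completionQHom p n m z := rfl

lemma LevelLimit.exists_of_eq (z : LevelLimit p n) : ∃ m w, LevelLimit.of p n m w = z := by
  induction z using DirectLimit.induction with
  | _ m w => exact ⟨m, w, rfl⟩

lemma limitHom_injective : Function.Injective (limitHom p n) := by
  rw [injective_iff_map_eq_zero]
  intro z hz
  obtain ⟨m, w, rfl⟩ := LevelLimit.exists_of_eq p n z
  rw [limitHom_of] at hz
  rw [(map_eq_zero_iff _ (completionQHom_injective p n m)).mp hz, map_zero]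

lemma limitHom_surjective : Function.Surjective (limitHom p n) := by
  intro δ
  obtain ⟨m, hm⟩ := δ.exists_tendsto_div_qProd
  obtain ⟨C, hC⟩ := hm.bddAbove_range_of_cofinite
  have hC0 : ∀ ν, ‖δ.eval (dualMonom p n ν)‖ / ‖(qProd p m ν : ℚ_[p])‖ ≤ C :=
    fun ν => hC ⟨ν, rfl⟩
  have hC1 : 0 ≤ C := (by positivity : (0 : ℝ) ≤ _).trans (hC0 0)
  obtain ⟨N, hN⟩ := exists_pow_lt_of_lt_one (show 0 < (C + 1)⁻¹ by positivity)
    (Padic.norm_p_lt_one (p := p))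
  obtain ⟨x, hx⟩ := exists_completionHom_eq p n m (δ := (p : ℚ_[p]) ^ N • δ)
    (fun ν => by
      have hq := norm_pos_iff.mpr (qProd_cast_ne_zero p m ν)
      have h1 := hC0 ν
      rw [div_le_iff₀ hq] at h1
      rw [AnDist.eval_smul, norm_mul, norm_pow]
      calc _ ≤ (C + 1)⁻¹ * (C * ‖(qProd p m ν : ℚ_[p])‖) := by gcongr
        _ = (C + 1)⁻¹ * C * ‖(qProd p m ν : ℚ_[p])‖ := by ring
        _ ≤ 1 * ‖(qProd p m ν : ℚ_[p])‖ := by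
          gcongr
          rw [inv_mul_le_one₀ (by positivity)]
          linarith
        _ = _ := one_mul _)
    (by
      have h1 := hm.const_mul ‖(p : ℚ_[p]) ^ N‖
      rw [mul_zero] at h1
      refine h1.congr fun ν => ?_
      rw [AnDist.eval_smul, norm_mul, mul_div_assoc])
  refine ⟨LevelLimit.of p n m (((p : ℚ_[p]) ^ N)⁻¹ ⊗ₜ x), ?_⟩
  rw [limitHom_of, completionQHom_tmul, hx,
    inv_smul_smul₀ (pow_ne_zero _ prime_cast_ne_zero)]

lemma continuous_completionQHom : Continuous[completionQTopology p (levelAlg p n m), _]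
    (completionQHom p n m) := by
  refine (continuous_latticeTopology_iff
    (completionQHom p n m : LevelCompletionQ p n m →+ AnDist p n)).mpr fun U hU => ?_
  obtain ⟨k, hk⟩ := exists_pow_smul_completionHom_mem p n m hU
  refine ⟨k, ?_⟩
  rintro _ ⟨x, rfl⟩
  have h1 : completionQHom p n m (1 ⊗ₜ x) = completionHom p n m x := by
    rw [completionQHom_tmul, one_smul]
  rw [map_nsmul]
  exact h1.symm ▸ hk x

lemma isLocallyConvexTopology_induced {E : Type} [AddCommGroup E] [Module ℚ_[p] E]
    (f : E →ₗ[ℚ_[p]] AnDist p n) :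
    IsLocallyConvexTopology p (TopologicalSpace.induced f inferInstance) where
  isTopologicalAddGroup := topologicalAddGroup_induced f
  continuousSMul := continuousSMul_induced f
  exists_submodule U hU := by
    rw [nhds_induced, map_zero, Filter.mem_comap] at hU
    obtain ⟨V, hV, hVU⟩ := hU
    obtain ⟨L, hL, hL0, hLV⟩ := AnDist.exists_addSubgroup hV
    refine ⟨L.comap (f : E →+ AnDist p n), fun a x hx => ?_, ?_,
      (Set.preimage_mono hLV).trans hVU⟩
    · change f ((a : ℚ_[p]) • x) ∈ L
      rw [map_smul]
      exact hL a _ hx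
    · rw [nhds_induced, map_zero]
      exact Filter.preimage_mem_comap hL0

lemma continuous_limitHom : Continuous (limitHom p n) := by
  refine continuous_sInf_dom (t := TopologicalSpace.induced (limitHom p n).toLinearMap inferInstance)
    ⟨isLocallyConvexTopology_induced p n _, fun m => ?_⟩ continuous_induced_dom
  rw [continuous_induced_rng]
  exact continuous_completionQHom p n m

/-- The isomorphism of algebras induced by the maps `completionQHom` on the direct limit. -/
def limitEquiv : LevelLimit p n ≃ₐ[ℚ_[p]] AnDist p n :=
  AlgEquiv.ofBijective (limitHom p n) ⟨limitHom_injective p n, limitHom_surjective p n⟩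

lemma limitEquiv_of_tmul (x : LevelCompletion p n m) :
    limitEquiv p n (LevelLimit.of p n m (1 ⊗ₜ x)) = completionHom p n m x := by
  refine (limitHom_of p n m (1 ⊗ₜ x)).trans ?_
  rw [completionQHom_tmul, one_smul]

lemma continuous_limitEquiv_symm : Continuous (limitEquiv p n).symm := by
  refine continuous_sInf_rng.mpr ?_
  rintro t ⟨ht, hof⟩
  let _ : TopologicalSpace (LevelLimit p n) := t
  have := ht.isTopologicalAddGroup
  refine continuous_of_continuousAt_zero ((limitEquiv p n).symm : AnDist p n →+ LevelLimit p n) ?_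
  rw [ContinuousAt, map_zero]
  intro U hU
  obtain ⟨L, -, hL, hLU⟩ := ht.exists_submodule U hU
  have hk : ∀ m, ∃ k : ℕ, ∀ x : LevelCompletion p n m,
      p ^ k • LevelLimit.of p n m (1 ⊗ₜ x) ∈ L := by
    intro m
    obtain ⟨k, hk⟩ := (continuous_latticeTopology_iff
      (LevelLimit.of p n m : LevelCompletionQ p n m →+ LevelLimit p n)).mp (hof m) L hL
    refine ⟨k, fun x => ?_⟩
    rw [← map_nsmul]
    exact hk _ ⟨x, rfl⟩
  choose k hk using hk
  have h := mem_nhds_zero_of_completionHom_mem p n k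
    (L := L.comap ((limitEquiv p n).symm : AnDist p n →+ LevelLimit p n)) (fun m x => by
      change (limitEquiv p n).symm (p ^ k m • completionHom p n m x) ∈ L
      rw [map_nsmul, ← limitEquiv_of_tmul, AlgEquiv.symm_apply_apply]
      exact hk m x)
  exact Filter.mem_of_superset h fun δ hδ => hLU hδ

/-- The isomorphism of topological algebras between the direct limit and `D^an`. -/
def limitContinuousEquiv : LevelLimit p n ≃A[ℚ_[p]] AnDist p n :=
  { limitEquiv p n with
    continuous_toFun := continuous_limitHom p n
    continuous_invFun := continuous_limitEquiv_symm p n }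

end Limit
end GL2Dist
end

theorem mainTheorem4 (p : ℕ) [Fact p.Prime] (n : ℕ) (hn : 1 ≤ n) :
    (∀ m : ℕ, Subalgebra.toSubmodule (levelAlg p n m) = levelModule p n m) ∧
    (∃! lam : Ug p →ₐ[ℚ_[p]] AnDist p n, IsTangentMap n lam) ∧
    ∀ lam : Ug p →ₐ[ℚ_[p]] AnDist p n, IsTangentMap n lam →
      ∃ Ψ : ∀ m : ℕ, LevelCompletion p n m →ₐ[ℤ_[p]] AnDist p n,
        (∀ m, Continuous (Ψ m) ∧
          (∀ u : levelAlg p n m, Ψ m (PadicCompletion.of p (levelAlg p n m) u) = lam u) ∧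
          ∀ Ψ' : LevelCompletion p n m → AnDist p n, Continuous Ψ' →
            (∀ u : levelAlg p n m, Ψ' (PadicCompletion.of p (levelAlg p n m) u) = lam u) →
            Ψ' = Ψ m) ∧
        ∃ Φ : LevelLimit p n ≃A[ℚ_[p]] AnDist p n,
          ∀ (m : ℕ) (x : LevelCompletion p n m), Φ (LevelLimit.of p n m (1 ⊗ₜ x)) = Ψ m x := by
  refine ⟨toSubmodule_levelAlg p n, ⟨tangentAlgHom p n, (isTangentMap_iff _).mpr rfl,
    fun lam h => (isTangentMap_iff lam).mp h⟩, fun lam h => ?_⟩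
  obtain rfl := (isTangentMap_iff lam).mp h
  exact ⟨completionHom p n, fun m => ⟨continuous_completionHom p n m, completionHom_of p n m,
    fun _ hc hu => eq_completionHom p n m hc hu⟩, limitContinuousEquiv p n,
    limitEquiv_of_tmul p n⟩
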